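/- For a Dirichlet character $\chi$ modulo $q$ and real $y$ let $\psi(y,\chi)=\sum_{n\le y}\Lambda(n)\chi(n)$, where $\Lambda$ is the von Mangoldt function. For every $\varepsilon>0$ there is a constant $C=C(\varepsilon)>0$ such that for all real $x\ge 4$ and all real $Q>0$ $$\sum_{q\le Q}\frac{q}{\varphi(q)}\sum_{\substack{\chi \bmod q\\ \chi\ \mathrm{primitive}}}\ \max_{y\le x}|\psi(y,\chi)|\ \le\ C\left(x+Q^2x^{\frac12}+Q\,x^{\frac{13}{14}+\varepsilon}\right)(\log x)^2,$$ where $q$ runs over the positive integers up to $Q$, $\varphi$ is Euler's totient function, the inner sum is over all primitive Dirichlet characters $\chi$ modulo $q$, and the maximum is over all real $y\le x$. -/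

import Mathlib

open scoped Classical in
/-- The finite set of primitive Dirichlet characters modulo `q`. -/
noncomputable def primitiveCharacters (q : ℕ) : Finset (DirichletCharacter ℂ q) :=
  haveI : Finite (ZMod q)ˣ := by
    rcases q with _ | n
    · exact inferInstanceAs (Finite ℤˣ)
    · infer_instance
  (Set.toFinite {χ : DirichletCharacter ℂ q | χ.IsPrimitive}).toFinset

theorem mem_primitiveCharacters {q : ℕ} (χ : DirichletCharacter ℂ q) :
    χ ∈ primitiveCharacters q ↔ χ.IsPrimitive := by
  simp [primitiveCharacters]

/-- The twisted Chebyshev function `ψ(y, χ) = ∑_{n ≤ y} Λ(n) χ(n)`, for real `y`. -/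
noncomputable def psiChar {q : ℕ} (y : ℝ) (χ : DirichletCharacter ℂ q) : ℂ :=
  ∑ n ∈ Finset.Icc 1 ⌊y⌋₊, (ArithmeticFunction.vonMangoldt n : ℂ) * χ (n : ZMod q)

/-- `max_{y ≤ x} |ψ(y, χ)|`, the maximum over all real `y ≤ x`. -/
noncomputable def maxPsiChar {q : ℕ} (x : ℝ) (χ : DirichletCharacter ℂ q) : ℝ :=
  sSup ((fun y : ℝ => ‖psiChar y χ‖) '' Set.Iic x)

/-- The supremum in `maxPsiChar` is attained, hence is a maximum. -/
theorem isGreatest_maxPsiChar {q : ℕ} (x : ℝ) (χ : DirichletCharacter ℂ q) :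
    IsGreatest ((fun y : ℝ => ‖psiChar y χ‖) '' Set.Iic x) (maxPsiChar x χ) := by
  have hfin : ((fun y : ℝ => ‖psiChar y χ‖) '' Set.Iic x).Finite := by
    refine ((Set.finite_Iic ⌊x⌋₊).image
      (fun m : ℕ => ‖psiChar (m : ℝ) χ‖)).subset ?_
    rintro _ ⟨y, hy, rfl⟩
    refine ⟨⌊y⌋₊, Nat.floor_mono hy, ?_⟩
    simp [psiChar]
  have hne : ((fun y : ℝ => ‖psiChar y χ‖) '' Set.Iic x).Nonempty :=
    ⟨_, x, le_refl x, rfl⟩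
  exact ⟨hne.csSup_mem hfin, fun _ ha => le_csSup hfin.bddAbove ha⟩

/-! Partition the range of `R = ⌊Q⌋` at `R ^ 2 = x`. Above it, the large sieve applied directly to
`Λ` already gives `R²√x log² x`. Below it, Vaughan's identity with a smooth mollifier `λ`
(`vonMangoldt_eq_mollified`) splits `Λ` into pieces with a free variable and one bilinear piece.
With `U = x^u`, the mollifier is `μ(d)` times a smooth cutoff that equals 1 for `d ≤ x^u` and
vanishes for `d ≥ x^(u+η)`.

The pieces with a free variable contain full character sums, which `polya_vinogradov` bounds by `√q
log q`. Their total is `R^(5/2) x^(2u+η) log² x`. The trivial character modulo 1 is handled by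
Chebyshev's bound and gives the term `x`.

The bilinear piece is `Λ` on `n > U` convolved with `λ * 1 - 1`, which also vanishes on `n ≤ U`.
Cauchy–Schwarz and the multiplicative large sieve apply on each dyadic block, after
`exists_separation` has removed the condition `mn ≤ y` uniformly in `y`. This gives `x + R x^(1-u/2)
+ √x R²`.

The exponent 2 of the logarithm needs care. Separation of variables costs one logarithm and the
number of dyadic blocks another, so a block itself may cost none. The mean square of `Λ` loses a
logarithm, and it is recovered because the mean square of `λ * 1` is `O(1 / log x)`
(`exists_smoothed_moebius`). A sharp truncation of `μ` is not used there: smoothness turns `λ * 1`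
into an average of the products `∏ (1 - p^(iτ))` over `p ∣ n`, which are small on average since
their factors are small at small primes.

Finally `u` is chosen in terms of `log R / log x` (`exists_truncation_exponent`). The value `u =
1/7`, for which `1 - u/2 = 13/14`, produces the exponent in the third term. -/

section
open Finset Complex

/-! ### Geometric exponential sums and the additive large sieve -/

/-- The additive character `θ ↦ exp (2πiθ)` of the real line. -/
noncomputable def expTwoPi (θ : ℝ) : ℂ := cexp (2 * Real.pi * θ * I)

theorem expTwoPi_add (x y : ℝ) : expTwoPi (x + y) = expTwoPi x * expTwoPi y := by
  simp only [expTwoPi, ← Complex.exp_add]; push_cast; ring_nf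

theorem expTwoPi_zero : expTwoPi 0 = 1 := by simp [expTwoPi]

theorem norm_expTwoPi (x : ℝ) : ‖expTwoPi x‖ = 1 := by
  have := Complex.norm_exp_ofReal_mul_I (2 * Real.pi * x)
  simpa [expTwoPi] using this

theorem conj_expTwoPi (x : ℝ) : (starRingEnd ℂ) (expTwoPi x) = expTwoPi (-x) := by
  simp only [expTwoPi, ← Complex.exp_conj]
  congr 1
  simp [Complex.conj_ofNat]

theorem expTwoPi_intCast (n : ℤ) : expTwoPi n = 1 := by
  rw [expTwoPi, Complex.exp_eq_one_iff]
  exact ⟨n, by push_cast; ring⟩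

theorem expTwoPi_nat_mul (n : ℕ) (x : ℝ) : expTwoPi (n * x) = expTwoPi x ^ n := by
  simp only [expTwoPi, ← Complex.exp_nat_mul]; push_cast; ring_nf

/-- The geometric sum `∑_{j < N} exp (2πijθ)`. -/
noncomputable def expSum (N : ℕ) (θ : ℝ) : ℂ := ∑ j ∈ range N, expTwoPi (j * θ)

theorem norm_expSum_le (N : ℕ) (θ : ℝ) : ‖expSum N θ‖ ≤ N := by
  refine (norm_sum_le _ _).trans ?_
  simp [norm_expTwoPi]

theorem norm_expTwoPi_sub_one (θ : ℝ) : ‖expTwoPi θ - 1‖ = 2 * |Real.sin (Real.pi * θ)| := by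
  have := Complex.norm_exp_I_mul_ofReal_sub_one (2 * Real.pi * θ)
  rw [show 2 * Real.pi * θ / 2 = Real.pi * θ by ring] at this
  rw [norm_mul, Real.norm_eq_abs, Real.norm_eq_abs, abs_two] at this
  rw [← this, expTwoPi]
  push_cast
  ring_nf

theorem norm_expSum_mul_sin_le (N : ℕ) (θ : ℝ) :
    ‖expSum N θ‖ * |Real.sin (Real.pi * θ)| ≤ 1 := by
  have h : expSum N θ * (expTwoPi θ - 1) = expTwoPi (N * θ) - 1 := by
    simp only [expSum, expTwoPi_nat_mul]
    exact geom_sum_mul _ _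
  have h1 : ‖expSum N θ‖ * (2 * |Real.sin (Real.pi * θ)|) ≤ 2 := by
    rw [← norm_expTwoPi_sub_one, ← norm_mul, h]
    refine (norm_sub_le _ _).trans ?_
    rw [norm_expTwoPi]; norm_num
  linarith

theorem min_le_sin_pi_mul {θ : ℝ} (h0 : 0 ≤ θ) (h1 : θ ≤ 1) :
    2 * min θ (1 - θ) ≤ Real.sin (Real.pi * θ) := by
  have key : ∀ t : ℝ, 0 ≤ t → t ≤ 1 / 2 → 2 * t ≤ Real.sin (Real.pi * t) := by
    intro t h0 h1
    have := Real.mul_le_sin (x := Real.pi * t) (by positivity) (by nlinarith [Real.pi_pos])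
    have e : 2 / Real.pi * (Real.pi * t) = 2 * t := by field_simp
    linarith
  rcases le_total θ (1 / 2) with h | h
  · rw [min_eq_left (by linarith)]; exact key θ h0 h
  · rw [min_eq_right (by linarith)]
    have := key (1 - θ) (by linarith) (by linarith)
    rwa [show Real.pi * (1 - θ) = Real.pi - Real.pi * θ by ring, Real.sin_pi_sub] at this

theorem norm_expSum_mul_min_le (N : ℕ) {θ : ℝ} (h0 : 0 ≤ θ) (h1 : θ ≤ 1) :
    ‖expSum N θ‖ * (2 * min θ (1 - θ)) ≤ 1 := by
  refine le_trans ?_ (norm_expSum_mul_sin_le N θ)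
  gcongr
  exact (min_le_sin_pi_mul h0 h1).trans (le_abs_self _)

theorem expTwoPi_add_int (x : ℝ) (z : ℤ) : expTwoPi (x + z) = expTwoPi x := by
  rw [expTwoPi_add, expTwoPi_intCast, mul_one]

theorem expSum_add_int (N : ℕ) (θ : ℝ) (z : ℤ) : expSum N (θ + z) = expSum N θ := by
  refine sum_congr rfl fun j _ => ?_
  have : (j : ℝ) * (θ + z) = j * θ + ((j * z : ℤ) : ℝ) := by push_cast; ring
  rw [this, expTwoPi_add_int]

theorem expSum_fract (N : ℕ) (θ : ℝ) : expSum N (Int.fract θ) = expSum N θ := by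
  conv_rhs => rw [← Int.fract_add_floor θ]
  rw [expSum_add_int]

theorem conj_expSum (N : ℕ) (θ : ℝ) : (starRingEnd ℂ) (expSum N θ) = expSum N (-θ) := by
  simp only [expSum, map_sum, conj_expTwoPi, mul_neg]

theorem norm_expSum_neg (N : ℕ) (θ : ℝ) : ‖expSum N (-θ)‖ = ‖expSum N θ‖ := by
  rw [← conj_expSum, RCLike.norm_conj]

/-- Schur's test. After expanding the square, the sums over `j` and `k` factor into `‖expSum‖ ^ 2`,
and `2‖c r‖‖c s‖ ≤ ‖c r‖² + ‖c s‖²` leaves only row sums of this kernel. -/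
theorem sum_norm_sq_sub_le {ι : Type*} (S : Finset ι) (α : ι → ℝ) (H : ℕ) (B : ℝ)
    (hB : ∀ r ∈ S, ∑ s ∈ S, ‖expSum (2 * H) (α r - α s)‖ ^ 2 ≤ B) (c : ι → ℂ) :
    ∑ j ∈ range (2 * H), ∑ k ∈ range (2 * H),
      ‖∑ r ∈ S, c r * expTwoPi (((j : ℝ) - k) * α r)‖ ^ 2 ≤ B * ∑ r ∈ S, ‖c r‖ ^ 2 := by
  have e1 : ((∑ j ∈ range (2 * H), ∑ k ∈ range (2 * H),
      ‖∑ r ∈ S, c r * expTwoPi (((j : ℝ) - k) * α r)‖ ^ 2 : ℝ) : ℂ)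
      = ∑ r ∈ S, ∑ s ∈ S, c r * (starRingEnd ℂ) (c s) *
        (expSum (2 * H) (α r - α s) * expSum (2 * H) (-(α r - α s))) := by
    push_cast
    have : ∀ j k : ℕ, ((‖∑ r ∈ S, c r * expTwoPi (((j : ℝ) - k) * α r)‖ : ℝ) : ℂ) ^ 2
        = ∑ r ∈ S, ∑ s ∈ S, c r * (starRingEnd ℂ) (c s) *
          (expTwoPi (j * (α r - α s)) * expTwoPi (k * -(α r - α s))) := by
      intro j k
      rw [← Complex.mul_conj', map_sum, sum_mul_sum]
      refine sum_congr rfl fun r _ => sum_congr rfl fun s _ => ?_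
      rw [map_mul, conj_expTwoPi, ← expTwoPi_add, mul_mul_mul_comm, ← expTwoPi_add]
      congr 2
      ring
    simp_rw [this]
    simp only [expSum]
    simp_rw [sum_mul_sum, mul_sum]
    calc _ = ∑ j ∈ range (2 * H), ∑ r ∈ S, ∑ s ∈ S, ∑ k ∈ range (2 * H),
          c r * (starRingEnd ℂ) (c s) *
          (expTwoPi (j * (α r - α s)) * expTwoPi (k * -(α r - α s))) := by
          refine sum_congr rfl fun j _ => ?_
          rw [sum_comm]
          exact sum_congr rfl fun r _ => by rw [sum_comm]
      _ = _ := by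
          rw [sum_comm]
          refine sum_congr rfl fun r _ => ?_
          rw [sum_comm]
  have e2 : ∑ j ∈ range (2 * H), ∑ k ∈ range (2 * H),
      ‖∑ r ∈ S, c r * expTwoPi (((j : ℝ) - k) * α r)‖ ^ 2 ≤
      ∑ r ∈ S, ∑ s ∈ S, ‖c r‖ * ‖c s‖ * ‖expSum (2 * H) (α r - α s)‖ ^ 2 := by
    have h0 : 0 ≤ ∑ j ∈ range (2 * H), ∑ k ∈ range (2 * H),
      ‖∑ r ∈ S, c r * expTwoPi (((j : ℝ) - k) * α r)‖ ^ 2 := by positivity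
    rw [← abs_of_nonneg h0, ← Real.norm_eq_abs, ← Complex.norm_real, e1]
    refine (norm_sum_le _ _).trans (sum_le_sum fun r _ => (norm_sum_le _ _).trans
      (sum_le_sum fun s _ => le_of_eq ?_))
    rw [norm_mul, norm_mul, norm_mul, RCLike.norm_conj, norm_expSum_neg]
    ring
  refine e2.trans ?_
  have e3 : ∀ r s, ‖c r‖ * ‖c s‖ * ‖expSum (2 * H) (α r - α s)‖ ^ 2 ≤
      ‖c r‖ ^ 2 / 2 * ‖expSum (2 * H) (α r - α s)‖ ^ 2
      + ‖c s‖ ^ 2 / 2 * ‖expSum (2 * H) (α s - α r)‖ ^ 2 := by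
    intro r s
    have : ‖expSum (2 * H) (α s - α r)‖ = ‖expSum (2 * H) (α r - α s)‖ := by
      rw [← norm_expSum_neg, neg_sub]
    rw [this, ← add_mul]
    gcongr
    nlinarith [sq_nonneg (‖c r‖ - ‖c s‖)]
  calc _ ≤ ∑ r ∈ S, ∑ s ∈ S, (‖c r‖ ^ 2 / 2 * ‖expSum (2 * H) (α r - α s)‖ ^ 2
      + ‖c s‖ ^ 2 / 2 * ‖expSum (2 * H) (α s - α r)‖ ^ 2) :=
        sum_le_sum fun r _ => sum_le_sum fun s _ => e3 r s
    _ = 2 * ∑ r ∈ S, ∑ s ∈ S, ‖c r‖ ^ 2 / 2 * ‖expSum (2 * H) (α r - α s)‖ ^ 2 := by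
        simp only [sum_add_distrib]
        have hs : ∑ r ∈ S, ∑ s ∈ S, ‖c s‖ ^ 2 / 2 * ‖expSum (2 * H) (α s - α r)‖ ^ 2 =
          ∑ r ∈ S, ∑ s ∈ S, ‖c r‖ ^ 2 / 2 * ‖expSum (2 * H) (α r - α s)‖ ^ 2 := sum_comm
        rw [hs]
        ring
    _ = ∑ r ∈ S, ‖c r‖ ^ 2 * ∑ s ∈ S, ‖expSum (2 * H) (α r - α s)‖ ^ 2 := by
        rw [mul_sum]
        refine sum_congr rfl fun r _ => ?_
        rw [← mul_sum]; ring
    _ ≤ ∑ r ∈ S, ‖c r‖ ^ 2 * B := sum_le_sum fun r hr => by gcongr; exact hB r hr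
    _ = _ := by rw [← sum_mul, mul_comm]

/-- Every `n < N ≤ H` is a difference `j - k` with `j, k < 2H` in at least `H` ways, namely `j = n +
k` for `k < H`. The double sum over differences thus majorizes `H` copies of the sum over `n`,
playing the role of a Fejér kernel. -/
theorem sum_norm_sq_dual_le {ι : Type*} (S : Finset ι) (α : ι → ℝ) {N H : ℕ} (hNH : N ≤ H)
    (B : ℝ) (hB : ∀ r ∈ S, ∑ s ∈ S, ‖expSum (2 * H) (α r - α s)‖ ^ 2 ≤ B) (c : ι → ℂ) :
    H * ∑ n ∈ range N, ‖∑ r ∈ S, c r * expTwoPi (n * α r)‖ ^ 2 ≤ B * ∑ r ∈ S, ‖c r‖ ^ 2 := by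
  refine le_trans ?_ (sum_norm_sq_sub_le S α H B hB c)
  rw [sum_comm]
  calc _ = ∑ k ∈ range H, ∑ n ∈ range N, ‖∑ r ∈ S, c r * expTwoPi (n * α r)‖ ^ 2 := by simp
    _ ≤ ∑ k ∈ range H, ∑ j ∈ range (2 * H),
        ‖∑ r ∈ S, c r * expTwoPi (((j : ℝ) - k) * α r)‖ ^ 2 := by
      refine sum_le_sum fun k hk => ?_
      rw [mem_range] at hk
      have : ∀ n : ℕ, ‖∑ r ∈ S, c r * expTwoPi (n * α r)‖ ^ 2 =
        ‖∑ r ∈ S, c r * expTwoPi ((((n + k : ℕ) : ℝ) - k) * α r)‖ ^ 2 := by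
        intro n; push_cast; simp
      simp_rw [this]
      rw [← sum_image (f := fun j : ℕ => ‖∑ r ∈ S, c r * expTwoPi (((j : ℝ) - k) * α r)‖ ^ 2)
        (g := fun n => n + k) (fun x _ y _ h => by simpa using h)]
      refine sum_le_sum_of_subset_of_nonneg ?_ fun _ _ _ => by positivity
      intro j hj
      simp only [mem_image, mem_range] at hj ⊢
      omega
    _ ≤ _ := by
      refine sum_le_sum_of_subset_of_nonneg ?_ fun _ _ _ => by positivity
      exact range_subset_range.2 (by omega)

/-- Duality: the dual inequality with coefficients `conj (T r)`, followed by Cauchy–Schwarz in `n`,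
gives `H * X ^ 2 ≤ ‖a‖² * B * X`, from which one factor `X` is cancelled. -/
theorem large_sieve_of_kernel {ι : Type*} (S : Finset ι) (α : ι → ℝ) {N H : ℕ} (hNH : N ≤ H)
    {B : ℝ} (hB0 : 0 ≤ B) (hB : ∀ r ∈ S, ∑ s ∈ S, ‖expSum (2 * H) (α r - α s)‖ ^ 2 ≤ B)
    (a : ℕ → ℂ) :
    H * ∑ r ∈ S, ‖∑ n ∈ range N, a n * expTwoPi (n * α r)‖ ^ 2
      ≤ B * ∑ n ∈ range N, ‖a n‖ ^ 2 := by
  set T : ι → ℂ := fun r => ∑ n ∈ range N, a n * expTwoPi (n * α r) with hT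
  set X : ℝ := ∑ r ∈ S, ‖T r‖ ^ 2 with hX
  have hX0 : 0 ≤ X := by positivity
  have h1 := sum_norm_sq_dual_le S α hNH B hB (fun r => (starRingEnd ℂ) (T r))
  simp only [RCLike.norm_conj] at h1
  have e1 : (X : ℂ) = ∑ n ∈ range N, a n * ∑ r ∈ S, (starRingEnd ℂ) (T r) * expTwoPi (n * α r) := by
    rw [hX]
    push_cast
    simp_rw [mul_sum]
    rw [sum_comm]
    refine sum_congr rfl fun r _ => ?_
    rw [← Complex.mul_conj']
    conv_lhs => rw [hT]
    simp only [sum_mul]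
    exact sum_congr rfl fun n _ => by ring
  have h2 : X ≤ ∑ n ∈ range N, ‖a n‖ * ‖∑ r ∈ S, (starRingEnd ℂ) (T r) * expTwoPi (n * α r)‖ := by
    rw [← abs_of_nonneg hX0, ← Real.norm_eq_abs, ← Complex.norm_real, e1]
    refine (norm_sum_le _ _).trans (le_of_eq ?_)
    simp only [norm_mul]
  have h3 := sum_mul_sq_le_sq_mul_sq (range N) (fun n => ‖a n‖)
    (fun n => ‖∑ r ∈ S, (starRingEnd ℂ) (T r) * expTwoPi (n * α r)‖)
  have h4 : X ^ 2 ≤ _ := (pow_le_pow_left₀ hX0 h2 2).trans h3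
  rcases hX0.eq_or_lt with h0 | h0
  · rw [← h0, mul_zero]
    positivity
  · have h5 : H * X ^ 2 ≤ (∑ n ∈ range N, ‖a n‖ ^ 2) * (B * X) := by
      calc _ ≤ (H : ℝ) * _ := mul_le_mul_of_nonneg_left h4 (by positivity)
        _ = (∑ n ∈ range N, ‖a n‖ ^ 2) * (H * _) := by ring
        _ ≤ _ := mul_le_mul_of_nonneg_left h1 (by positivity)
    nlinarith

/-- Cut the circle, centred at `α r`, into `K` arcs of length `1 / K`. Spacing puts at most one
point in each arc, and in the arc at distance `m` from the nearer end the kernel is at most `(K /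
2m)²`, or `(2H)²` when `m = 0`; the inverse squares then converge. -/
theorem sum_norm_sq_expSum_le_of_spaced {ι : Type*} (S : Finset ι) (α : ι → ℝ) {K H : ℕ}
    (hK : 0 < K) (hKH : K ≤ H)
    (hsp : ∀ r ∈ S, ∀ s ∈ S, r ≠ s → ∀ z : ℤ, 1 / (K : ℝ) ≤ |α r - α s - z|) (r : ι) :
    ∑ s ∈ S, ‖expSum (2 * H) (α r - α s)‖ ^ 2 ≤ 9 * (H : ℝ) ^ 2 := by
  have hK' : (0 : ℝ) < K := by exact_mod_cast hK
  set β : ι → ℝ := fun s => Int.fract (α r - α s) with hβ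
  set k : ι → ℕ := fun s => ⌊K * β s⌋₊ with hk
  set G : ℕ → ℝ := fun m => if m = 0 then 4 * (H : ℝ) ^ 2 else K ^ 2 / 4 * ((m : ℝ) ^ 2)⁻¹ with hG
  have hβ0 : ∀ s, 0 ≤ β s := fun s => Int.fract_nonneg _
  have hβ1 : ∀ s, β s < 1 := fun s => Int.fract_lt_one _
  have hG0 : ∀ m, 0 ≤ G m := by
    intro m; simp only [hG]; split_ifs <;> positivity
  have hk1 : ∀ s, (k s : ℝ) ≤ K * β s := fun s => Nat.floor_le (by have := hβ0 s; positivity)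
  have hk2 : ∀ s, K * β s < k s + 1 := fun s => Nat.lt_floor_add_one _
  have hkK : ∀ s, k s < K := by
    intro s
    have : (k s : ℝ) < K := by nlinarith [hk1 s, hβ1 s]
    exact_mod_cast this
  have hinj : Set.InjOn k S := by
    intro s hs t ht hst
    by_contra hne
    -- This integer shift turns the difference modulo 1 into a difference of fractional parts.
    have h := hsp s hs t ht hne (⌊α r - α t⌋ - ⌊α r - α s⌋)
    have e : α s - α t - ((⌊α r - α t⌋ - ⌊α r - α s⌋ : ℤ) : ℝ) = β t - β s := by
      simp only [hβ, Int.fract]; push_cast; ring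
    rw [e] at h
    have h1 := hk1 s; have h2 := hk2 s; have h3 := hk1 t; have h4 := hk2 t
    rw [hst] at h1 h2
    have : |K * β t - K * β s| < 1 := by rw [abs_lt]; constructor <;> linarith
    rw [← mul_sub, abs_mul, abs_of_pos hK'] at this
    rw [div_le_iff₀ hK'] at h
    linarith
  -- Bounding by the values at both ends, rather than by the nearer one, makes the sum over arcs
  -- symmetric under `j ↦ K - 1 - j`.
  have hb : ∀ s, ‖expSum (2 * H) (α r - α s)‖ ^ 2 ≤ G (k s) + G (K - 1 - k s) := by
    intro s
    rw [← expSum_fract]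
    set m := min (k s) (K - 1 - k s) with hm
    have hGm : G m ≤ G (k s) + G (K - 1 - k s) := by
      rcases min_choice (k s) (K - 1 - k s) with h | h <;> rw [hm, h] <;> linarith [hG0 (k s), hG0 (K - 1 - k s)]
    refine le_trans ?_ hGm
    simp only [hG]
    split_ifs with h0
    · have := norm_expSum_le (2 * H) (Int.fract (α r - α s))
      push_cast at this
      calc _ ≤ (2 * (H : ℝ)) ^ 2 := by gcongr
        _ = _ := by ring
    · have h1 := norm_expSum_mul_min_le (2 * H) (hβ0 s) (hβ1 s).le
      have hmK : (m : ℝ) ≤ K * min (β s) (1 - β s) := by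
        rw [mul_min_of_nonneg _ _ hK'.le]
        refine le_min (le_trans ?_ (hk1 s)) ?_
        · exact_mod_cast min_le_left _ _
        · have : m ≤ K - 1 - k s := min_le_right _ _
          have h2 : m + 1 + k s ≤ K := by have := hkK s; omega
          have h3 : (m : ℝ) + 1 + k s ≤ K := by exact_mod_cast h2
          nlinarith [hk2 s]
      have hm0 : (0 : ℝ) < m := by exact_mod_cast Nat.pos_of_ne_zero h0
      have h4 : ‖expSum (2 * H) (β s)‖ * (2 * m) ≤ K := by
        calc _ ≤ ‖expSum (2 * H) (β s)‖ * (2 * (K * min (β s) (1 - β s))) := by gcongr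
          _ = K * (‖expSum (2 * H) (β s)‖ * (2 * min (β s) (1 - β s))) := by ring
          _ ≤ K * 1 := by gcongr
          _ = K := mul_one _
      rw [← le_div_iff₀ (by positivity)] at h4
      calc _ ≤ (K / (2 * (m : ℝ))) ^ 2 := by gcongr
        _ = _ := by field_simp; ring
  calc _ ≤ ∑ s ∈ S, (G (k s) + G (K - 1 - k s)) := sum_le_sum fun s _ => hb s
    _ = ∑ j ∈ S.image k, (G j + G (K - 1 - j)) := by rw [sum_image hinj]
    _ ≤ ∑ j ∈ range K, (G j + G (K - 1 - j)) := by
      refine sum_le_sum_of_subset_of_nonneg ?_ fun _ _ _ => add_nonneg (hG0 _) (hG0 _)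
      intro j hj
      obtain ⟨s, -, rfl⟩ := mem_image.1 hj
      exact mem_range.2 (hkK s)
    _ = 2 * ∑ j ∈ range K, G j := by rw [sum_add_distrib, sum_range_reflect]; ring
    _ ≤ 2 * (4 * (H : ℝ) ^ 2 + K ^ 2 / 4 * 2) := by
      obtain ⟨K', rfl⟩ : ∃ K', K = K' + 1 := ⟨K - 1, by omega⟩
      have h0 : ∑ j ∈ range (K' + 1), G j = 4 * (H : ℝ) ^ 2 +
          ((K' + 1 : ℕ) : ℝ) ^ 2 / 4 * ∑ j ∈ Ioo 0 (K' + 1), ((j : ℝ) ^ 2)⁻¹ := by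
        rw [mul_sum, range_eq_Ico, sum_eq_sum_Ico_succ_bot (by omega)]
        congr 1
        refine sum_congr (by ext; simp; omega) fun j hj => ?_
        have : j ≠ 0 := by rw [mem_Ioo] at hj; omega
        simp [hG, this]
      rw [h0]
      have := sum_Ioo_inv_sq_le (α := ℝ) 0 (K' + 1)
      gcongr
      simpa using this
    _ ≤ _ := by
      have : (K : ℝ) ≤ H := by exact_mod_cast hKH
      nlinarith

/-- Index set for the Farey fractions `a / q` with `q ≤ R`, as pairs `(q, a)`. -/
def fareyPairs (R : ℕ) : Finset (Σ _ : ℕ, ℕ) :=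
  (Icc 1 R).sigma fun q => (range q).filter fun a => a.Coprime q

theorem farey_spaced {R : ℕ} (r s : Σ _ : ℕ, ℕ) (hr : r ∈ fareyPairs R) (hs : s ∈ fareyPairs R)
    (hne : r ≠ s) (z : ℤ) :
    1 / ((R ^ 2 : ℕ) : ℝ) ≤ |(r.2 : ℝ) / r.1 - (s.2 : ℝ) / s.1 - z| := by
  obtain ⟨q, a⟩ := r
  obtain ⟨q', a'⟩ := s
  simp only [fareyPairs, mem_sigma, mem_Icc, mem_filter, mem_range] at hr hs ⊢
  obtain ⟨⟨hq1, hqR⟩, haq, hc⟩ := hr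
  obtain ⟨⟨hq1', hqR'⟩, haq', hc'⟩ := hs
  have hq0 : (0 : ℝ) < q := by exact_mod_cast hq1
  have hq0' : (0 : ℝ) < q' := by exact_mod_cast hq1'
  have e : (a : ℝ) / q - (a' : ℝ) / q' - z = ((a * q' - a' * q - z * q * q' : ℤ) : ℝ) / (q * q') := by
    push_cast; field_simp
  rw [e, abs_div, abs_of_pos (mul_pos hq0 hq0')]
  have hnz : (a * q' - a' * q - z * q * q' : ℤ) ≠ 0 := by
    intro h
    -- Both fractions lie in `[0, 1)`, so they can differ by an integer only if they are equal;
    -- reduced fractions that are equal have the same denominator.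
    have hz : z = 0 := by
      have hlt : (z : ℝ) < 1 ∧ -1 < (z : ℝ) := by
        have h0 : (a : ℝ) / q - (a' : ℝ) / q' - z = 0 := by rw [e, h]; simp
        have h1 : (a : ℝ) / q < 1 := by rw [div_lt_one hq0]; exact_mod_cast haq
        have h2 : (a' : ℝ) / q' < 1 := by rw [div_lt_one hq0']; exact_mod_cast haq'
        have h3 : 0 ≤ (a : ℝ) / q := by positivity
        have h4 : 0 ≤ (a' : ℝ) / q' := by positivity
        constructor <;> linarith
      have h1 : z < 1 := by exact_mod_cast hlt.1
      have h2 : -1 < z := by exact_mod_cast hlt.2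
      omega
    subst hz
    have h1 : a * q' = a' * q := by
      have : (a * q' : ℤ) = a' * q := by linarith
      exact_mod_cast this
    have d1 : q ∣ q' := hc.symm.dvd_of_dvd_mul_left ⟨a', by rw [h1, mul_comm]⟩
    have d2 : q' ∣ q := hc'.symm.dvd_of_dvd_mul_left ⟨a, by rw [← h1, mul_comm]⟩
    have hqq : q = q' := Nat.dvd_antisymm d1 d2
    subst hqq
    have : a = a' := Nat.eq_of_mul_eq_mul_right hq1 h1
    subst this
    exact hne rfl
  have h1 : (1 : ℝ) ≤ |((a * q' - a' * q - z * q * q' : ℤ) : ℝ)| := by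
    rw [← Int.cast_abs]
    exact_mod_cast Int.one_le_abs hnz
  refine div_le_div₀ (by positivity) h1 (by positivity) ?_
  push_cast
  rw [sq]
  gcongr

/-- The additive large sieve inequality over Farey fractions. -/
theorem additive_large_sieve {R : ℕ} (hR : 1 ≤ R) (N : ℕ) (a : ℕ → ℂ) :
    ∑ r ∈ fareyPairs R, ‖∑ n ∈ range N, a n * expTwoPi (n * ((r.2 : ℝ) / r.1))‖ ^ 2
      ≤ 9 * (N + (R : ℝ) ^ 2) * ∑ n ∈ range N, ‖a n‖ ^ 2 := by
  set H := max N (R ^ 2)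
  have hH : (0 : ℝ) < H := by
    have : 0 < H := lt_of_lt_of_le (by positivity) (le_max_right N (R ^ 2))
    exact_mod_cast this
  have h := large_sieve_of_kernel (fareyPairs R) (fun r => (r.2 : ℝ) / r.1)
    (le_max_left N (R ^ 2)) (B := 9 * (H : ℝ) ^ 2) (by positivity)
    (fun r _ => sum_norm_sq_expSum_le_of_spaced _ _ (by positivity) (le_max_right N (R ^ 2))
      (fun r hr s hs hne z => farey_spaced r s hr hs hne z) r) a
  have hle : (H : ℝ) ≤ N + (R : ℝ) ^ 2 := by
    have : H ≤ N + R ^ 2 := max_le (by omega) (by omega)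
    exact_mod_cast this
  have h2 : ∑ r ∈ fareyPairs R, ‖∑ n ∈ range N, a n * expTwoPi (n * ((r.2 : ℝ) / r.1))‖ ^ 2
      ≤ 9 * H * ∑ n ∈ range N, ‖a n‖ ^ 2 := by
    refine le_of_mul_le_mul_left ?_ hH
    calc _ ≤ _ := h
      _ = _ := by ring
  refine h2.trans ?_
  gcongr

/-! ### Gauss sums, the multiplicative large sieve and Pólya–Vinogradov -/

section Gauss
open ZMod DirichletCharacter

theorem isPrimitive_inv {q : ℕ} {χ : DirichletCharacter ℂ q} (hχ : χ.IsPrimitive) :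
    (χ⁻¹).IsPrimitive := by
  rw [isPrimitive_def, conductor_inv]; exact hχ

/-- The Fourier transform of a primitive `χ` is a multiple of `χ⁻¹`. Transforming twice and
evaluating Fourier inversion at `-1` gives `q`, and the resulting product of Gauss sums is `τ * conj
τ`. -/
theorem norm_gaussSum_sq {q : ℕ} [NeZero q] {χ : DirichletCharacter ℂ q} (hχ : χ.IsPrimitive) :
    ‖gaussSum χ stdAddChar‖ ^ 2 = q := by
  have h1 : ZMod.dft (ZMod.dft (χ : ZMod q → ℂ)) (-1) = q := by
    rw [ZMod.dft_dft]; simp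
  have h2 : ZMod.dft (χ : ZMod q → ℂ) =
      (χ⁻¹ (-1) * gaussSum χ stdAddChar) • (fun k => χ⁻¹ k) := by
    funext k
    rw [hχ.fourierTransform_eq_inv_mul_gaussSum, neg_eq_neg_one_mul, map_mul, Pi.smul_apply,
      smul_eq_mul]
    ring
  rw [h2, ZMod.dft_const_smul, Pi.smul_apply,
    (isPrimitive_inv hχ).fourierTransform_eq_inv_mul_gaussSum, neg_neg, inv_inv, map_one, one_mul,
    smul_eq_mul] at h1
  have h3 : star (gaussSum χ stdAddChar) = χ⁻¹ (-1) * gaussSum χ⁻¹ stdAddChar := by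
    rw [star_gaussSum_eq, AddChar.inv_mulShift,
      gaussSum_mulShift_of_isPrimitive _ (isPrimitive_inv hχ), inv_inv, MulChar.inv_apply_eq_inv',
      inv_eq_of_mul_eq_one_left (a := χ (-1)) (by rw [← map_mul]; simp)]
  have h4 : ((‖gaussSum χ stdAddChar‖ ^ 2 : ℝ) : ℂ) = (q : ℝ) := by
    push_cast
    rw [← Complex.mul_conj']
    change _ * star _ = _
    rw [h3, ← h1]; ring
  exact_mod_cast h4

theorem stdAddChar_eq_expTwoPi {q : ℕ} [NeZero q] (b : ZMod q) (n : ℕ) :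
    (stdAddChar (b * (n : ZMod q)) : ℂ) = expTwoPi (n * ((b.val : ℝ) / q)) := by
  have : b * (n : ZMod q) = (((b.val * n : ℕ) : ℤ) : ZMod q) := by
    push_cast; rw [ZMod.natCast_zmod_val]
  rw [this, ZMod.stdAddChar_coe, expTwoPi]
  push_cast
  congr 1
  ring

theorem char_mul_gaussSum {q : ℕ} [NeZero q] {χ : DirichletCharacter ℂ q} (hχ : χ.IsPrimitive)
    (n : ℕ) : χ (n : ZMod q) * gaussSum χ⁻¹ stdAddChar =
      ∑ b : ZMod q, χ⁻¹ b * expTwoPi (n * ((b.val : ℝ) / q)) := by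
  have := gaussSum_mulShift_of_isPrimitive (stdAddChar (N := q)) (isPrimitive_inv hχ) (n : ZMod q)
  rw [inv_inv] at this
  rw [← this, gaussSum]
  refine sum_congr rfl fun b _ => ?_
  rw [AddChar.mulShift_apply, mul_comm (n : ZMod q), stdAddChar_eq_expTwoPi]

/-- Parseval's identity on the unit group, from orthogonality of characters. -/
theorem sum_char_norm_sq {q : ℕ} [NeZero q] (S : ZMod q → ℂ) :
    ∑ χ : DirichletCharacter ℂ q, ‖∑ b : ZMod q, χ b * S b‖ ^ 2 =
      q.totient * ∑ b : ZMod q with IsUnit b, ‖S b‖ ^ 2 := by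
  classical
  have h : ((∑ χ : DirichletCharacter ℂ q, ‖∑ b : ZMod q, χ b * S b‖ ^ 2 : ℝ) : ℂ) =
      ((q.totient * ∑ b : ZMod q with IsUnit b, ‖S b‖ ^ 2 : ℝ) : ℂ) := by
    push_cast
    have e : ∀ χ : DirichletCharacter ℂ q, ∑ b : ZMod q, χ b * S b =
        ∑ b : ZMod q with IsUnit b, χ b * S b := by
      intro χ
      rw [sum_filter]
      refine sum_congr rfl fun b _ => ?_
      split_ifs with hb
      · rfl
      · rw [χ.map_nonunit hb, zero_mul]
    have e2 : ∀ χ : DirichletCharacter ℂ q, ((‖∑ b : ZMod q, χ b * S b‖ : ℝ) : ℂ) ^ 2 =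
        ∑ b : ZMod q with IsUnit b, ∑ c : ZMod q with IsUnit c,
          (S c * (starRingEnd ℂ) (S b)) * (χ b⁻¹ * χ c) := by
      intro χ
      rw [← Complex.conj_mul', e, map_sum, sum_mul_sum]
      refine sum_congr rfl fun b hb => sum_congr rfl fun c hc => ?_
      have hcb : (starRingEnd ℂ) (χ b) = χ b⁻¹ := by
        change star (χ b) = _
        have hbu : IsUnit b := (mem_filter.1 hb).2
        rw [MulChar.star_apply', MulChar.inv_apply_eq_inv']
        refine inv_eq_of_mul_eq_one_left ?_
        rw [← map_mul, (ZMod.inv_mul_eq_one_of_isUnit hbu b).2 rfl, map_one]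
      rw [map_mul, hcb]
      ring
    simp_rw [e2]
    rw [sum_comm, mul_sum]
    refine sum_congr rfl fun b hb => ?_
    rw [sum_comm]
    have hbu : IsUnit b := (mem_filter.1 hb).2
    simp_rw [← mul_sum, DirichletCharacter.sum_char_inv_mul_char_eq ℂ hbu]
    rw [sum_eq_single b]
    · rw [if_pos rfl, Complex.mul_conj']; ring
    · intro c _ hcb; rw [if_neg hcb.symm, mul_zero]
    · intro hb'; exact absurd hb hb'
  exact_mod_cast h

theorem sum_units_eq_sum_coprime {q : ℕ} [NeZero q] (F : ℕ → ℝ) :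
    ∑ b : ZMod q with IsUnit b, F b.val = ∑ a ∈ (range q).filter (fun a => a.Coprime q), F a := by
  refine sum_nbij (fun b => b.val) ?_ ?_ ?_ (fun _ _ => rfl)
  · intro b hb
    rw [mem_filter] at hb
    rw [mem_filter, mem_range]
    refine ⟨ZMod.val_lt b, ?_⟩
    rw [← ZMod.isUnit_iff_coprime, ZMod.natCast_zmod_val]
    exact hb.2
  · exact fun b _ c _ h => ZMod.val_injective q h
  · intro a ha
    rw [mem_coe, mem_filter, mem_range] at ha
    refine ⟨(a : ZMod q), ?_, ZMod.val_cast_of_lt ha.1⟩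
    rw [mem_coe, mem_filter]
    exact ⟨mem_univ _, (ZMod.isUnit_iff_coprime a q).2 ha.2⟩

/-- The Gauss sum expands `χ` in additive characters at the cost of a factor of modulus `√q`.
Positivity allows the sum to be extended from primitive characters to all characters, where Parseval
applies. -/
theorem sum_primitive_norm_sq_le {q : ℕ} (hq : 1 ≤ q) (N : ℕ) (a : ℕ → ℂ) :
    (q : ℝ) / q.totient * ∑ χ ∈ primitiveCharacters q,
      ‖∑ n ∈ range N, a n * χ (n : ZMod q)‖ ^ 2 ≤
    ∑ b ∈ (range q).filter (fun b => b.Coprime q),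
      ‖∑ n ∈ range N, a n * expTwoPi (n * ((b : ℝ) / q))‖ ^ 2 := by
  have : NeZero q := ⟨by omega⟩
  have hφ : (0 : ℝ) < q.totient := by exact_mod_cast Nat.totient_pos.2 hq
  set S : ZMod q → ℂ := fun b => ∑ n ∈ range N, a n * expTwoPi (n * ((b.val : ℝ) / q)) with hS
  have h1 : ∀ χ ∈ primitiveCharacters q, q * ‖∑ n ∈ range N, a n * χ (n : ZMod q)‖ ^ 2 =
      ‖∑ b : ZMod q, χ⁻¹ b * S b‖ ^ 2 := by
    intro χ hχ
    rw [mem_primitiveCharacters] at hχ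
    rw [← norm_gaussSum_sq (isPrimitive_inv hχ), ← mul_pow, ← norm_mul, mul_comm, sum_mul]
    simp_rw [mul_assoc, char_mul_gaussSum hχ, hS, mul_sum]
    rw [sum_comm]
    congr 2
    exact sum_congr rfl fun b _ => sum_congr rfl fun n _ => by ring
  rw [← sum_units_eq_sum_coprime (fun b => ‖∑ n ∈ range N, a n * expTwoPi (n * ((b : ℝ) / q))‖ ^ 2),
    div_mul_eq_mul_div, div_le_iff₀ hφ, mul_sum, sum_congr rfl h1, mul_comm _ (q.totient : ℝ),
    ← sum_char_norm_sq S]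
  rw [← sum_image (f := fun χ : DirichletCharacter ℂ q => ‖∑ b : ZMod q, χ b * S b‖ ^ 2)
    (g := fun χ => χ⁻¹) (fun x _ y _ h => inv_injective h)]
  exact sum_le_sum_of_subset_of_nonneg (subset_univ _) fun _ _ _ => by positivity

/-- The multiplicative large sieve inequality. -/
theorem multiplicative_large_sieve {R : ℕ} (hR : 1 ≤ R) (N : ℕ) (a : ℕ → ℂ) :
    ∑ q ∈ Icc 1 R, (q : ℝ) / q.totient * ∑ χ ∈ primitiveCharacters q,
      ‖∑ n ∈ range N, a n * χ (n : ZMod q)‖ ^ 2 ≤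
    9 * (N + (R : ℝ) ^ 2) * ∑ n ∈ range N, ‖a n‖ ^ 2 := by
  refine le_trans ?_ (additive_large_sieve hR N a)
  rw [fareyPairs, sum_sigma]
  exact sum_le_sum fun q hq => sum_primitive_norm_sq_le (mem_Icc.1 hq).1 N a

/-- The Pólya–Vinogradov inequality for primitive characters. -/
theorem polya_vinogradov {q : ℕ} (hq : 2 ≤ q) {χ : DirichletCharacter ℂ q} (hχ : χ.IsPrimitive)
    (N : ℕ) : ‖∑ n ∈ range N, χ (n : ZMod q)‖ ≤ √q * (1 + Real.log q) := by
  have : NeZero q := ⟨by omega⟩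
  have : Fact (1 < q) := ⟨hq⟩
  have hq0 : (0 : ℝ) < q := by positivity
  have hg : ‖gaussSum χ⁻¹ (stdAddChar (N := q))‖ = √q := by
    rw [← norm_gaussSum_sq (isPrimitive_inv hχ), Real.sqrt_sq (norm_nonneg _)]
  have h1 : (∑ n ∈ range N, χ (n : ZMod q)) * gaussSum χ⁻¹ stdAddChar =
      ∑ b : ZMod q, χ⁻¹ b * expSum N ((b.val : ℝ) / q) := by
    simp_rw [sum_mul, char_mul_gaussSum hχ, expSum, mul_sum]
    exact sum_comm
  -- The reciprocal of `min j (q - j)` is bounded by the sum of the two reciprocals, which leaves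
  -- two equal harmonic sums.
  have h2 : ‖∑ b : ZMod q, χ⁻¹ b * expSum N ((b.val : ℝ) / q)‖ ≤
      ∑ j ∈ Icc 1 (q - 1), (q : ℝ) / 2 * ((j : ℝ)⁻¹ + ((q - j : ℕ) : ℝ)⁻¹) := by
    calc _ ≤ ∑ b : ZMod q, ‖χ⁻¹ b * expSum N ((b.val : ℝ) / q)‖ := norm_sum_le _ _
      _ = ∑ b ∈ univ.erase (0 : ZMod q), ‖χ⁻¹ b * expSum N ((b.val : ℝ) / q)‖ := by
        rw [← add_sum_erase univ _ (mem_univ (0 : ZMod q)), MulChar.map_zero]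
        simp
      _ ≤ ∑ b ∈ univ.erase (0 : ZMod q), (q : ℝ) / 2 * (((b.val : ℕ) : ℝ)⁻¹ + ((q - b.val : ℕ) : ℝ)⁻¹) := by
        refine sum_le_sum fun b hb => ?_
        have hb0 : b ≠ 0 := (mem_erase.1 hb).1
        have hbq := ZMod.val_lt b
        have hb1 : (0 : ℝ) < b.val := by
          have : 0 < b.val := Nat.pos_of_ne_zero (by rwa [ne_eq, ZMod.val_eq_zero])
          exact_mod_cast this
        have hb2 : (0 : ℝ) < ((q - b.val : ℕ) : ℝ) := by
          have : 0 < q - b.val := by omega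
          exact_mod_cast this
        have hb3 : ((q - b.val : ℕ) : ℝ) = q - b.val := by rw [Nat.cast_sub hbq.le]
        rw [norm_mul]
        have hle : ‖χ⁻¹ b‖ ≤ 1 := DirichletCharacter.norm_le_one _ _
        refine (mul_le_of_le_one_left (norm_nonneg _) hle).trans ?_
        have h := norm_expSum_mul_min_le N (θ := (b.val : ℝ) / q) (by positivity)
          (by rw [div_le_one hq0]; exact_mod_cast hbq.le)
        have hm : min ((b.val : ℝ) / q) (1 - (b.val : ℝ) / q) =
            min (b.val : ℝ) ((q - b.val : ℕ) : ℝ) / q := by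
          rw [hb3, ← min_div_div_right hq0.le]
          congr 1
          field_simp
        rw [hm] at h
        have hmin : 0 < min (b.val : ℝ) ((q - b.val : ℕ) : ℝ) := lt_min hb1 hb2
        have h' : ‖expSum N ((b.val : ℝ) / q)‖ ≤ (q : ℝ) / 2 * (min (b.val : ℝ) ((q - b.val : ℕ) : ℝ))⁻¹ := by
          rw [← div_eq_mul_inv, div_div, le_div_iff₀ (by positivity)]
          have h5 := mul_le_mul_of_nonneg_right h hq0.le
          calc _ = _ := by field_simp
            _ ≤ _ := h5
            _ = _ := one_mul _
        refine h'.trans ?_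
        gcongr
        rcases min_choice (b.val : ℝ) ((q - b.val : ℕ) : ℝ) with e | e <;> rw [e]
        · have := inv_pos.2 hb2; linarith
        · have := inv_pos.2 hb1; linarith
      _ = _ := by
        refine sum_nbij (fun b => b.val) ?_ ?_ ?_ (fun _ _ => rfl)
        · intro b hb
          have hb0 : b ≠ 0 := (mem_erase.1 hb).1
          have : b.val ≠ 0 := by rwa [ne_eq, ZMod.val_eq_zero]
          have := ZMod.val_lt b
          rw [mem_Icc]; omega
        · exact fun b _ c _ h => ZMod.val_injective q h
        · intro a ha
          rw [mem_coe, mem_Icc] at ha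
          have hv := ZMod.val_cast_of_lt (show a < q by omega)
          refine ⟨(a : ZMod q), ?_, hv⟩
          rw [mem_coe, mem_erase]
          refine ⟨?_, mem_univ _⟩
          rw [ne_eq, ← ZMod.val_eq_zero, hv]; omega
  have h3 : ∑ j ∈ Icc 1 (q - 1), (q : ℝ) / 2 * ((j : ℝ)⁻¹ + ((q - j : ℕ) : ℝ)⁻¹) ≤
      q * (1 + Real.log q) := by
    rw [← mul_sum, sum_add_distrib]
    have hrefl : ∑ j ∈ Icc 1 (q - 1), ((q - j : ℕ) : ℝ)⁻¹ = ∑ j ∈ Icc 1 (q - 1), (j : ℝ)⁻¹ := by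
      refine sum_nbij' (fun j => q - j) (fun j => q - j) ?_ ?_ ?_ ?_ (fun _ _ => rfl)
      all_goals intro j hj; rw [mem_Icc] at hj
      · rw [mem_Icc]; omega
      · rw [mem_Icc]; omega
      · omega
      · omega
    have hh : ∑ j ∈ Icc 1 (q - 1), (j : ℝ)⁻¹ ≤ 1 + Real.log q := by
      have := harmonic_le_one_add_log (q - 1)
      rw [harmonic_eq_sum_Icc] at this
      push_cast at this
      refine this.trans ?_
      gcongr
      · have : 0 < q - 1 := by omega
        exact_mod_cast this
      · omega
    rw [hrefl]
    nlinarith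
  have h4 := congrArg norm h1
  rw [norm_mul, hg] at h4
  have hs : 0 < √(q : ℝ) := Real.sqrt_pos.2 hq0
  refine le_of_mul_le_mul_right ?_ hs
  rw [h4]
  refine (h2.trans h3).trans (le_of_eq ?_)
  rw [mul_right_comm, Real.mul_self_sqrt hq0.le]
end Gauss

/-! ### Fourier separation of the condition `k ≤ y` -/

theorem hasSum_cos_div_sq {v : ℝ} (hv : |v| ≤ 1) :
    HasSum (fun n : ℕ => 1 / (n : ℝ) ^ 2 * Real.cos (2 * Real.pi * n * v))
      (Real.pi ^ 2 * (v ^ 2 - |v| + 1 / 6)) := by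
  have h := hasSum_one_div_nat_pow_mul_cos (k := 1) one_ne_zero (x := |v|) ⟨abs_nonneg v, hv⟩
  have e1 : (fun n : ℕ => 1 / (n : ℝ) ^ 2 * Real.cos (2 * Real.pi * n * v)) =
      fun n : ℕ => 1 / (n : ℝ) ^ (2 * 1) * Real.cos (2 * Real.pi * n * |v|) := by
    funext n
    rw [mul_one, ← Real.cos_abs (2 * Real.pi * n * v), abs_mul, abs_of_nonneg (a := 2 * Real.pi * n) (by positivity)]
  rw [e1]
  convert h using 1
  have e2 : (Polynomial.map (algebraMap ℚ ℝ) (Polynomial.bernoulli (2 * 1))).eval |v| =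
      v ^ 2 - |v| + 1 / 6 := by
    have h2 := bernoulliFun_two |v|
    rw [bernoulliFun, sq_abs] at h2
    rw [mul_one, h2, one_div]
  have e3 : ((2 * 1).factorial : ℝ) = 2 := by norm_num [Nat.factorial]
  rw [e2, e3]
  ring

/-- The Fourier coefficient bound for a cutoff smoothed at scale `δ`. -/
noncomputable def cutoffWeight (δ : ℝ) (n : ℕ) : ℝ :=
  if n = 0 then 1 else min (1 / (n : ℝ)) (1 / δ * ((n : ℝ) ^ 2)⁻¹)

theorem cutoffWeight_nonneg {δ : ℝ} (hδ : 0 < δ) (n : ℕ) : 0 ≤ cutoffWeight δ n := by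
  unfold cutoffWeight
  split_ifs
  · exact zero_le_one
  · exact le_min (by positivity) (by positivity)

theorem sum_cutoffWeight_le {δ : ℝ} (hδ : 0 < δ) (N : ℕ) :
    ∑ n ∈ range N, cutoffWeight δ n ≤ 4 + Real.log ⌈1 / δ⌉₊ := by
  set J := ⌈1 / δ⌉₊ with hJ
  have hJ1 : 1 / δ ≤ J := Nat.le_ceil _
  have hδ' : 0 < 1 / δ := by positivity
  have hsub : range N ⊆ insert 0 (Icc 1 J ∪ Ioo J N) := by
    intro n hn
    rw [mem_range] at hn
    simp only [mem_insert, mem_union, mem_Icc, mem_Ioo]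
    omega
  calc _ ≤ ∑ n ∈ insert 0 (Icc 1 J ∪ Ioo J N), cutoffWeight δ n :=
        sum_le_sum_of_subset_of_nonneg hsub fun _ _ _ => cutoffWeight_nonneg hδ _
    _ ≤ 1 + (∑ n ∈ Icc 1 J, cutoffWeight δ n + ∑ n ∈ Ioo J N, cutoffWeight δ n) := by
      have hd : Disjoint (Icc 1 J) (Ioo J N) := by
        rw [disjoint_left]; intro n h1 h2; rw [mem_Icc] at h1; rw [mem_Ioo] at h2; omega
      rw [sum_insert (by simp), sum_union hd]
      simp [cutoffWeight]
    _ ≤ 1 + ((1 + Real.log J) + 2) := by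
      gcongr
      · have h := harmonic_le_one_add_log J
        rw [harmonic_eq_sum_Icc] at h
        push_cast at h
        refine le_trans (sum_le_sum fun n hn => ?_) h
        have : n ≠ 0 := by have := (mem_Icc.1 hn).1; omega
        rw [cutoffWeight, if_neg this]
        exact (min_le_left _ _).trans (one_div _).le
      · have h := sum_Ioo_inv_sq_le (α := ℝ) J N
        calc _ ≤ ∑ n ∈ Ioo J N, 1 / δ * ((n : ℝ) ^ 2)⁻¹ := by
              refine sum_le_sum fun n hn => ?_
              have : n ≠ 0 := by rw [mem_Ioo] at hn; omega
              rw [cutoffWeight, if_neg this]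
              exact min_le_right _ _
          _ ≤ 1 / δ * (2 / (J + 1)) := by rw [← mul_sum]; gcongr
          _ ≤ 2 := by
            rw [mul_div_assoc', div_le_iff₀ (by positivity)]
            linarith
    _ = _ := by ring

theorem expTwoPi_mul_norm_sub_le (n : ℕ) (b δ : ℝ) (hδ : 0 < δ) :
    ‖expTwoPi (-(n * b)) - expTwoPi (-(n * (b + δ)))‖ ≤ min 2 (2 * Real.pi * n * δ) := by
  refine le_min ?_ ?_
  · refine (norm_sub_le _ _).trans ?_
    rw [norm_expTwoPi, norm_expTwoPi]; norm_num
  · have : expTwoPi (-(n * b)) - expTwoPi (-(n * (b + δ))) =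
      expTwoPi (-(n * (b + δ))) * (expTwoPi (n * δ) - 1) := by
      rw [mul_sub, ← expTwoPi_add]; ring_nf
    rw [this, norm_mul, norm_expTwoPi, one_mul, norm_expTwoPi_sub_one]
    have h := Real.abs_sin_le_abs (x := Real.pi * (n * δ))
    rw [abs_of_nonneg (a := Real.pi * (n * δ)) (by positivity)] at h
    linarith

theorem cos_eq_expTwoPi (n : ℕ) (u b : ℝ) : ((Real.cos (2 * Real.pi * n * (u - b)) : ℝ) : ℂ) =
    (expTwoPi (-(n * b)) * expTwoPi (n * u) + expTwoPi (n * b) * expTwoPi (-(n * u))) / 2 := by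
  rw [← expTwoPi_add, ← expTwoPi_add, expTwoPi, expTwoPi]
  push_cast
  rw [Complex.cos]
  ring_nf

/-- The coefficient of `exp (2πinu)` in the Fourier series of the smoothed cutoff at `b`. -/
noncomputable def cutoffCoeff (δ b : ℝ) (n : ℕ) : ℂ :=
  1 / (4 * δ * Real.pi ^ 2 * n ^ 2) *
    ((expTwoPi (-(n * b)) - expTwoPi (-(n * (b + δ)))) -
      (expTwoPi (-(n * (-1 / 4))) - expTwoPi (-(n * (-1 / 4 + δ)))))

theorem norm_cutoffCoeff_le {δ : ℝ} (hδ : 0 < δ) (b : ℝ) (n : ℕ) :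
    ‖cutoffCoeff δ b n‖ ≤ cutoffWeight δ n := by
  rcases Nat.eq_zero_or_pos n with rfl | hn
  · simp [cutoffCoeff, cutoffWeight]
  have hn' : (0 : ℝ) < n := by exact_mod_cast hn
  have hpi := Real.pi_gt_three
  rw [cutoffCoeff, cutoffWeight, if_neg hn.ne', norm_mul]
  have e : ‖(1 / (4 * δ * Real.pi ^ 2 * n ^ 2) : ℂ)‖ = 1 / (4 * δ * Real.pi ^ 2 * (n : ℝ) ^ 2) := by
    have : (1 / (4 * δ * Real.pi ^ 2 * n ^ 2) : ℂ) = ((1 / (4 * δ * Real.pi ^ 2 * (n : ℝ) ^ 2) : ℝ) : ℂ) := by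
      push_cast; rfl
    rw [this, Complex.norm_real, Real.norm_of_nonneg (by positivity)]
  have h : ‖(expTwoPi (-(n * b)) - expTwoPi (-(n * (b + δ)))) -
      (expTwoPi (-(n * (-1 / 4))) - expTwoPi (-(n * (-1 / 4 + δ))))‖ ≤
      2 * min 2 (2 * Real.pi * n * δ) := by
    refine (norm_sub_le _ _).trans ?_
    have h1 := expTwoPi_mul_norm_sub_le n b δ hδ
    have h2 := expTwoPi_mul_norm_sub_le n (-1 / 4) δ hδ
    linarith
  rw [e]
  refine le_min ?_ ?_
  · calc _ ≤ 1 / (4 * δ * Real.pi ^ 2 * (n : ℝ) ^ 2) * (2 * (2 * Real.pi * n * δ)) := by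
          gcongr; exact h.trans (by gcongr; exact min_le_right _ _)
      _ = 1 / n * (1 / Real.pi) := by field_simp; ring
      _ ≤ 1 / n * 1 := by
        gcongr
        rw [div_le_one (by positivity)]; linarith
      _ = _ := mul_one _
  · calc _ ≤ 1 / (4 * δ * Real.pi ^ 2 * (n : ℝ) ^ 2) * (2 * 2) := by
          gcongr; exact h.trans (by gcongr; exact min_le_left _ _)
      _ = 1 / δ * ((n : ℝ) ^ 2)⁻¹ * (1 / Real.pi ^ 2) := by field_simp; ring
      _ ≤ 1 / δ * ((n : ℝ) ^ 2)⁻¹ * 1 := by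
        gcongr
        rw [div_le_one (by positivity)]; nlinarith
      _ = _ := mul_one _

/-- The series `∑ cos (2πnv) / n²` is the quadratic `v² - |v| + 1/6` up to a factor. A difference
quotient of step `δ` turns `-|v|` into a step with a ramp on `(b, b + δ)`, plus terms linear in `u`;
subtracting the same quotient at `-1/4`, a point left of all `u`, cancels the dependence on `u`.
Only `u` off the ramp is considered, so the value is exact. -/
theorem hasSum_cutoff {δ b u : ℝ} (hδ : 0 < δ) (hδ4 : δ ≤ 1 / 4) (hb0 : 0 ≤ b) (hb : b ≤ 1 / 2)
    (hu0 : 0 ≤ u) (hu : u ≤ 1 / 2) (hub : u ≤ b ∨ b + δ ≤ u) :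
    HasSum (fun n : ℕ => cutoffCoeff δ b n * expTwoPi (n * u) +
      (starRingEnd ℂ) (cutoffCoeff δ b n) * expTwoPi (-(n * u)))
      ((if u ≤ b then 1 else 0) - (b + 1 / 4 : ℝ)) := by
  have h1 := hasSum_cos_div_sq (v := u - b) (by rw [abs_le]; constructor <;> linarith)
  have h2 := hasSum_cos_div_sq (v := u - (b + δ)) (by rw [abs_le]; constructor <;> linarith)
  have h3 := hasSum_cos_div_sq (v := u - (-1 / 4)) (by rw [abs_le]; constructor <;> linarith)
  have h4 := hasSum_cos_div_sq (v := u - (-1 / 4 + δ)) (by rw [abs_le]; constructor <;> linarith)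
  have h := ((h1.sub h2).sub (h3.sub h4)).mul_left (1 / (2 * δ * Real.pi ^ 2))
  have hval : 1 / (2 * δ * Real.pi ^ 2) * (Real.pi ^ 2 * ((u - b) ^ 2 - |u - b| + 1 / 6) -
      Real.pi ^ 2 * ((u - (b + δ)) ^ 2 - |u - (b + δ)| + 1 / 6) -
      (Real.pi ^ 2 * ((u - -1 / 4) ^ 2 - |u - -1 / 4| + 1 / 6) -
      Real.pi ^ 2 * ((u - (-1 / 4 + δ)) ^ 2 - |u - (-1 / 4 + δ)| + 1 / 6))) =
      (if u ≤ b then 1 else 0) - (b + 1 / 4 : ℝ) := by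
    have a3 : |u - -1 / 4| = u + 1 / 4 := by rw [abs_of_nonneg (by linarith)]; ring
    have a4 : |u - (-1 / 4 + δ)| = u + 1 / 4 - δ := by rw [abs_of_nonneg (by linarith)]; ring
    rw [a3, a4]
    have hpi := Real.pi_pos
    rcases hub with hc | hc
    · rw [if_pos hc, abs_of_nonpos (a := u - b) (by linarith), abs_of_nonpos (a := u - (b + δ)) (by linarith)]
      field_simp
      ring
    · rw [if_neg (by linarith), abs_of_nonneg (a := u - b) (by linarith), abs_of_nonneg (a := u - (b + δ)) (by linarith)]
      field_simp
      ring
  rw [hval] at h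
  have h' := Complex.hasSum_ofReal.2 h
  convert h' using 1
  · funext n
    simp only [Complex.ofReal_mul, Complex.ofReal_sub, cos_eq_expTwoPi, cutoffCoeff]
    simp only [map_mul, map_sub, conj_expTwoPi, map_div₀, map_one, map_pow, Complex.conj_ofReal,
      Complex.conj_natCast, Complex.conj_ofNat, neg_neg]
    push_cast
    have hpi : (Real.pi : ℂ) ≠ 0 := by exact_mod_cast Real.pi_ne_zero
    have hδc : (δ : ℂ) ≠ 0 := by exact_mod_cast hδ.ne'
    rcases Nat.eq_zero_or_pos n with rfl | hn
    · simp
    · have hnc : (n : ℂ) ≠ 0 := by exact_mod_cast hn.ne'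
      field_simp
      ring
  · split_ifs <;> push_cast <;> rfl

/-- Separation of variables: a sum restricted to `k i ≤ y` is dominated, uniformly in `y ≤ x`, by
unrestricted sums twisted by `(k i) ^ (2πit)`, with total weight `O(log x)`. -/
theorem exists_separation {x : ℝ} (hx : 4 ≤ x) : ∃ w t : ℕ → ℝ, (∀ n, 0 ≤ w n) ∧ Summable w ∧
    ∑' n, w n ≤ 8 * Real.log x ∧
    ∀ {ι : Type} (y : ℕ) (_ : (y : ℝ) ≤ x) (s : Finset ι) (k : ι → ℕ)
      (_ : ∀ i ∈ s, 1 ≤ k i ∧ (k i : ℝ) ≤ 2 * x) (a : ι → ℂ),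
      ‖∑ i ∈ s with k i ≤ y, a i‖ ≤ ∑' n, w n *
        (‖∑ i ∈ s, a i * expTwoPi (t n * Real.log (k i))‖ +
          ‖∑ i ∈ s, a i * expTwoPi (-(t n) * Real.log (k i))‖) := by
  have hlog1 : 1 ≤ Real.log x := by
    rw [Real.le_log_iff_exp_le (by linarith)]
    have := Real.exp_one_lt_d9
    linarith
  -- The ramp must fit, after division by `P`, between `log y` and `log (y + 1)`, whose gap is at
  -- least `1 / (2x)`; as `P ≤ 4x`, this `δ` suffices.
  set δ : ℝ := 1 / (8 * x ^ 2) with hδdef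
  -- This scaling sends `log k` for `1 ≤ k ≤ 2x` into `[0, 1/2]`, within the period on which the
  -- quadratic formula holds.
  set P : ℝ := 2 * Real.log (2 * x) with hP
  have hlog2 : Real.log x ≤ Real.log (2 * x) := Real.log_le_log (by linarith) (by linarith)
  have hPpos : 0 < P := by linarith
  have hδ : 0 < δ := by positivity
  have hδ4 : δ ≤ 1 / 4 := by
    rw [hδdef]; apply one_div_le_one_div_of_le <;> nlinarith
  have hsum : ∀ N, ∑ n ∈ range N, cutoffWeight δ n ≤ 8 * Real.log x := by
    intro N
    refine (sum_cutoffWeight_le hδ N).trans ?_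
    have h1 : 1 / δ = 8 * x ^ 2 := by rw [hδdef, one_div_one_div]
    rw [h1]
    have h2 : (⌈8 * x ^ 2⌉₊ : ℝ) ≤ x ^ 4 := by
      have := Nat.ceil_lt_add_one (a := 8 * x ^ 2) (by positivity)
      have h16 : 16 ≤ x ^ 2 := by nlinarith
      nlinarith
    have h3 : Real.log ⌈8 * x ^ 2⌉₊ ≤ Real.log (x ^ 4) := by
      refine Real.log_le_log ?_ h2
      exact_mod_cast Nat.ceil_pos.2 (by positivity)
    rw [Real.log_pow] at h3
    push_cast at h3
    linarith
  refine ⟨cutoffWeight δ, fun n => n / P, cutoffWeight_nonneg hδ,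
    summable_of_sum_range_le (cutoffWeight_nonneg hδ) hsum,
    Real.tsum_le_of_sum_range_le (cutoffWeight_nonneg hδ) hsum, ?_⟩
  intro ι y hy s k hk a
  have hWs : Summable (cutoffWeight δ) := summable_of_sum_range_le (cutoffWeight_nonneg hδ) hsum
  set S : ℝ → ℂ := fun τ => ∑ i ∈ s, a i * expTwoPi (τ * Real.log (k i)) with hS
  have hSb : ∀ τ, ‖S τ‖ ≤ ∑ i ∈ s, ‖a i‖ := by
    intro τ
    refine (norm_sum_le _ _).trans (le_of_eq ?_)
    simp [norm_expTwoPi]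
  have hRs : Summable fun n : ℕ => cutoffWeight δ n * (‖S (n / P)‖ + ‖S (-(n / P))‖) := by
    refine Summable.of_nonneg_of_le (fun n => mul_nonneg (cutoffWeight_nonneg hδ n) (by positivity))
      (fun n => ?_) (hWs.mul_right (∑ i ∈ s, ‖a i‖ + ∑ i ∈ s, ‖a i‖))
    exact mul_le_mul_of_nonneg_left (add_le_add (hSb _) (hSb _)) (cutoffWeight_nonneg hδ n)
  rcases Nat.eq_zero_or_pos y with rfl | hy0
  · have : s.filter (fun i => k i ≤ 0) = ∅ := by
      refine filter_eq_empty_iff.2 fun i hi => ?_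
      have := (hk i hi).1; omega
    rw [this, sum_empty, norm_zero]
    exact tsum_nonneg fun n => mul_nonneg (cutoffWeight_nonneg hδ n) (by positivity)
  have hy1 : (1 : ℝ) ≤ y := by exact_mod_cast hy0
  set b : ℝ := Real.log y / P with hb
  have hhalf : ∀ z : ℝ, 1 ≤ z → z ≤ 2 * x → 0 ≤ Real.log z / P ∧ Real.log z / P ≤ 1 / 2 := by
    intro z h1 h2
    refine ⟨div_nonneg (Real.log_nonneg h1) hPpos.le, ?_⟩
    rw [div_le_iff₀ hPpos, hP]
    have := Real.log_le_log (by linarith) h2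
    linarith
  have hb2 := hhalf y hy1 (by linarith)
  have hhas : ∀ i ∈ s, HasSum (fun n : ℕ =>
      a i * (cutoffCoeff δ b n * expTwoPi (n * (Real.log (k i) / P)) +
      (starRingEnd ℂ) (cutoffCoeff δ b n) * expTwoPi (-(n * (Real.log (k i) / P)))))
      (a i * ((if k i ≤ y then 1 else 0) - (b + 1 / 4 : ℝ))) := by
    intro i hi
    obtain ⟨hk1, hk2⟩ := hk i hi
    have hk1' : (1 : ℝ) ≤ k i := by exact_mod_cast hk1
    have hu := hhalf (k i) hk1' hk2
    refine HasSum.mul_left _ ?_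
    have hiff : Real.log (k i) / P ≤ b ↔ k i ≤ y := by
      rw [hb, div_le_div_iff_of_pos_right hPpos, Real.log_le_log_iff (by linarith) (by linarith)]
      exact Nat.cast_le
    have := hasSum_cutoff (b := b) (u := Real.log (k i) / P) hδ hδ4 hb2.1 hb2.2 hu.1 hu.2 (by
      by_cases hc : k i ≤ y
      · exact Or.inl (hiff.2 hc)
      · right
        have hky : (y : ℝ) + 1 ≤ k i := by
          have : y + 1 ≤ k i := by omega
          exact_mod_cast this
        have h1 : Real.log y + 1 / (2 * x) ≤ Real.log (k i) := by
          have h2 := Real.one_sub_inv_le_log_of_pos (x := (k i : ℝ) / y) (by positivity)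
          rw [Real.log_div (by linarith) (by linarith), inv_div] at h2
          have h3 : (y : ℝ) / k i ≤ y / (y + 1) := by gcongr
          have h4 : (y : ℝ) / (y + 1) = 1 - 1 / (y + 1) := by field_simp; ring
          have h5 : 1 / (2 * x) ≤ 1 / ((y : ℝ) + 1) := by gcongr; linarith
          linarith
        have h6 : δ * P ≤ 1 / (2 * x) := by
          have h7 : Real.log (2 * x) ≤ 2 * x := (Real.log_le_self (by linarith))
          rw [hδdef, div_mul_eq_mul_div, div_le_div_iff₀ (by positivity) (by positivity), hP]
          nlinarith
        rw [hb, div_add' _ _ _ hPpos.ne', div_le_div_iff_of_pos_right hPpos]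
        linarith)
    simpa only [hiff] using this
  have htot := hasSum_sum hhas
  set A : ℕ → ℂ := fun n => cutoffCoeff δ b n * S (n / P) +
    (starRingEnd ℂ) (cutoffCoeff δ b n) * S (-(n / P)) with hA
  have hA' : HasSum A (∑ i ∈ s with k i ≤ y, a i - (b + 1 / 4 : ℝ) * S 0) := by
    convert htot using 1
    · funext n
      simp only [hA, hS, mul_sum, ← sum_add_distrib]
      refine sum_congr rfl fun i _ => ?_
      have e1 : (n : ℝ) / P * Real.log (k i) = n * (Real.log (k i) / P) := by ring
      rw [neg_mul, e1]; ring
    · simp only [hS, sum_filter, mul_sum, ← sum_sub_distrib]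
      refine sum_congr rfl fun i _ => ?_
      rw [zero_mul, expTwoPi_zero]
      split_ifs <;> ring
  -- Division by zero makes the coefficient at `n = 0` vanish, so the weight `1` at that index is
  -- free to carry the constant term, where `b + 1/4 ≤ 3/4`.
  have hA0 : A 0 = 0 := by simp [hA, cutoffCoeff]
  have hAle : ∀ n, ‖A n‖ ≤ cutoffWeight δ n * (‖S (n / P)‖ + ‖S (-(n / P))‖) := by
    intro n
    refine (norm_add_le _ _).trans ?_
    rw [norm_mul, norm_mul, RCLike.norm_conj, ← mul_add]
    exact mul_le_mul_of_nonneg_right (norm_cutoffCoeff_le hδ b n) (by positivity)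
  have hdec : ∑ i ∈ s with k i ≤ y, a i = (b + 1 / 4 : ℝ) * S 0 + ∑' n, A n := by
    rw [hA'.tsum_eq]; ring
  rw [hdec]
  refine (norm_add_le _ _).trans ?_
  rw [hA'.summable.tsum_eq_zero_add, hA0, zero_add, hRs.tsum_eq_zero_add]
  refine add_le_add ?_ ?_
  · rw [norm_mul, Complex.norm_real, Real.norm_of_nonneg (by linarith [hb2.1])]
    simp only [cutoffWeight, if_true, Nat.cast_zero, zero_div, neg_zero, one_mul]
    have := norm_nonneg (S 0)
    nlinarith [hb2.2]
  · refine tsum_of_norm_bounded ((summable_nat_add_iff 1).2 hRs).hasSum fun n => hAle (n + 1)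

/-! ### The large sieve for bilinear forms with a maximum -/

/-- All primitive characters of moduli `1 ≤ q ≤ R`. -/
noncomputable def charPairs (R : ℕ) : Finset (Σ q : ℕ, DirichletCharacter ℂ q) :=
  (Icc 1 R).sigma primitiveCharacters

/-- The weight `q / φ(q)` of a character modulo `q`. -/
noncomputable def modulusWeight (p : Σ q : ℕ, DirichletCharacter ℂ q) : ℝ :=
  (p.1 : ℝ) / p.1.totient

theorem modulusWeight_nonneg (p : Σ q : ℕ, DirichletCharacter ℂ q) : 0 ≤ modulusWeight p := by
  unfold modulusWeight; positivity

theorem mem_charPairs {R : ℕ} {p : Σ q : ℕ, DirichletCharacter ℂ q} :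
    p ∈ charPairs R ↔ (1 ≤ p.1 ∧ p.1 ≤ R) ∧ p.2.IsPrimitive := by
  simp [charPairs, mem_primitiveCharacters]

theorem sum_charPairs (R : ℕ) (F : (Σ q : ℕ, DirichletCharacter ℂ q) → ℝ) :
    ∑ p ∈ charPairs R, modulusWeight p * F p =
      ∑ q ∈ Icc 1 R, (q : ℝ) / q.totient * ∑ χ ∈ primitiveCharacters q, F ⟨q, χ⟩ := by
  rw [charPairs, sum_sigma]
  simp only [modulusWeight, mul_sum]

theorem large_sieve_charPairs {R : ℕ} (hR : 1 ≤ R) (M : ℕ) (a : ℕ → ℂ) :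
    ∑ p ∈ charPairs R, modulusWeight p * ‖∑ n ∈ Icc 1 M, a n * p.2 (n : ZMod p.1)‖ ^ 2 ≤
      18 * (M + (R : ℝ) ^ 2) * ∑ n ∈ Icc 1 M, ‖a n‖ ^ 2 := by
  have key : ∀ {A : Type} [AddCommMonoid A] (f : ℕ → A), f 0 = 0 →
      ∑ n ∈ range (M + 1), f n = ∑ n ∈ Icc 1 M, f n := by
    intro A _ f hf
    rw [range_eq_Ico, sum_eq_sum_Ico_succ_bot (by omega), hf, zero_add]
    rfl
  -- The coefficient at `0` must be cleared because the character modulo 1 does not vanish there.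
  -- The range then has length `M + 1`, whence 18 in place of 9.
  set a' : ℕ → ℂ := fun n => if n = 0 then 0 else a n with ha'
  have hc : ∀ n ∈ Icc 1 M, a' n = a n := fun n hn => by
    have : n ≠ 0 := by have := (mem_Icc.1 hn).1; omega
    simp [ha', this]
  have h := multiplicative_large_sieve hR (M + 1) a'
  rw [key (fun n => ‖a' n‖ ^ 2) (by simp [ha']),
    sum_congr (f := fun n => ‖a' n‖ ^ 2) rfl fun n hn => by rw [hc n hn]] at h
  have h2 : ∑ p ∈ charPairs R, modulusWeight p * ‖∑ n ∈ Icc 1 M, a n * p.2 (n : ZMod p.1)‖ ^ 2 =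
    ∑ q ∈ Icc 1 R, (q : ℝ) / q.totient * ∑ χ ∈ primitiveCharacters q,
      ‖∑ n ∈ range (M + 1), a' n * χ (n : ZMod q)‖ ^ 2 := by
    rw [sum_charPairs R (fun p => ‖∑ n ∈ Icc 1 M, a n * p.2 (n : ZMod p.1)‖ ^ 2)]
    refine sum_congr rfl fun q _ => ?_
    congr 1
    refine sum_congr rfl fun χ _ => ?_
    rw [key (fun n => a' n * χ (n : ZMod q)) (by simp [ha'])]
    congr 2
    exact sum_congr rfl fun n hn => by rw [hc n hn]
  rw [h2]
  refine h.trans ?_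
  gcongr ?_ * _
  have : (1 : ℝ) ≤ (R : ℝ) ^ 2 := by exact_mod_cast Nat.one_le_pow _ _ hR
  have hM : (0 : ℝ) ≤ M := Nat.cast_nonneg M
  push_cast
  linarith

theorem sum_weight_mul_le_sqrt {ι : Type*} (s : Finset ι) (ω f g : ι → ℝ) (hω : ∀ i, 0 ≤ ω i) :
    ∑ i ∈ s, ω i * (f i * g i) ≤ √(∑ i ∈ s, ω i * f i ^ 2) * √(∑ i ∈ s, ω i * g i ^ 2) := by
  have h := Real.sum_mul_le_sqrt_mul_sqrt s (fun i => √(ω i) * f i) (fun i => √(ω i) * g i)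
  simp only [mul_pow, Real.sq_sqrt (hω _)] at h
  refine le_trans (le_of_eq (sum_congr rfl fun i _ => ?_)) h
  rw [mul_mul_mul_comm, Real.mul_self_sqrt (hω i)]

/-- The sum over `m ≤ M`, `n ≤ N` with `mn ≤ y` of `a m * b n * χ (m n)`. -/
noncomputable def hyperbolaSum (a b : ℕ → ℂ) (M N y : ℕ) (p : Σ q : ℕ, DirichletCharacter ℂ q) :
    ℂ :=
  ∑ i ∈ Icc 1 M ×ˢ Icc 1 N with i.1 * i.2 ≤ y, a i.1 * b i.2 * p.2 ((i.1 * i.2 : ℕ) : ZMod p.1)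

/-- Maximal bilinear large sieve. -/
theorem bilinear_large_sieve {x : ℝ} (hx : 4 ≤ x) {R : ℕ} (hR : 1 ≤ R) {M N : ℕ}
    (hMN : (M : ℝ) * N ≤ 2 * x) (a b : ℕ → ℂ) (Y : (Σ q : ℕ, DirichletCharacter ℂ q) → ℕ)
    (hY : ∀ p, (Y p : ℝ) ≤ x) :
    ∑ p ∈ charPairs R, modulusWeight p * ‖hyperbolaSum a b M N (Y p) p‖ ≤
      288 * Real.log x * (√((M + (R : ℝ) ^ 2) * ∑ n ∈ Icc 1 M, ‖a n‖ ^ 2) *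
        √((N + (R : ℝ) ^ 2) * ∑ n ∈ Icc 1 N, ‖b n‖ ^ 2)) := by
  -- The weights and frequencies do not depend on the cutoff, so `Y p` may vary with the character,
  -- and one large sieve bound per frequency serves every choice of `Y`.
  obtain ⟨w, t, hw0, hws, hwsum, hsep⟩ := exists_separation hx
  set s := Icc 1 M ×ˢ Icc 1 N with hs
  set Z : ℝ := √((M + (R : ℝ) ^ 2) * ∑ n ∈ Icc 1 M, ‖a n‖ ^ 2) *
        √((N + (R : ℝ) ^ 2) * ∑ n ∈ Icc 1 N, ‖b n‖ ^ 2) with hZ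
  have hZ0 : 0 ≤ Z := by positivity
  have hk : ∀ i ∈ s, 1 ≤ i.1 * i.2 ∧ ((i.1 * i.2 : ℕ) : ℝ) ≤ 2 * x := by
    intro i hi
    simp only [hs, mem_product, mem_Icc] at hi
    refine ⟨Nat.mul_le_mul hi.1.1 hi.2.1, le_trans ?_ hMN⟩
    exact_mod_cast Nat.mul_le_mul hi.1.2 hi.2.2
  set T : ℝ → (Σ q : ℕ, DirichletCharacter ℂ q) → ℂ := fun τ p =>
    ∑ i ∈ s, a i.1 * b i.2 * p.2 ((i.1 * i.2 : ℕ) : ZMod p.1) *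
      expTwoPi (τ * Real.log ((i.1 * i.2 : ℕ) : ℝ)) with hT
  have hTb : ∀ τ p, ‖T τ p‖ ≤ ∑ i ∈ s, ‖a i.1 * b i.2 * p.2 ((i.1 * i.2 : ℕ) : ZMod p.1)‖ := by
    intro τ p
    refine (norm_sum_le _ _).trans (le_of_eq ?_)
    simp [norm_expTwoPi]
  have hfac : ∀ τ p, T τ p = (∑ m ∈ Icc 1 M, a m * expTwoPi (τ * Real.log m) * p.2 (m : ZMod p.1)) *
      (∑ n ∈ Icc 1 N, b n * expTwoPi (τ * Real.log n) * p.2 (n : ZMod p.1)) := by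
    intro τ p
    rw [sum_mul_sum, ← sum_product', hT]
    refine sum_congr rfl fun i hi => ?_
    simp only [mem_product, mem_Icc] at hi
    have h1 : (i.1 : ℝ) ≠ 0 := by have := hi.1.1; positivity
    have h2 : (i.2 : ℝ) ≠ 0 := by have := hi.2.1; positivity
    push_cast
    rw [Real.log_mul h1 h2, mul_add, expTwoPi_add, map_mul]
    ring
  have hW : ∀ τ, ∑ p ∈ charPairs R, modulusWeight p * ‖T τ p‖ ≤ 18 * Z := by
    intro τ
    simp_rw [hfac, norm_mul]
    refine (sum_weight_mul_le_sqrt _ _ _ _ modulusWeight_nonneg).trans ?_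
    have e : ∀ (c : ℕ → ℂ) (K : ℕ), √(∑ p ∈ charPairs R, modulusWeight p *
        ‖∑ m ∈ Icc 1 K, c m * expTwoPi (τ * Real.log m) * p.2 (m : ZMod p.1)‖ ^ 2) ≤
        √18 * √((K + (R : ℝ) ^ 2) * ∑ n ∈ Icc 1 K, ‖c n‖ ^ 2) := by
      intro c K
      rw [← Real.sqrt_mul (by norm_num)]
      refine Real.sqrt_le_sqrt ?_
      have := large_sieve_charPairs hR K (fun m => c m * expTwoPi (τ * Real.log m))
      simp only [norm_mul, norm_expTwoPi, mul_one] at this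
      rwa [mul_assoc] at this
    calc _ ≤ (√18 * √((M + (R : ℝ) ^ 2) * ∑ n ∈ Icc 1 M, ‖a n‖ ^ 2)) *
          (√18 * √((N + (R : ℝ) ^ 2) * ∑ n ∈ Icc 1 N, ‖b n‖ ^ 2)) :=
          mul_le_mul (e a M) (e b N) (by positivity) (by positivity)
      _ = (√18 * √18) * Z := by rw [hZ]; ring
      _ = 18 * Z := by rw [Real.mul_self_sqrt (by norm_num)]
  have hsm : ∀ p, Summable fun n => w n * (‖T (t n) p‖ + ‖T (-(t n)) p‖) := by
    intro p
    set B := ∑ i ∈ s, ‖a i.1 * b i.2 * p.2 ((i.1 * i.2 : ℕ) : ZMod p.1)‖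
    refine Summable.of_nonneg_of_le (fun n => mul_nonneg (hw0 n) (by positivity)) (fun n => ?_)
      (hws.mul_right (B + B))
    exact mul_le_mul_of_nonneg_left (add_le_add (hTb _ p) (hTb _ p)) (hw0 n)
  calc _ ≤ ∑ p ∈ charPairs R, modulusWeight p * ∑' n, w n * (‖T (t n) p‖ + ‖T (-(t n)) p‖) := by
        refine sum_le_sum fun p _ => mul_le_mul_of_nonneg_left ?_ (modulusWeight_nonneg p)
        exact hsep (Y p) (hY p) s (fun i => i.1 * i.2) hk
          (fun i => a i.1 * b i.2 * p.2 ((i.1 * i.2 : ℕ) : ZMod p.1))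
    _ = ∑' n, ∑ p ∈ charPairs R, modulusWeight p * (w n * (‖T (t n) p‖ + ‖T (-(t n)) p‖)) := by
        rw [Summable.tsum_finsetSum fun p _ => (hsm p).mul_left _]
        exact sum_congr rfl fun p _ => (tsum_mul_left).symm
    _ ≤ ∑' n, w n * (36 * Z) := by
        have hle : ∀ n, ∑ p ∈ charPairs R, modulusWeight p * (w n * (‖T (t n) p‖ + ‖T (-(t n)) p‖))
            ≤ w n * (36 * Z) := by
          intro n
          have h1 := hW (t n)
          have h2 := hW (-(t n))
          calc _ = w n * (∑ p ∈ charPairs R, modulusWeight p * ‖T (t n) p‖ +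
                ∑ p ∈ charPairs R, modulusWeight p * ‖T (-(t n)) p‖) := by
                rw [← sum_add_distrib, mul_sum]
                exact sum_congr rfl fun p _ => by ring
            _ ≤ _ := mul_le_mul_of_nonneg_left (by linarith) (hw0 n)
        exact Summable.tsum_le_tsum hle (summable_sum fun p _ => (hsm p).mul_left _)
          (hws.mul_right _)
    _ = (∑' n, w n) * (36 * Z) := tsum_mul_right
    _ ≤ 8 * Real.log x * (36 * Z) := by gcongr
    _ = _ := by ring

/-! ### Rearrangement of divisor sums -/

theorem sum_divisorsAntidiagonal_eq {A : Type*} [AddCommMonoid A] (N : ℕ) (F : ℕ → ℕ → A) :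
    ∑ n ∈ Icc 1 N, ∑ i ∈ n.divisorsAntidiagonal, F i.1 i.2 =
      ∑ i ∈ Icc 1 N ×ˢ Icc 1 N with i.1 * i.2 ≤ N, F i.1 i.2 := by
  rw [sum_sigma']
  refine sum_nbij' (fun j => j.2) (fun i => ⟨i.1 * i.2, i⟩) ?_ ?_ ?_ (fun _ _ => rfl) (fun _ _ => rfl)
  · rintro ⟨n, i⟩ h
    simp only [mem_sigma, mem_Icc, Nat.mem_divisorsAntidiagonal, mem_filter, mem_product] at h ⊢
    obtain ⟨⟨h1, h2⟩, h3, h4⟩ := h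
    have ha : 0 < i.1 := Nat.pos_of_ne_zero fun h => by simp [h] at h3; omega
    have hb : 0 < i.2 := Nat.pos_of_ne_zero fun h => by simp [h] at h3; omega
    have := Nat.le_mul_of_pos_right i.1 hb
    have := Nat.le_mul_of_pos_left i.2 ha
    omega
  · intro i h
    simp only [mem_sigma, mem_Icc, Nat.mem_divisorsAntidiagonal, mem_filter, mem_product] at h ⊢
    have : 0 < i.1 * i.2 := Nat.mul_pos h.1.1.1 h.1.2.1
    exact ⟨⟨this, h.2⟩, trivial, this.ne'⟩
  · rintro ⟨n, i⟩ h
    simp only [mem_sigma, Nat.mem_divisorsAntidiagonal] at h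
    obtain ⟨-, rfl, -⟩ := h
    rfl

theorem sum_hyperbola_eq {A : Type*} [AddCommMonoid A] (N : ℕ) (F : ℕ → ℕ → A) :
    ∑ i ∈ Icc 1 N ×ˢ Icc 1 N with i.1 * i.2 ≤ N, F i.1 i.2 =
      ∑ a ∈ Icc 1 N, ∑ b ∈ Icc 1 (N / a), F a b := by
  rw [sum_filter, sum_product]
  refine sum_congr rfl fun a ha => ?_
  rw [← sum_filter]
  refine sum_congr ?_ fun _ _ => rfl
  ext b
  have ha1 := (mem_Icc.1 ha).1
  simp only [mem_filter, mem_Icc, Nat.le_div_iff_mul_le ha1, mul_comm b a]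
  constructor
  · rintro ⟨⟨h1, -⟩, h2⟩; exact ⟨h1, h2⟩
  · rintro ⟨h1, h2⟩; exact ⟨⟨h1, (Nat.le_mul_of_pos_left b ha1).trans h2⟩, h2⟩

/-! ### Chebyshev and Mertens bounds, and means of multiplicative functions -/

section Mertens
open ArithmeticFunction

theorem sum_vonMangoldt_le (N : ℕ) : ∑ n ∈ Icc 1 N, Λ n ≤ 6 * (N : ℝ) := by
  have h := Chebyshev.psi_le_const_mul_self (x := N) (Nat.cast_nonneg N)
  have h2 : Chebyshev.psi N = ∑ n ∈ Icc 1 N, Λ n := by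
    rw [Chebyshev.psi, Nat.floor_natCast]; rfl
  rw [← h2]
  refine h.trans ?_
  have : Real.log 4 ≤ 2 := by
    rw [show (4 : ℝ) = 2 ^ 2 by norm_num, Real.log_pow]
    have := Real.log_two_lt_d9
    push_cast; linarith
  gcongr
  linarith

/-- Summing `log n = ∑_{d ∣ n} Λ d` produces `∑ Λ d ⌊N / d⌋`; Chebyshev's bound pays for removing
the floor. -/
theorem sum_vonMangoldt_div_le {N : ℕ} (hN : 1 ≤ N) :
    ∑ n ∈ Icc 1 N, Λ n / n ≤ Real.log N + 6 := by
  have hN0 : (0 : ℝ) < N := by exact_mod_cast hN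
  have h1 : ∑ n ∈ Icc 1 N, Real.log n = ∑ d ∈ Icc 1 N, Λ d * ((N / d : ℕ) : ℝ) := by
    calc _ = ∑ n ∈ Icc 1 N, ∑ i ∈ n.divisorsAntidiagonal, Λ i.1 := by
          refine sum_congr rfl fun n _ => ?_
          rw [← vonMangoldt_sum, Nat.sum_divisorsAntidiagonal (fun i _ => Λ i)]
      _ = ∑ a ∈ Icc 1 N, ∑ b ∈ Icc 1 (N / a), Λ a := by
          rw [sum_divisorsAntidiagonal_eq N (fun a _ => Λ a), sum_hyperbola_eq N (fun a _ => Λ a)]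
      _ = _ := by
          refine sum_congr rfl fun a _ => ?_
          rw [sum_const, Nat.card_Icc, nsmul_eq_mul, Nat.add_sub_cancel, mul_comm]
  have h2 : ∑ n ∈ Icc 1 N, Real.log n ≤ N * Real.log N := by
    calc _ ≤ ∑ n ∈ Icc 1 N, Real.log N := by
          refine sum_le_sum fun n hn => Real.log_le_log ?_ ?_
          · exact_mod_cast (mem_Icc.1 hn).1
          · exact_mod_cast (mem_Icc.1 hn).2
      _ = _ := by simp
  have h3 : N * ∑ n ∈ Icc 1 N, Λ n / n ≤ ∑ d ∈ Icc 1 N, Λ d * ((N / d : ℕ) : ℝ) + ∑ d ∈ Icc 1 N, Λ d := by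
    rw [mul_sum, ← sum_add_distrib]
    refine sum_le_sum fun d hd => ?_
    have hd0 : (0 : ℝ) < d := by exact_mod_cast (mem_Icc.1 hd).1
    have h4 : (N : ℝ) / d ≤ ((N / d : ℕ) : ℝ) + 1 := by
      rw [div_le_iff₀ hd0]
      have := Nat.lt_div_mul_add (a := N) (mem_Icc.1 hd).1
      have h5 : (N : ℝ) < (N / d : ℕ) * d + d := by exact_mod_cast this
      nlinarith
    calc _ = Λ d * ((N : ℝ) / d) := by ring
      _ ≤ Λ d * (((N / d : ℕ) : ℝ) + 1) := mul_le_mul_of_nonneg_left h4 vonMangoldt_nonneg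
      _ = _ := by ring
  have h4 := sum_vonMangoldt_le N
  refine le_of_mul_le_mul_left ?_ hN0
  calc _ ≤ _ := h3
    _ ≤ N * Real.log N + 6 * N := by rw [← h1]; linarith
    _ = _ := by ring

theorem sum_log_div_prime_le {N : ℕ} (hN : 1 ≤ N) :
    ∑ p ∈ Icc 1 N with p.Prime, Real.log p / p ≤ 10 * Real.log N := by
  rcases hN.eq_or_lt with rfl | h
  · have : (Icc 1 1).filter Nat.Prime = ∅ := by decide
    rw [this]; simp
  · have h1 := sum_vonMangoldt_div_le hN
    have h2 : ∑ p ∈ Icc 1 N with p.Prime, Real.log p / p ≤ ∑ n ∈ Icc 1 N, Λ n / n := by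
      calc _ = ∑ p ∈ Icc 1 N with p.Prime, Λ p / p := by
            refine sum_congr rfl fun p hp => ?_
            rw [vonMangoldt_apply_prime (mem_filter.1 hp).2]
        _ ≤ _ := by
            refine sum_le_sum_of_subset_of_nonneg (filter_subset _ _) fun n _ _ => ?_
            exact div_nonneg vonMangoldt_nonneg (Nat.cast_nonneg n)
    have h3 : Real.log 2 ≤ Real.log N := Real.log_le_log (by norm_num) (by exact_mod_cast h)
    have := Real.log_two_gt_d9
    linarith

/-- The strongly multiplicative function with values `g p` at primes. -/
noncomputable def stronglyMul (g : ℕ → ℝ) (n : ℕ) : ℝ := ∏ p ∈ n.primeFactors, g p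

theorem stronglyMul_nonneg {g : ℕ → ℝ} (hg : ∀ p, 0 ≤ g p) (n : ℕ) : 0 ≤ stronglyMul g n :=
  prod_nonneg fun p _ => hg p

theorem stronglyMul_primePow_mul_le {g : ℕ → ℝ} (hg : ∀ p, 0 ≤ g p) (hg4 : ∀ p, g p ≤ 4)
    {d m : ℕ} (hd : IsPrimePow d) (hm : m ≠ 0) : stronglyMul g (d * m) ≤ 4 * stronglyMul g m := by
  obtain ⟨p, k, hp, hk, rfl⟩ := (isPrimePow_nat_iff d).1 hd
  have h0 := stronglyMul_nonneg hg m
  have e : (p ^ k * m).primeFactors = insert p m.primeFactors := by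
    rw [Nat.primeFactors_mul (pow_ne_zero _ hp.ne_zero) hm, Nat.primeFactors_prime_pow hk.ne' hp]
    rfl
  rw [stronglyMul, e]
  by_cases h : p ∈ m.primeFactors
  · rw [insert_eq_of_mem h]
    change stronglyMul g m ≤ _
    linarith
  · rw [prod_insert h]
    exact mul_le_mul_of_nonneg_right (hg4 p) h0

/-- Split `log N` as `log n + log (N / n)`. The second part is at most `N / n`. In the first, write
`log n` as a divisor sum of `Λ`, detach the prime power `d` at the cost of a factor 4, and sum over
`d` by Chebyshev. This reduces a mean value to a logarithmic mean while gaining `log N`. -/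
theorem log_mul_sum_stronglyMul_le {g : ℕ → ℝ} (hg : ∀ p, 0 ≤ g p) (hg4 : ∀ p, g p ≤ 4) (N : ℕ) :
    Real.log N * ∑ n ∈ Icc 1 N, stronglyMul g n ≤
      25 * N * ∑ n ∈ Icc 1 N, stronglyMul g n / n := by
  set f := stronglyMul g
  have hf := stronglyMul_nonneg hg
  have h1 : ∑ n ∈ Icc 1 N, f n * Real.log n ≤ 24 * N * ∑ n ∈ Icc 1 N, f n / n := by
    calc _ = ∑ n ∈ Icc 1 N, ∑ i ∈ n.divisorsAntidiagonal, f (i.2 * i.1) * Λ i.2 := by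
          refine sum_congr rfl fun n _ => ?_
          rw [← vonMangoldt_sum, ← Nat.sum_divisorsAntidiagonal' (fun _ i => Λ i), mul_sum]
          refine sum_congr rfl fun i hi => ?_
          rw [mul_comm i.2, (Nat.mem_divisorsAntidiagonal.1 hi).1]
      _ = ∑ m ∈ Icc 1 N, ∑ d ∈ Icc 1 (N / m), f (d * m) * Λ d := by
          rw [sum_divisorsAntidiagonal_eq N (fun a b => f (b * a) * Λ b),
            sum_hyperbola_eq N (fun a b => f (b * a) * Λ b)]
      _ ≤ ∑ m ∈ Icc 1 N, ∑ d ∈ Icc 1 (N / m), 4 * f m * Λ d := by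
          refine sum_le_sum fun m hm => sum_le_sum fun d _ => ?_
          by_cases hd : IsPrimePow d
          · refine mul_le_mul_of_nonneg_right ?_ vonMangoldt_nonneg
            exact stronglyMul_primePow_mul_le hg hg4 hd (by have := (mem_Icc.1 hm).1; omega)
          · rw [vonMangoldt_eq_zero_iff.2 hd, mul_zero, mul_zero]
      _ ≤ ∑ m ∈ Icc 1 N, 4 * f m * (6 * (N / m)) := by
          refine sum_le_sum fun m _ => ?_
          rw [← mul_sum]
          refine mul_le_mul_of_nonneg_left ?_ (by have := hf m; positivity)
          refine (sum_vonMangoldt_le _).trans ?_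
          gcongr
          exact Nat.cast_div_le
      _ = _ := by rw [mul_sum]; exact sum_congr rfl fun m _ => by ring
  have h2 : ∑ n ∈ Icc 1 N, f n * (Real.log N - Real.log n) ≤ N * ∑ n ∈ Icc 1 N, f n / n := by
    rw [mul_sum]
    refine sum_le_sum fun n hn => ?_
    have hn0 : (0 : ℝ) < n := by exact_mod_cast (mem_Icc.1 hn).1
    have hN0 : (0 : ℝ) < N := by
      have := (mem_Icc.1 hn); exact_mod_cast lt_of_lt_of_le this.1 this.2
    rw [← Real.log_div hN0.ne' hn0.ne']
    have := Real.log_le_self (x := (N : ℝ) / n) (by positivity)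
    calc _ ≤ f n * (N / n) := mul_le_mul_of_nonneg_left this (hf n)
      _ = _ := by ring
  have h3 : Real.log N * ∑ n ∈ Icc 1 N, f n = ∑ n ∈ Icc 1 N, f n * Real.log n +
      ∑ n ∈ Icc 1 N, f n * (Real.log N - Real.log n) := by
    rw [← sum_add_distrib, mul_sum]; exact sum_congr rfl fun n _ => by ring
  rw [h3]
  linarith

theorem stronglyMul_prime_pow {g : ℕ → ℝ} {p e : ℕ} (hp : p.Prime) (he : e ≠ 0) :
    stronglyMul g (p ^ e) = g p := by
  rw [stronglyMul, Nat.primeFactors_prime_pow he hp, prod_singleton]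

theorem hasSum_stronglyMul_prime_pow {g : ℕ → ℝ} {p : ℕ} (hp : p.Prime) :
    HasSum (fun e : ℕ => stronglyMul g (p ^ e) / ((p ^ e : ℕ) : ℝ)) (1 + g p / (p - 1)) := by
  have hp2 : (2 : ℝ) ≤ p := by exact_mod_cast hp.two_le
  have h : HasSum (fun e : ℕ => g p / p * ((p : ℝ)⁻¹) ^ e) (g p / p * (1 - (p : ℝ)⁻¹)⁻¹) :=
    (hasSum_geometric_of_lt_one (by positivity) (inv_lt_one_of_one_lt₀ (by linarith))).mul_left _
  have e1 : g p / p * (1 - (p : ℝ)⁻¹)⁻¹ = g p / (p - 1) := by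
    have : (p : ℝ) - 1 ≠ 0 := by linarith
    field_simp
  rw [e1] at h
  have h5 : HasSum (fun e : ℕ => stronglyMul g (p ^ (e + 1)) / ((p ^ (e + 1) : ℕ) : ℝ))
      (g p / (p - 1)) := by
    refine h.congr_fun fun e => ?_
    rw [stronglyMul_prime_pow hp (Nat.succ_ne_zero e), inv_pow]
    push_cast
    rw [pow_succ]
    field_simp
  have h6 := (hasSum_nat_add_iff (f := fun e : ℕ => stronglyMul g (p ^ e) / ((p ^ e : ℕ) : ℝ)) 1).1 h5
  have h7 : 1 + g p / (p - 1) = g p / (p - 1) +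
      ∑ e ∈ range 1, stronglyMul g (p ^ e) / ((p ^ e : ℕ) : ℝ) := by
    simp [stronglyMul, add_comm]
  rw [h7]
  exact h6

/-- The sum is dominated by the Euler product over primes up to `N`. Replacing `p - 1` by `p` costs
at most `8 / p²` at each prime, and `∑ 1 / p² ≤ 1` accounts for the 8. -/
theorem sum_stronglyMul_div_le {g : ℕ → ℝ} (hg : ∀ p, 0 ≤ g p) (hg4 : ∀ p, g p ≤ 4) (N : ℕ) :
    ∑ n ∈ Icc 1 N, stronglyMul g n / n ≤
      Real.exp (8 + ∑ p ∈ Icc 1 N with p.Prime, g p / p) := by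
  set F : ℕ → ℝ := fun n => stronglyMul g n / n with hF
  have hF0 : ∀ n, 0 ≤ F n := fun n => div_nonneg (stronglyMul_nonneg hg n) (Nat.cast_nonneg n)
  have hF1 : F 1 = 1 := by simp [hF, stronglyMul]
  have hmul : ∀ {m n : ℕ}, m.Coprime n → F (m * n) = F m * F n := by
    intro m n hmn
    simp only [hF, stronglyMul, hmn.primeFactors_mul, prod_union hmn.disjoint_primeFactors]
    push_cast
    rw [div_mul_div_comm]
  have hsum : ∀ {p : ℕ}, p.Prime → Summable fun n : ℕ => ‖F (p ^ n)‖ := by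
    intro p hp
    simp only [Real.norm_of_nonneg (hF0 _)]
    exact (hasSum_stronglyMul_prime_pow hp).summable
  have h := (EulerProduct.summable_and_hasSum_smoothNumbers_prod_primesBelow_tsum hF1 hmul hsum
    (N + 1)).2
  have h' := (hasSum_subtype_iff_indicator (f := F) (s := (N + 1).smoothNumbers)).1 h
  have h1 : ∑ n ∈ Icc 1 N, F n ≤ ∏ p ∈ (N + 1).primesBelow, ∑' n : ℕ, F (p ^ n) := by
    have e : ∑ n ∈ Icc 1 N, F n = ∑ n ∈ Icc 1 N, ((N + 1).smoothNumbers).indicator F n := by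
      refine sum_congr rfl fun n hn => ?_
      rw [Set.indicator_of_mem]
      rw [mem_Icc] at hn
      refine Nat.mem_smoothNumbers_of_lt hn.1 (by omega)
    rw [e]
    exact sum_le_hasSum _ (fun n _ => Set.indicator_nonneg (fun n _ => hF0 n) n) h'
  refine h1.trans ?_
  have hset : (N + 1).primesBelow = (Icc 1 N).filter Nat.Prime := by
    ext p
    simp only [Nat.primesBelow, mem_filter, mem_range, mem_Icc]
    constructor
    · rintro ⟨a, b⟩; exact ⟨⟨b.one_le, by omega⟩, b⟩
    · rintro ⟨⟨a, b⟩, c⟩; exact ⟨by omega, c⟩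
  rw [hset]
  calc _ ≤ ∏ p ∈ Icc 1 N with p.Prime, Real.exp (g p / p + 8 * ((p : ℝ) ^ 2)⁻¹) := by
        refine prod_le_prod (fun p _ => tsum_nonneg fun n => hF0 _) fun p hp => ?_
        have hp' := (mem_filter.1 hp).2
        have hp2 : (2 : ℝ) ≤ p := by exact_mod_cast hp'.two_le
        rw [(hasSum_stronglyMul_prime_pow hp').tsum_eq]
        have h2 : g p / (p - 1) ≤ g p / p + 8 * ((p : ℝ) ^ 2)⁻¹ := by
          have e : g p / (p - 1) = g p / p + g p / (p * (p - 1)) := by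
            have : (p : ℝ) - 1 ≠ 0 := by linarith
            field_simp
            ring
          have h3 : g p / (p * (p - 1)) ≤ 8 * ((p : ℝ) ^ 2)⁻¹ := by
            rw [← div_eq_mul_inv, div_le_div_iff₀ (by nlinarith) (by positivity)]
            have := hg4 p; have := hg p
            have h5 : (p : ℝ) ^ 2 ≤ 2 * (p * (p - 1)) := by nlinarith
            nlinarith
          rw [e]; linarith
        have := Real.add_one_le_exp (g p / (p - 1))
        calc _ ≤ Real.exp (g p / (p - 1)) := by linarith
          _ ≤ _ := Real.exp_le_exp.2 h2
    _ = Real.exp (∑ p ∈ Icc 1 N with p.Prime, (g p / p + 8 * ((p : ℝ) ^ 2)⁻¹)) := by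
        rw [Real.exp_sum]
    _ ≤ _ := by
        rw [Real.exp_le_exp, sum_add_distrib, add_comm, ← mul_sum]
        gcongr
        have h4 : ∑ p ∈ Icc 1 N with p.Prime, ((p : ℝ) ^ 2)⁻¹ ≤ ∑ p ∈ Ioo 1 (N + 1), ((p : ℝ) ^ 2)⁻¹ := by
          refine sum_le_sum_of_subset_of_nonneg ?_ fun _ _ _ => by positivity
          intro p hp
          rw [mem_filter, mem_Icc] at hp
          rw [mem_Ioo]
          exact ⟨hp.2.one_lt, by omega⟩
        have h5 := sum_Ioo_inv_sq_le (α := ℝ) 1 (N + 1)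
        norm_num at h5
        linarith

/-- Primes are grouped by `log p ≍ R / 2 ^ j`. Mertens' bound makes each group's `∑ 1 / p` bounded,
while the numerator is at most `min 4 (ξ² / 4 ^ j)`. Only about `K` groups reach the value 4 and the
others decay geometrically, so the total is `O(1 + log ξ)` for `ξ ≥ 1`, with `K` chosen minimal,
uniformly in `N`. -/
theorem sum_prime_min_div_le {N : ℕ} {R : ℝ} (hR : 0 < R) (hNR : Real.log N ≤ R)
    {ξ : ℝ} {K : ℕ} (hξ0 : 0 ≤ ξ) (hK : ξ ≤ 2 ^ K) :
    ∑ p ∈ Icc 1 N with p.Prime, min 4 ((ξ * (Real.log p / R)) ^ 2) / p ≤ 20 * (4 * K + 2) := by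
  set m : ℕ → ℝ := fun j => min 4 (ξ ^ 2 * (1 / 4) ^ j) with hm
  have hm0 : ∀ j, 0 ≤ m j := fun j => le_min (by norm_num) (by positivity)
  obtain ⟨J, hJ⟩ : ∃ J : ℕ, R / Real.log 2 < 2 ^ J := pow_unbounded_of_one_lt _ (by norm_num)
  have hl2 : 0 < Real.log 2 := Real.log_pos (by norm_num)
  have hpt : ∀ p ∈ (Icc 1 N).filter Nat.Prime, min 4 ((ξ * (Real.log p / R)) ^ 2) / p ≤
      ∑ j ∈ range J, if Real.log p ≤ R / 2 ^ j then 2 ^ (j + 1) * m j / R * (Real.log p / p) else 0 := by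
    intro p hp
    rw [mem_filter, mem_Icc] at hp
    have hp2 : (2 : ℝ) ≤ p := by exact_mod_cast hp.2.two_le
    have hlp : Real.log 2 ≤ Real.log p := Real.log_le_log (by norm_num) hp2
    have hlp0 : 0 < Real.log p := by linarith
    have hlR : Real.log p ≤ R := le_trans (Real.log_le_log (by linarith) (by exact_mod_cast hp.1.2)) hNR
    -- The group of `p`: `2 ^ j ≤ R / log p < 2 ^ (j + 1)`.
    obtain ⟨j, hj1, hj2⟩ := exists_nat_pow_near (x := R / Real.log p) (y := 2)
      (by rwa [one_le_div hlp0]) (by norm_num)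
    have hjJ : j < J := by
      have h1 : (2 : ℝ) ^ j < 2 ^ J := by
        refine lt_of_le_of_lt (hj1.trans ?_) hJ
        gcongr
      exact (pow_lt_pow_iff_right₀ (by norm_num)).1 h1
    have hcond : Real.log p ≤ R / 2 ^ j := by
      rw [le_div_iff₀ hlp0] at hj1
      rw [le_div_iff₀ (by positivity)]; linarith
    refine le_trans ?_ (single_le_sum (f := fun j => if Real.log p ≤ R / 2 ^ j then
      2 ^ (j + 1) * m j / R * (Real.log p / p) else 0) (fun i _ => ?_) (mem_range.2 hjJ))
    · simp only [if_pos hcond]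
      have h1 : min 4 ((ξ * (Real.log p / R)) ^ 2) ≤ m j := by
        refine min_le_min le_rfl ?_
        rw [mul_pow]
        gcongr
        calc (Real.log p / R) ^ 2 ≤ (1 / 2 ^ j) ^ 2 := by
              refine pow_le_pow_left₀ (by positivity) ?_ 2
              rw [div_le_div_iff₀ hR (by positivity)]
              rw [le_div_iff₀ (by positivity)] at hcond
              linarith
          _ = (1 / 4) ^ j := by
              rw [one_div, one_div, inv_pow, inv_pow, ← pow_mul, mul_comm, pow_mul]; norm_num
      have h2 : 1 ≤ 2 ^ (j + 1) / R * Real.log p := by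
        rw [div_lt_iff₀ hlp0] at hj2
        rw [div_mul_eq_mul_div, le_div_iff₀ hR]; linarith
      calc _ ≤ m j / p := by gcongr
        _ ≤ m j / p * (2 ^ (j + 1) / R * Real.log p) :=
            le_mul_of_one_le_right (div_nonneg (hm0 j) (by linarith)) h2
        _ = _ := by ring
    · split_ifs
      · have := hm0 i; positivity
      · exact le_rfl
  calc _ ≤ ∑ p ∈ Icc 1 N with p.Prime, ∑ j ∈ range J,
        if Real.log p ≤ R / 2 ^ j then 2 ^ (j + 1) * m j / R * (Real.log p / p) else 0 :=
        sum_le_sum hpt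
    _ = ∑ j ∈ range J, ∑ p ∈ Icc 1 N with p.Prime,
        if Real.log p ≤ R / 2 ^ j then 2 ^ (j + 1) * m j / R * (Real.log p / p) else 0 := sum_comm
    _ ≤ ∑ j ∈ range J, 20 * m j := by
        refine sum_le_sum fun j _ => ?_
        rw [← sum_filter, ← mul_sum]
        have hfl : 1 ≤ ⌊Real.exp (R / 2 ^ j)⌋₊ := by
          rw [Nat.one_le_floor_iff]
          exact Real.one_le_exp (by positivity)
        have h1 : ∑ p ∈ ((Icc 1 N).filter Nat.Prime).filter (fun p : ℕ => Real.log (p : ℝ) ≤ R / 2 ^ j),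
            Real.log (p : ℝ) / p ≤ ∑ p ∈ Icc 1 ⌊Real.exp (R / 2 ^ j)⌋₊ with p.Prime, Real.log p / p := by
          refine sum_le_sum_of_subset_of_nonneg ?_ fun p hp _ => ?_
          · intro p hp
            simp only [mem_filter, mem_Icc] at hp ⊢
            refine ⟨⟨hp.1.1.1, Nat.le_floor ?_⟩, hp.1.2⟩
            rw [← Real.log_le_iff_le_exp (by exact_mod_cast hp.1.2.pos)]
            exact hp.2
          · have : (1 : ℝ) ≤ p := by exact_mod_cast (mem_Icc.1 (mem_filter.1 hp).1).1
            exact div_nonneg (Real.log_nonneg this) (by linarith)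
        have h2 := sum_log_div_prime_le hfl
        have h3 : Real.log ⌊Real.exp (R / 2 ^ j)⌋₊ ≤ R / 2 ^ j := by
          rw [Real.log_le_iff_le_exp (by exact_mod_cast hfl)]
          exact Nat.floor_le (Real.exp_nonneg _)
        calc _ ≤ 2 ^ (j + 1) * m j / R * (10 * (R / 2 ^ j)) := by
              refine mul_le_mul_of_nonneg_left (by linarith) ?_
              have := hm0 j; positivity
          _ = _ := by field_simp; ring
    _ = 20 * ∑ j ∈ range J, m j := by rw [mul_sum]
    _ ≤ _ := by
        gcongr
        have hsub : ∑ j ∈ range J, m j ≤ ∑ j ∈ range (K + J), m j :=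
          sum_le_sum_of_subset_of_nonneg (range_subset_range.2 (by omega)) fun j _ _ => hm0 j
        refine hsub.trans ?_
        rw [sum_range_add]
        refine add_le_add ?_ ?_
        · calc _ ≤ ∑ j ∈ range K, (4 : ℝ) := sum_le_sum fun j _ => min_le_left _ _
            _ = _ := by simp [mul_comm]
        · calc _ ≤ ∑ j ∈ range J, ((1 : ℝ) / 4) ^ j := by
                refine sum_le_sum fun j _ => (min_le_right _ _).trans ?_
                rw [pow_add, ← mul_assoc]
                refine mul_le_of_le_one_left (by positivity) ?_
                have : ξ ^ 2 ≤ (2 ^ K) ^ 2 := by gcongr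
                calc _ ≤ (2 ^ K) ^ 2 * (1 / 4 : ℝ) ^ K := by gcongr
                  _ = 1 := by rw [← pow_mul, mul_comm K, pow_mul, ← mul_pow]; norm_num
            _ ≤ ∑ j ∈ range J, ((1 : ℝ) / 2) ^ j := by
                refine sum_le_sum fun j _ => ?_
                gcongr
                norm_num
            _ ≤ 2 := sum_geometric_two_le J

/-- The factor at `p` is at most `min 4 ((2π|ξ| log p / R)²)`, so the prime sum is logarithmic in `1
+ |ξ|` and its exponential is polynomial. Polynomial growth is all that integration against a
Schwartz function requires. -/
theorem exists_sum_twist_le : ∃ (C : ℝ) (B : ℕ), 0 < C ∧ ∀ (N : ℕ) (R ξ : ℝ), 1 ≤ N → 0 < R →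
    Real.log N ≤ R →
    Real.log N * ∑ n ∈ Icc 1 N, ∏ p ∈ n.primeFactors, ‖1 - expTwoPi (ξ * (Real.log p / R))‖ ^ 2 ≤
      C * N * (1 + |ξ|) ^ B := by
  -- Each doubling of `1 + |ξ|` adds `20 * 4 = 80` to the exponent, so `b` is the resulting
  -- polynomial degree.
  obtain ⟨b, hb⟩ : ∃ b : ℕ, Real.exp 80 < 2 ^ b := pow_unbounded_of_one_lt _ (by norm_num)
  refine ⟨25 * Real.exp 48 * (16 : ℝ) ^ b, b, by positivity, fun N R ξ hN hR hNR => ?_⟩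
  set g : ℕ → ℝ := fun p => ‖1 - expTwoPi (ξ * (Real.log p / R))‖ ^ 2 with hgdef
  have hg : ∀ p, 0 ≤ g p := fun p => by positivity
  have hgm : ∀ p, g p ≤ min 4 ((2 * Real.pi * |ξ| * (Real.log p / R)) ^ 2) := by
    intro p
    rw [hgdef]
    dsimp only
    rw [norm_sub_rev, norm_expTwoPi_sub_one]
    refine le_min ?_ ?_
    · rw [mul_pow, sq_abs]
      have := Real.sin_sq_le_one (Real.pi * (ξ * (Real.log p / R)))
      linarith
    · rw [← sq_abs (2 * Real.pi * |ξ| * (Real.log p / R))]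
      gcongr
      refine (mul_le_mul_of_nonneg_left Real.abs_sin_le_abs (by norm_num)).trans (le_of_eq ?_)
      simp only [abs_mul, abs_of_pos Real.pi_pos, abs_abs, abs_two]
      ring
  have hg4 : ∀ p, g p ≤ 4 := fun p => (hgm p).trans (min_le_left _ _)
  obtain ⟨K, hK1, hK2⟩ := exists_nat_pow_near (x := 8 * (1 + |ξ|)) (y := 2)
    (by have := abs_nonneg ξ; linarith) (by norm_num)
  have h1 := log_mul_sum_stronglyMul_le hg hg4 N
  have h2 := sum_stronglyMul_div_le hg hg4 N
  have h3 : ∑ p ∈ Icc 1 N with p.Prime, g p / p ≤ 20 * (4 * (K + 1 : ℕ) + 2) := by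
    refine le_trans (sum_le_sum fun p _ => ?_) (sum_prime_min_div_le hR hNR
      (ξ := 2 * Real.pi * |ξ|) (K := K + 1) (by positivity) ?_)
    · exact div_le_div_of_nonneg_right (hgm p) (Nat.cast_nonneg p)
    · have := Real.pi_lt_four
      have h0 := abs_nonneg ξ
      nlinarith
  have h4 : Real.exp (8 + ∑ p ∈ Icc 1 N with p.Prime, g p / p) ≤
      Real.exp 48 * (16 * (1 + |ξ|)) ^ b := by
    calc _ ≤ Real.exp (48 + ((K + 1 : ℕ) : ℝ) * 80) := by
          rw [Real.exp_le_exp]; push_cast at h3 ⊢; linarith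
      _ = Real.exp 48 * Real.exp 80 ^ (K + 1) := by rw [Real.exp_add, Real.exp_nat_mul]
      _ ≤ Real.exp 48 * (2 ^ b) ^ (K + 1) := by gcongr
      _ = Real.exp 48 * (2 ^ (K + 1)) ^ b := by rw [← pow_mul, ← pow_mul, mul_comm b]
      _ ≤ _ := by
        gcongr
        rw [pow_succ]; linarith
  calc _ ≤ _ := h1
    _ ≤ 25 * N * (Real.exp 48 * (16 * (1 + |ξ|)) ^ b) := by gcongr; exact h2.trans h4
    _ = _ := by rw [mul_pow]; ring

end Mertens

/-! ### Mean square of a smoothly truncated Möbius divisor sum -/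

section SmoothedMoebius
open ArithmeticFunction MeasureTheory
open scoped FourierTransform ContDiff ArithmeticFunction.Moebius

/-- A smooth cutoff, given with a rapidly decaying Fourier representation. -/
theorem exists_smooth_cutoff {η : ℝ} (hη : 0 < η) : ∃ (H : ℝ → ℝ) (φ : ℝ → ℂ),
    (∀ t, 0 ≤ H t ∧ H t ≤ 1) ∧ (∀ t, -1 ≤ t → t ≤ 0 → H t = 1) ∧ (∀ t, η ≤ t → H t = 0) ∧
    Continuous φ ∧ (∀ B : ℕ, Integrable fun ξ => ‖φ ξ‖ * (1 + |ξ|) ^ B) ∧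
    ∀ t, (H t : ℂ) = ∫ ξ, φ ξ * expTwoPi (ξ * t) := by
  -- A bump equal to 1 on `[-2, 0]` and supported in `[-2 - η, η]`. Compact support makes its
  -- transform Schwartz; the drop on the left is harmless, since only arguments at least `-1` need
  -- the value 1.
  let b : ContDiffBump (-1 : ℝ) := ⟨1, 1 + η, one_pos, by linarith⟩
  have hcs : HasCompactSupport fun t => ((b t : ℝ) : ℂ) :=
    b.hasCompactSupport.comp_left (g := fun r : ℝ => (r : ℂ)) Complex.ofReal_zero
  have hcd : ContDiff ℝ ∞ fun t => ((b t : ℝ) : ℂ) := Complex.ofRealCLM.contDiff.comp b.contDiff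
  let f : SchwartzMap ℝ ℂ := hcs.toSchwartzMap hcd
  let g : SchwartzMap ℝ ℂ := 𝓕 f
  refine ⟨b, g, fun t => ⟨b.nonneg, b.le_one⟩, fun t h1 h2 => ?_, fun t ht => ?_,
    g.continuous, fun B => ?_, fun t => ?_⟩
  · refine b.one_of_mem_closedBall ?_
    rw [Metric.mem_closedBall, Real.dist_eq, abs_le]
    constructor <;> simp only [b] <;> linarith
  · refine b.zero_of_le_dist ?_
    rw [Real.dist_eq]
    refine le_trans ?_ (le_abs_self _)
    simp only [b]; linarith
  · have h0 := g.integrable_pow_mul volume 0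
    have h1 := g.integrable_pow_mul volume B
    refine ((h0.add h1).const_mul (2 ^ (B - 1))).mono' ?_ (Filter.Eventually.of_forall fun ξ => ?_)
    · exact (by fun_prop : Continuous fun ξ : ℝ => ‖g ξ‖ * (1 + |ξ|) ^ B).aestronglyMeasurable
    · rw [Real.norm_of_nonneg (by positivity)]
      have := add_pow_le (zero_le_one (α := ℝ)) (abs_nonneg ξ) B
      simp only [pow_zero, one_mul, Pi.add_apply, one_pow, Real.norm_eq_abs] at this ⊢
      calc _ ≤ ‖g ξ‖ * (2 ^ (B - 1) * (1 + |ξ| ^ B)) := by gcongr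
        _ = _ := by ring
  · have h : 𝓕⁻ (𝓕 f) = f := FourierTransform.fourierInv_fourier_eq f
    have h2 : f t = (𝓕⁻ (𝓕 f)) t := by rw [h]
    have h3 : f t = (b t : ℂ) := rfl
    rw [← h3, h2, SchwartzMap.fourierInv_coe, Real.fourierInv_eq']
    refine integral_congr_ae (Filter.Eventually.of_forall fun ξ => ?_)
    simp only [smul_eq_mul, expTwoPi]
    rw [mul_comm]
    congr 2
    simp
    ring

theorem sum_moebius_mul_eq_prod {f : ℕ → ℂ} (h1 : f 1 = 1)
    (hf : ∀ m n, m ≠ 0 → n ≠ 0 → f (m * n) = f m * f n) {n : ℕ} (hn : n ≠ 0) :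
    ∑ d ∈ n.divisors, (μ d : ℂ) * f d = ∏ p ∈ n.primeFactors, (1 - f p) := by
  -- The value at `0` is overwritten because `f 0` is arbitrary; for the exponential used later it
  -- is 1.
  let F : ArithmeticFunction ℂ := ⟨fun n => if n = 0 then 0 else f n, by simp⟩
  have hF : ∀ n, n ≠ 0 → F n = f n := fun n hn => by simp [F, hn]
  have hFm : F.IsMultiplicative := by
    refine ⟨by rw [hF 1 one_ne_zero, h1], fun {m n} _ => ?_⟩
    rcases eq_or_ne m 0 with rfl | hm
    · simp
    rcases eq_or_ne n 0 with rfl | hn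
    · simp
    rw [hF _ (mul_ne_zero hm hn), hF m hm, hF n hn, hf m n hm hn]
  -- The Möbius function kills non-squarefree divisors, so `n` may be replaced by its radical.
  set r := ∏ p ∈ n.primeFactors, p with hr
  have hr0 : r ≠ 0 := prod_ne_zero_iff.2 fun p hp => (Nat.prime_of_mem_primeFactors hp).ne_zero
  have hrf : r.primeFactors = n.primeFactors :=
    Nat.primeFactors_prod fun p hp => Nat.prime_of_mem_primeFactors hp
  have hrs : Squarefree r := by
    have := UniqueFactorizationMonoid.squarefree_radical (a := n)
    rwa [Nat.radical_eq_prod_primeFactors] at this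
  have hrn : r ∣ n := Nat.prod_primeFactors_dvd n
  have h2 := hFm.prodPrimeFactors_one_sub_of_squarefree F hrs
  rw [hrf] at h2
  have h3 : ∏ p ∈ n.primeFactors, (1 - f p) = ∏ p ∈ n.primeFactors, (1 - F p) :=
    prod_congr rfl fun p hp => by rw [hF p (Nat.prime_of_mem_primeFactors hp).ne_zero]
  rw [h3, h2]
  symm
  calc _ = ∑ d ∈ r.divisors, (μ d : ℂ) * f d := by
        refine sum_congr rfl fun d hd => ?_
        rw [hF d (Nat.pos_of_mem_divisors hd).ne']
    _ = _ := by
        refine sum_subset (Nat.divisors_subset_of_dvd hn hrn) fun d hd hdr => ?_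
        by_cases hsq : Squarefree d
        · exfalso
          apply hdr
          rw [Nat.mem_divisors] at hd ⊢
          refine ⟨?_, hr0⟩
          rw [← Nat.prod_primeFactors_of_squarefree hsq]
          exact prod_dvd_prod_of_subset _ _ _ (Nat.primeFactors_mono hd.1 hn)
        · rw [moebius_eq_zero_of_not_squarefree hsq]; simp

theorem continuous_expTwoPi : Continuous expTwoPi := by
  unfold expTwoPi; fun_prop

/-- Cauchy–Schwarz for the weight `w`, from the discriminant of `c ↦ ∫ w (f - c)²`. -/
theorem sq_integral_mul_le {w f : ℝ → ℝ} (hw : ∀ ξ, 0 ≤ w ξ) (h0 : Integrable w)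
    (h1 : Integrable fun ξ => w ξ * f ξ) (h2 : Integrable fun ξ => w ξ * f ξ ^ 2) :
    (∫ ξ, w ξ * f ξ) ^ 2 ≤ (∫ ξ, w ξ) * ∫ ξ, w ξ * f ξ ^ 2 := by
  have key : ∀ c : ℝ, 0 ≤ (∫ ξ, w ξ) * (c * c) + (-2 * ∫ ξ, w ξ * f ξ) * c +
      ∫ ξ, w ξ * f ξ ^ 2 := by
    intro c
    have h : 0 ≤ ∫ ξ, w ξ * (f ξ - c) ^ 2 :=
      integral_nonneg fun ξ => mul_nonneg (hw ξ) (sq_nonneg _)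
    have e : (fun ξ => w ξ * (f ξ - c) ^ 2) =
        fun ξ => w ξ * f ξ ^ 2 - 2 * c * (w ξ * f ξ) + c ^ 2 * w ξ := by
      funext ξ; ring
    have i1 := h1.const_mul (2 * c)
    have i2 := h0.const_mul (c ^ 2)
    have i3 : Integrable fun ξ => w ξ * f ξ ^ 2 - 2 * c * (w ξ * f ξ) := h2.sub i1
    rw [e, integral_add i3 i2, integral_sub h2 i1, integral_const_mul,
      integral_const_mul] at h
    linarith
  have := discrim_le_zero key
  rw [discrim] at this
  linarith

/-- Fourier inversion of the cutoff turns the divisor sum into `∫ φ(ξ) ∏_{p ∣ n} (1 - e(ξ log p /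
L)) dξ` up to a unimodular factor in the integrand. Cauchy–Schwarz in `ξ` moves the square inside,
the mean over `n` is polynomial in `ξ`, and the decay of `φ` absorbs it. The shift `u` enters only
through the unimodular factor, hence uniformity in `u`. -/
theorem exists_smoothed_moebius {η : ℝ} (hη : 0 < η) : ∃ (H : ℝ → ℝ) (C : ℝ), 0 < C ∧
    (∀ t, 0 ≤ H t ∧ H t ≤ 1) ∧ (∀ t, -1 ≤ t → t ≤ 0 → H t = 1) ∧ (∀ t, η ≤ t → H t = 0) ∧
    ∀ (N : ℕ) (L u : ℝ), 1 ≤ N → 0 < L → Real.log N ≤ L →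
      Real.log N * ∑ n ∈ Icc 1 N, (∑ d ∈ n.divisors, (μ d : ℝ) * H (Real.log d / L - u)) ^ 2 ≤
        C * N := by
  obtain ⟨H, φ, hH01, hH1, hH0, hφc, hφi, hφ⟩ := exists_smooth_cutoff hη
  obtain ⟨C, B, hC, hmean⟩ := exists_sum_twist_le
  set A := ∫ ξ, ‖φ ξ‖ with hA
  set D := ∫ ξ, ‖φ ξ‖ * (1 + |ξ|) ^ B with hD
  have hA0 : 0 ≤ A := integral_nonneg fun ξ => norm_nonneg _
  have hD0 : 0 ≤ D := integral_nonneg fun ξ => by positivity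
  refine ⟨H, C * A * D + 1, by positivity, hH01, hH1, hH0, fun N L u hN hL hNL => ?_⟩
  have hφi0 : Integrable fun ξ => ‖φ ξ‖ := by simpa using hφi 0
  set P : ℕ → ℝ → ℝ := fun n ξ => ∏ p ∈ n.primeFactors, ‖1 - expTwoPi (ξ * (Real.log p / L))‖ with hP
  have hPc : ∀ n, Continuous (P n) := by
    intro n
    refine continuous_finsetProd _ fun p _ => ?_
    exact (continuous_const.sub (continuous_expTwoPi.comp (continuous_id.mul continuous_const))).norm
  have hP0 : ∀ n ξ, 0 ≤ P n ξ := fun n ξ => prod_nonneg fun p _ => norm_nonneg _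
  have hPb : ∀ n ξ, P n ξ ≤ 2 ^ n.primeFactors.card := by
    intro n ξ
    refine (prod_le_prod (fun p _ => norm_nonneg _) (fun p _ => ?_)).trans (prod_const _).le
    refine (norm_sub_le _ _).trans ?_
    rw [norm_expTwoPi]; norm_num
  have hi1 : ∀ n (k : ℕ), Integrable fun ξ => ‖φ ξ‖ * P n ξ ^ k := by
    intro n k
    refine (hφi0.const_mul ((2 ^ n.primeFactors.card) ^ k)).mono'
      ((hφc.norm.mul ((hPc n).pow k)).aestronglyMeasurable) (Filter.Eventually.of_forall fun ξ => ?_)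
    have := hP0 n ξ
    rw [Real.norm_of_nonneg (by positivity), mul_comm]
    gcongr
    exact hPb n ξ
  have hb : ∀ n ∈ Icc 1 N, (∑ d ∈ n.divisors, (μ d : ℝ) * H (Real.log d / L - u)) ^ 2 ≤
      A * ∫ ξ, ‖φ ξ‖ * P n ξ ^ 2 := by
    intro n hn
    have hn0 : n ≠ 0 := by have := (mem_Icc.1 hn).1; omega
    have hint : ∀ t, Integrable fun ξ => φ ξ * expTwoPi (ξ * t) := by
      intro t
      refine hφi0.mono' (hφc.mul (continuous_expTwoPi.comp (continuous_id.mul continuous_const))).aestronglyMeasurable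
        (Filter.Eventually.of_forall fun ξ => ?_)
      rw [norm_mul, norm_expTwoPi, mul_one]
    have e1 : ((∑ d ∈ n.divisors, (μ d : ℝ) * H (Real.log d / L - u) : ℝ) : ℂ) =
        ∫ ξ, φ ξ * expTwoPi (-(ξ * u)) * ∏ p ∈ n.primeFactors, (1 - expTwoPi (ξ * (Real.log p / L))) := by
      push_cast
      simp_rw [hφ, ← integral_const_mul]
      rw [← integral_finsetSum _ fun d _ => (hint _).const_mul _]
      congr 1
      funext ξ
      rw [← sum_moebius_mul_eq_prod (f := fun d => expTwoPi (ξ * (Real.log d / L)))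
        (by simp [expTwoPi_zero]) (fun m k hm hk => ?_) hn0, mul_sum]
      · refine sum_congr rfl fun d _ => ?_
        rw [mul_sub, sub_eq_add_neg, expTwoPi_add]
        ring
      · rw [← expTwoPi_add]
        push_cast
        rw [Real.log_mul (by exact_mod_cast hm) (by exact_mod_cast hk)]
        ring_nf
    have e2 : |∑ d ∈ n.divisors, (μ d : ℝ) * H (Real.log d / L - u)| ≤ ∫ ξ, ‖φ ξ‖ * P n ξ := by
      rw [← Real.norm_eq_abs, ← Complex.norm_real, e1]
      refine (norm_integral_le_integral_norm _).trans (le_of_eq ?_)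
      congr 1
      funext ξ
      rw [norm_mul, norm_mul, norm_expTwoPi, mul_one, norm_prod]
    rw [← sq_abs]
    refine (pow_le_pow_left₀ (abs_nonneg _) e2 2).trans ?_
    exact sq_integral_mul_le (fun ξ => norm_nonneg _) hφi0 (by simpa using hi1 n 1) (hi1 n 2)
  have hlog : 0 ≤ Real.log N := Real.log_nonneg (by exact_mod_cast hN)
  calc _ ≤ Real.log N * ∑ n ∈ Icc 1 N, A * ∫ ξ, ‖φ ξ‖ * P n ξ ^ 2 :=
        mul_le_mul_of_nonneg_left (sum_le_sum hb) hlog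
    _ = A * ∫ ξ, ‖φ ξ‖ * (Real.log N * ∑ n ∈ Icc 1 N, P n ξ ^ 2) := by
        rw [← mul_sum, ← integral_finsetSum _ fun n _ => hi1 n 2, mul_left_comm,
          ← integral_const_mul]
        congr 2
        funext ξ
        rw [mul_sum, mul_sum, mul_sum]
        exact sum_congr rfl fun n _ => by ring
    _ ≤ A * ∫ ξ, C * N * (‖φ ξ‖ * (1 + |ξ|) ^ B) := by
        refine mul_le_mul_of_nonneg_left ?_ hA0
        refine integral_mono ?_ ((hφi B).const_mul _) fun ξ => ?_
        · have := integrable_finsetSum (Icc 1 N) fun n _ => (hi1 n 2).const_mul (Real.log N)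
          refine this.congr (Filter.Eventually.of_forall fun ξ => ?_)
          simp only [mul_sum]
          exact sum_congr rfl fun n _ => by ring
        · dsimp only
          have := hmean N L ξ hN hL hNL
          simp only [hP, ← prod_pow]
          calc _ ≤ ‖φ ξ‖ * (C * N * (1 + |ξ|) ^ B) := mul_le_mul_of_nonneg_left this (norm_nonneg _)
            _ = _ := by ring
    _ = C * A * D * N := by rw [integral_const_mul]; ring
    _ ≤ _ := by
        have : (0 : ℝ) ≤ N := Nat.cast_nonneg N
        nlinarith

end SmoothedMoebius

/-! ### The mollified Vaughan identity and its linear sums -/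

section Vaughan
open ArithmeticFunction
open scoped ArithmeticFunction.zeta

/-- The part of an arithmetic function supported on `n ≤ U`. -/
noncomputable def lowPart (f : ArithmeticFunction ℝ) (U : ℕ) : ArithmeticFunction ℝ :=
  ⟨fun n => if n ≤ U then f n else 0, by simp⟩

/-- The part of an arithmetic function supported on `n > U`. -/
noncomputable def highPart (f : ArithmeticFunction ℝ) (U : ℕ) : ArithmeticFunction ℝ :=
  ⟨fun n => if n ≤ U then 0 else f n, by simp⟩

theorem lowPart_apply (f : ArithmeticFunction ℝ) (U n : ℕ) :
    lowPart f U n = if n ≤ U then f n else 0 := rfl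

theorem highPart_apply (f : ArithmeticFunction ℝ) (U n : ℕ) :
    highPart f U n = if n ≤ U then 0 else f n := rfl

theorem lowPart_add_highPart (f : ArithmeticFunction ℝ) (U : ℕ) :
    lowPart f U + highPart f U = f := by
  ext n
  rw [ArithmeticFunction.add_apply, lowPart_apply, highPart_apply]
  split_ifs <;> simp

/-- Vaughan's identity with a general mollifier `lam`. -/
theorem vonMangoldt_eq_mollified (lam : ArithmeticFunction ℝ) (U : ℕ) :
    vonMangoldt = lowPart vonMangoldt U + lam * ArithmeticFunction.log - lowPart vonMangoldt U * lam * ζ -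
      highPart vonMangoldt U * (lam * ζ - 1) := by
  have h1 := lowPart_add_highPart vonMangoldt U
  have h2 : vonMangoldt * (ζ : ArithmeticFunction ℝ) = ArithmeticFunction.log := vonMangoldt_mul_zeta
  have h3 : highPart vonMangoldt U = vonMangoldt - lowPart vonMangoldt U := eq_sub_of_add_eq' h1
  rw [h3, ← h2]
  ring

/-- The twisted sum of an arithmetic function up to `Y`. -/
noncomputable def twistedSum (f : ArithmeticFunction ℝ) (Y : ℕ)
    (p : Σ q : ℕ, DirichletCharacter ℂ q) : ℂ :=
  ∑ n ∈ Icc 1 Y, (f n : ℂ) * p.2 (n : ZMod p.1)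

theorem twistedSum_mul (f g : ArithmeticFunction ℝ) (Y : ℕ)
    (p : Σ q : ℕ, DirichletCharacter ℂ q) :
    twistedSum (f * g) Y p = ∑ i ∈ Icc 1 Y ×ˢ Icc 1 Y with i.1 * i.2 ≤ Y,
      (f i.1 : ℂ) * g i.2 * p.2 ((i.1 * i.2 : ℕ) : ZMod p.1) := by
  rw [← sum_divisorsAntidiagonal_eq Y
    (fun a b => (f a : ℂ) * g b * p.2 ((a * b : ℕ) : ZMod p.1)), twistedSum]
  refine sum_congr rfl fun n _ => ?_
  rw [mul_apply]
  push_cast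
  rw [sum_mul]
  refine sum_congr rfl fun i hi => ?_
  rw [← (Nat.mem_divisorsAntidiagonal.1 hi).1]
  push_cast
  rfl

theorem twistedSum_mul' (f g : ArithmeticFunction ℝ) (Y : ℕ)
    (p : Σ q : ℕ, DirichletCharacter ℂ q) :
    twistedSum (f * g) Y p = ∑ a ∈ Icc 1 Y, (f a : ℂ) * p.2 (a : ZMod p.1) *
      twistedSum g (Y / a) p := by
  rw [twistedSum_mul, sum_hyperbola_eq Y
    (fun a b => (f a : ℂ) * g b * p.2 ((a * b : ℕ) : ZMod p.1))]
  refine sum_congr rfl fun a _ => ?_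
  rw [twistedSum, mul_sum]
  refine sum_congr rfl fun b _ => ?_
  push_cast
  rw [map_mul]
  ring

theorem twistedSum_add (f g : ArithmeticFunction ℝ) (Y : ℕ)
    (p : Σ q : ℕ, DirichletCharacter ℂ q) :
    twistedSum (f + g) Y p = twistedSum f Y p + twistedSum g Y p := by
  simp only [twistedSum, ← sum_add_distrib, ArithmeticFunction.add_apply]
  exact sum_congr rfl fun n _ => by push_cast; ring

theorem twistedSum_sub (f g : ArithmeticFunction ℝ) (Y : ℕ)
    (p : Σ q : ℕ, DirichletCharacter ℂ q) :
    twistedSum (f - g) Y p = twistedSum f Y p - twistedSum g Y p := by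
  have := twistedSum_add (f - g) g Y p
  rw [sub_add_cancel] at this
  rw [this]; ring

theorem norm_twistedSum_le (f : ArithmeticFunction ℝ) (Y : ℕ)
    (p : Σ q : ℕ, DirichletCharacter ℂ q) : ‖twistedSum f Y p‖ ≤ ∑ n ∈ Icc 1 Y, |f n| := by
  refine (norm_sum_le _ _).trans (sum_le_sum fun n _ => ?_)
  rw [norm_mul, Complex.norm_real, Real.norm_eq_abs]
  exact mul_le_of_le_one_right (abs_nonneg _) (DirichletCharacter.norm_le_one _ _)

theorem norm_twistedSum_mul_le (f g : ArithmeticFunction ℝ) (Y : ℕ)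
    (p : Σ q : ℕ, DirichletCharacter ℂ q) {B : ℝ} (hB : ∀ y ≤ Y, ‖twistedSum g y p‖ ≤ B) :
    ‖twistedSum (f * g) Y p‖ ≤ B * ∑ n ∈ Icc 1 Y, |f n| := by
  rw [twistedSum_mul', mul_sum]
  refine (norm_sum_le _ _).trans (sum_le_sum fun n _ => ?_)
  rw [norm_mul, norm_mul, Complex.norm_real, Real.norm_eq_abs, mul_comm B]
  refine mul_le_mul ?_ (hB _ (Nat.div_le_self Y n)) (norm_nonneg _) (abs_nonneg _)
  exact mul_le_of_le_one_right (abs_nonneg _) (DirichletCharacter.norm_le_one _ _)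

theorem twistedSum_succ (f : ArithmeticFunction ℝ) (Y : ℕ)
    (p : Σ q : ℕ, DirichletCharacter ℂ q) :
    twistedSum f (Y + 1) p = twistedSum f Y p + f (Y + 1) * p.2 ((Y + 1 : ℕ) : ZMod p.1) := by
  rw [twistedSum, sum_Icc_succ_top (by omega), twistedSum]

/-- Abel summation, carried out by induction on `Y`: the error against `S Y * log Y` grows by at
most `B` times the increment of the logarithm. -/
theorem norm_twistedSum_log_le (p : Σ q : ℕ, DirichletCharacter ℂ q) {B : ℝ}
    (hB : ∀ y, ‖twistedSum (ζ : ArithmeticFunction ℝ) y p‖ ≤ B) (Y : ℕ) :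
    ‖twistedSum ArithmeticFunction.log Y p‖ ≤ 2 * B * Real.log Y := by
  set S : ℕ → ℂ := fun y => twistedSum (ζ : ArithmeticFunction ℝ) y p with hS
  have hB0 : 0 ≤ B := (norm_nonneg _).trans (hB 0)
  have key : ‖twistedSum ArithmeticFunction.log Y p - S Y * Real.log Y‖ ≤ B * Real.log Y := by
    induction Y with
    | zero => simp [twistedSum]
    | succ Y ih =>
      have e : twistedSum ArithmeticFunction.log (Y + 1) p - S (Y + 1) * (Real.log (Y + 1 : ℕ) : ℝ) =
          (twistedSum ArithmeticFunction.log Y p - S Y * Real.log Y) -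
            S Y * ((Real.log (Y + 1 : ℕ) - Real.log Y : ℝ) : ℂ) := by
        have h1 := twistedSum_succ (ArithmeticFunction.log : ArithmeticFunction ℝ) Y p
        have h2 : S (Y + 1) = S Y + p.2 ((Y + 1 : ℕ) : ZMod p.1) := by
          have := twistedSum_succ (ζ : ArithmeticFunction ℝ) Y p
          rw [natCoe_apply, zeta_apply_ne (Nat.succ_ne_zero Y)] at this
          simpa [hS] using this
        rw [h1, h2, log_apply]
        push_cast
        ring
      have hmono : Real.log Y ≤ Real.log (Y + 1 : ℕ) := by
        rcases Nat.eq_zero_or_pos Y with rfl | h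
        · simp
        · exact Real.log_le_log (by exact_mod_cast h) (by exact_mod_cast Nat.le_succ Y)
      rw [e]
      refine (norm_sub_le _ _).trans ?_
      rw [norm_mul, Complex.norm_real, Real.norm_of_nonneg (by linarith)]
      have := mul_le_mul_of_nonneg_right (hB Y) (sub_nonneg.2 hmono)
      linarith
  have h0 : 0 ≤ Real.log (Y : ℝ) := Real.log_natCast_nonneg Y
  have : twistedSum ArithmeticFunction.log Y p = (twistedSum ArithmeticFunction.log Y p - S Y * Real.log Y) + S Y * Real.log Y := by ring
  rw [this]
  refine (norm_add_le _ _).trans ?_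
  rw [norm_mul, Complex.norm_real, Real.norm_of_nonneg h0]
  have := mul_le_mul_of_nonneg_right (hB Y) h0
  linarith

theorem norm_twistedSum_zeta_le {p : Σ q : ℕ, DirichletCharacter ℂ q} (hp : 2 ≤ p.1)
    (hprim : p.2.IsPrimitive) (Y : ℕ) :
    ‖twistedSum (ζ : ArithmeticFunction ℝ) Y p‖ ≤ √p.1 * (1 + Real.log p.1) := by
  have h := polya_vinogradov hp hprim (Y + 1)
  have : Fact (1 < p.1) := ⟨hp⟩
  rw [range_eq_Ico, sum_eq_sum_Ico_succ_bot (by omega), Nat.cast_zero, MulChar.map_zero,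
    zero_add] at h
  refine le_trans (le_of_eq ?_) h
  congr 1
  refine sum_congr rfl fun n hn => ?_
  rw [natCoe_apply, zeta_apply_ne (by have := (mem_Icc.1 hn).1; omega)]
  simp

theorem sum_abs_mul_le (f g : ArithmeticFunction ℝ) (Y : ℕ) :
    ∑ n ∈ Icc 1 Y, |(f * g) n| ≤ (∑ n ∈ Icc 1 Y, |f n|) * ∑ n ∈ Icc 1 Y, |g n| := by
  calc _ ≤ ∑ n ∈ Icc 1 Y, ∑ i ∈ n.divisorsAntidiagonal, |f i.1| * |g i.2| := by
        refine sum_le_sum fun n _ => ?_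
        rw [mul_apply]
        refine (abs_sum_le_sum_abs _ _).trans (le_of_eq ?_)
        simp only [abs_mul]
    _ ≤ ∑ i ∈ Icc 1 Y ×ˢ Icc 1 Y, |f i.1| * |g i.2| := by
        rw [sum_divisorsAntidiagonal_eq Y (fun a b => |f a| * |g b|)]
        exact sum_le_sum_of_subset_of_nonneg (filter_subset _ _) fun _ _ _ => by positivity
    _ = _ := by rw [sum_mul_sum, ← sum_product']

theorem sum_abs_lowPart_vonMangoldt_le (U Y : ℕ) :
    ∑ n ∈ Icc 1 Y, |lowPart vonMangoldt U n| ≤ 6 * (U : ℝ) := by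
  refine le_trans ?_ (sum_vonMangoldt_le U)
  calc _ = ∑ n ∈ Icc 1 Y with n ≤ U, Λ n := by
        rw [sum_filter]
        refine sum_congr rfl fun n _ => ?_
        rw [lowPart_apply]
        split_ifs
        · exact abs_of_nonneg vonMangoldt_nonneg
        · exact abs_zero
    _ ≤ _ := by
        refine sum_le_sum_of_subset_of_nonneg ?_ fun _ _ _ => vonMangoldt_nonneg
        intro n hn
        simp only [mem_filter, mem_Icc] at hn ⊢
        omega

theorem sum_abs_le_of_support {lam : ArithmeticFunction ℝ} (h1 : ∀ d, |lam d| ≤ 1) {V : ℕ}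
    (hV : ∀ d, V < d → lam d = 0) (Y : ℕ) : ∑ n ∈ Icc 1 Y, |lam n| ≤ V := by
  calc _ = ∑ n ∈ Icc 1 Y with n ≤ V, |lam n| := by
        rw [sum_filter]
        refine sum_congr rfl fun n _ => ?_
        split_ifs with h
        · rfl
        · rw [hV n (by omega), abs_zero]
    _ ≤ ∑ n ∈ Icc 1 V, |lam n| := by
        refine sum_le_sum_of_subset_of_nonneg ?_ fun _ _ _ => abs_nonneg _
        intro n hn
        simp only [mem_filter, mem_Icc] at hn ⊢
        omega
    _ ≤ ∑ n ∈ Icc 1 V, (1 : ℝ) := sum_le_sum fun n _ => h1 n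
    _ = _ := by simp

/-- The linear-sum part of the decomposition is controlled by the Pólya–Vinogradov inequality. -/
theorem norm_twistedSum_vonMangoldt_le {lam : ArithmeticFunction ℝ} (h1 : ∀ d, |lam d| ≤ 1)
    {U V : ℕ} (hV : ∀ d, V < d → lam d = 0) {p : Σ q : ℕ, DirichletCharacter ℂ q} (hp : 2 ≤ p.1)
    (hprim : p.2.IsPrimitive) (Y : ℕ) :
    ‖twistedSum vonMangoldt Y p‖ ≤ 6 * U + √p.1 * (1 + Real.log p.1) *
      (2 * V * Real.log Y + 6 * U * V) +
      ‖twistedSum (highPart vonMangoldt U * (lam * ζ - 1)) Y p‖ := by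
  set P := √p.1 * (1 + Real.log p.1)
  have hP : ∀ y, ‖twistedSum (ζ : ArithmeticFunction ℝ) y p‖ ≤ P := norm_twistedSum_zeta_le hp hprim
  have hP0 : 0 ≤ P := (norm_nonneg _).trans (hP 0)
  have hlog0 : 0 ≤ Real.log (Y : ℝ) := Real.log_natCast_nonneg Y
  have t1 : ‖twistedSum (lowPart vonMangoldt U) Y p‖ ≤ 6 * U :=
    (norm_twistedSum_le _ _ _).trans (sum_abs_lowPart_vonMangoldt_le U Y)
  have t2 : ‖twistedSum (lam * ArithmeticFunction.log) Y p‖ ≤ 2 * P * Real.log Y * V := by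
    refine (norm_twistedSum_mul_le lam ArithmeticFunction.log Y p (B := 2 * P * Real.log Y) fun y hy => ?_).trans ?_
    · refine (norm_twistedSum_log_le p hP y).trans ?_
      rcases Nat.eq_zero_or_pos y with rfl | h
      · rw [Nat.cast_zero, Real.log_zero, mul_zero]; positivity
      · gcongr
    · gcongr
      exact sum_abs_le_of_support h1 hV Y
  have t3 : ‖twistedSum (lowPart vonMangoldt U * lam * ζ) Y p‖ ≤ P * (6 * U * V) := by
    refine (norm_twistedSum_mul_le _ _ Y p fun y _ => hP y).trans ?_
    gcongr
    refine (sum_abs_mul_le _ _ Y).trans ?_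
    exact mul_le_mul (sum_abs_lowPart_vonMangoldt_le U Y) (sum_abs_le_of_support h1 hV Y)
      (sum_nonneg fun _ _ => abs_nonneg _) (by positivity)
  conv_lhs => rw [vonMangoldt_eq_mollified lam U]
  rw [twistedSum_sub, twistedSum_sub, twistedSum_add]
  refine (norm_sub_le _ _).trans ?_
  gcongr
  refine (norm_sub_le _ _).trans ?_
  have := norm_add_le (twistedSum (lowPart vonMangoldt U) Y p) (twistedSum (lam * ArithmeticFunction.log) Y p)
  linarith

end Vaughan

/-! ### The bilinear sums -/

section TypeTwo
open ArithmeticFunction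

/-- The restriction of a sequence to the dyadic block `2 ^ k ≤ m < 2 ^ (k + 1)`. -/
noncomputable def dyadicBlock (f : ℕ → ℝ) (k m : ℕ) : ℂ := if Nat.log 2 m = k then (f m : ℂ) else 0

/-- In the block `2 ^ k ≤ m < 2 ^ (k + 1)` the other variable is at most `x / 2 ^ k`, so each block
lies in a box of area at most `2x`, independently of `Y`. -/
theorem twistedSum_eq_sum_hyperbolaSum (f g : ArithmeticFunction ℝ) {x : ℝ} {Y : ℕ}
    (hY : (Y : ℝ) ≤ x) (p : Σ q : ℕ, DirichletCharacter ℂ q) :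
    twistedSum (f * g) Y p = ∑ k ∈ range (Nat.log 2 ⌊x⌋₊ + 1),
      hyperbolaSum (dyadicBlock f k) (fun n => (g n : ℂ)) (2 ^ (k + 1)) ⌊x / 2 ^ k⌋₊ Y p := by
  have hk : ∀ k, hyperbolaSum (dyadicBlock f k) (fun n => (g n : ℂ)) (2 ^ (k + 1)) ⌊x / 2 ^ k⌋₊ Y p =
      ∑ i ∈ Icc 1 Y ×ˢ Icc 1 Y with i.1 * i.2 ≤ Y, if Nat.log 2 i.1 = k then
        (f i.1 : ℂ) * g i.2 * p.2 ((i.1 * i.2 : ℕ) : ZMod p.1) else 0 := by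
    intro k
    rw [← sum_filter]
    have e : ∀ i : ℕ × ℕ, dyadicBlock f k i.1 * (g i.2 : ℂ) * p.2 ((i.1 * i.2 : ℕ) : ZMod p.1) =
        if Nat.log 2 i.1 = k then (f i.1 : ℂ) * g i.2 * p.2 ((i.1 * i.2 : ℕ) : ZMod p.1) else 0 := by
      intro i
      rw [dyadicBlock]
      split_ifs <;> simp
    rw [hyperbolaSum, sum_congr rfl fun i _ => e i, ← sum_filter]
    refine sum_congr ?_ fun _ _ => rfl
    ext ⟨m, n⟩
    simp only [mem_filter, mem_product, mem_Icc]
    constructor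
    · rintro ⟨⟨⟨⟨h1, -⟩, h2, -⟩, h3⟩, h4⟩
      refine ⟨⟨⟨⟨h1, ?_⟩, h2, ?_⟩, h3⟩, h4⟩
      · exact (Nat.le_mul_of_pos_right m h2).trans h3
      · exact (Nat.le_mul_of_pos_left n h1).trans h3
    · rintro ⟨⟨⟨⟨h1, -⟩, h2, -⟩, h3⟩, h4⟩
      have hm1 : 2 ^ k ≤ m := by rw [← h4]; exact Nat.pow_log_le_self 2 (by omega)
      have hm2 : m < 2 ^ (k + 1) := by rw [← h4]; exact Nat.lt_pow_succ_log_self (by norm_num) m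
      refine ⟨⟨⟨⟨h1, hm2.le⟩, h2, Nat.le_floor ?_⟩, h3⟩, h4⟩
      rw [le_div_iff₀ (by positivity)]
      have : n * 2 ^ k ≤ Y := by
        calc n * 2 ^ k ≤ n * m := Nat.mul_le_mul_left n hm1
          _ = m * n := mul_comm _ _
          _ ≤ Y := h3
      have h5 : (n : ℝ) * 2 ^ k ≤ Y := by exact_mod_cast this
      linarith
  simp_rw [hk]
  rw [sum_comm, twistedSum_mul]
  refine sum_congr rfl fun i hi => ?_
  rw [sum_ite_eq, if_pos]
  simp only [mem_filter, mem_product, mem_Icc] at hi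
  rw [mem_range, Nat.lt_succ_iff]
  refine Nat.log_mono_right (hi.1.1.2.trans (Nat.le_floor hY))

theorem sum_sq_dyadicBlock_le (U k : ℕ) :
    ∑ m ∈ Icc 1 (2 ^ (k + 1)), ‖dyadicBlock (highPart vonMangoldt U) k m‖ ^ 2 ≤
      Real.log (2 ^ (k + 1)) * (6 * 2 ^ (k + 1)) := by
  calc _ ≤ ∑ m ∈ Icc 1 (2 ^ (k + 1)), Real.log (2 ^ (k + 1)) * Λ m := by
        refine sum_le_sum fun m hm => ?_
        have h1 : (0 : ℝ) < m := by exact_mod_cast (mem_Icc.1 hm).1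
        have h2 : Real.log m ≤ Real.log (2 ^ (k + 1)) :=
          Real.log_le_log h1 (by exact_mod_cast (mem_Icc.1 hm).2)
        have h3 : Λ m ≤ Real.log (2 ^ (k + 1)) := vonMangoldt_le_log.trans h2
        have h4 : ‖dyadicBlock (highPart vonMangoldt U) k m‖ ≤ Λ m := by
          rw [dyadicBlock, highPart_apply]
          split_ifs
          · simp
          · rw [Complex.norm_real, Real.norm_of_nonneg vonMangoldt_nonneg]
          · simp
        calc _ ≤ Λ m ^ 2 := by gcongr
          _ = Λ m * Λ m := sq _
          _ ≤ _ := mul_le_mul_of_nonneg_right h3 vonMangoldt_nonneg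
    _ ≤ _ := by
        rw [← mul_sum]
        have := sum_vonMangoldt_le (2 ^ (k + 1))
        push_cast at this
        gcongr
        exact Real.log_nonneg (one_le_pow₀ (by norm_num))

/-- One block in real numbers. The factor `L` from the mean square of `Λ` cancels the `1 / L` from
the mollified sequence, so no logarithm remains. The cross terms `M R²` and `N R²` use that both
side lengths are at most `2x / U`. -/
theorem sqrt_block_le {x R M N U D L : ℝ} (hx : 0 ≤ x) (hR : 0 ≤ R) (hM : 0 ≤ M) (hN : 0 ≤ N)
    (hU : 0 < U) (hD : 0 ≤ D) (hL : 0 < L) (hMN : M * N ≤ 2 * x) (hMU : M * U ≤ 2 * x)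
    (hNU : N * U ≤ 2 * x) :
    √((M + R ^ 2) * (2 * L * (6 * M))) * √((N + R ^ 2) * (D * N / L)) ≤
      √(96 * D) * (x + x * R / √U + √x * R ^ 2) := by
  set B := x + x * R / √U + √x * R ^ 2 with hB
  have hB0 : 0 ≤ B := by positivity
  rw [← Real.sqrt_mul (by positivity)]
  have e : √(96 * D) * B = √(96 * D * B ^ 2) := by
    rw [Real.sqrt_mul' _ (sq_nonneg B), Real.sqrt_sq hB0]
  rw [e]
  refine Real.sqrt_le_sqrt ?_
  have e2 : (M + R ^ 2) * (2 * L * (6 * M)) * ((N + R ^ 2) * (D * N / L)) =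
      12 * D * (((M + R ^ 2) * (N + R ^ 2)) * (M * N)) := by field_simp; ring
  have hM' : M ≤ 2 * x / U := by rwa [le_div_iff₀ hU]
  have hN' : N ≤ 2 * x / U := by rwa [le_div_iff₀ hU]
  have h1 : (M + R ^ 2) * (N + R ^ 2) ≤ 2 * x + 4 * x / U * R ^ 2 + R ^ 4 := by
    have hR2 : 0 ≤ R ^ 2 := by positivity
    have h3 := mul_le_mul_of_nonneg_right hM' hR2
    have h4 := mul_le_mul_of_nonneg_right hN' hR2
    have e3 : 4 * x / U * R ^ 2 = 2 * x / U * R ^ 2 + 2 * x / U * R ^ 2 := by ring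
    rw [e3]
    nlinarith
  have h2 : (2 * x + 4 * x / U * R ^ 2 + R ^ 4) * (2 * x) ≤ 8 * B ^ 2 := by
    have hs : (x * R / √U) ^ 2 = x ^ 2 * R ^ 2 / U := by
      rw [div_pow, mul_pow, Real.sq_sqrt hU.le]
    have hs2 : (√x * R ^ 2) ^ 2 = x * R ^ 4 := by
      rw [mul_pow, Real.sq_sqrt hx]; ring
    have hb : x ^ 2 + (x * R / √U) ^ 2 + (√x * R ^ 2) ^ 2 ≤ B ^ 2 := by
      have a1 : 0 ≤ x * R / √U := by positivity
      have a2 : 0 ≤ √x * R ^ 2 := by positivity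
      rw [hB]
      nlinarith [mul_nonneg hx a1, mul_nonneg hx a2, mul_nonneg a1 a2]
    rw [hs, hs2] at hb
    have e4 : (2 * x + 4 * x / U * R ^ 2 + R ^ 4) * (2 * x) =
        4 * x ^ 2 + 8 * (x ^ 2 * R ^ 2 / U) + 2 * (x * R ^ 4) := by ring
    rw [e4]
    have a3 : 0 ≤ x ^ 2 := by positivity
    have a4 : 0 ≤ x * R ^ 4 := by positivity
    linarith
  rw [e2]
  calc _ ≤ 12 * D * ((2 * x + 4 * x / U * R ^ 2 + R ^ 4) * (2 * x)) := by gcongr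
    _ ≤ 12 * D * (8 * B ^ 2) := by gcongr
    _ = _ := by ring

theorem natLog_floor_add_one_le {x : ℝ} (hx : 4 ≤ x) :
    ((Nat.log 2 ⌊x⌋₊ + 1 : ℕ) : ℝ) ≤ 3 * Real.log x := by
  have h1 : ((2 ^ Nat.log 2 ⌊x⌋₊ : ℕ) : ℝ) ≤ x := by
    refine le_trans ?_ (Nat.floor_le (by linarith))
    exact_mod_cast Nat.pow_log_le_self 2 (Nat.floor_pos.2 (by linarith)).ne'
  have h2 := Real.log_le_log (by positivity) h1
  push_cast at h2 ⊢
  rw [Real.log_pow] at h2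
  have h3 := Real.log_two_gt_d9
  have h4 : Real.log 4 ≤ Real.log x := Real.log_le_log (by norm_num) hx
  have h5 : Real.log 4 = 2 * Real.log 2 := by
    rw [show (4 : ℝ) = 2 ^ 2 by norm_num, Real.log_pow]; norm_num
  have h6 : (0 : ℝ) ≤ Nat.log 2 ⌊x⌋₊ := Nat.cast_nonneg _
  nlinarith

theorem type_two_bound {x : ℝ} (hx : 4 ≤ x) {R : ℕ} (hR : 1 ≤ R) {U : ℕ} (hU : 1 ≤ U)
    {b : ArithmeticFunction ℝ} (hb0 : ∀ n, n ≤ U → b n = 0) {D : ℝ} (hD : 0 ≤ D)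
    (hb : ∀ N : ℕ, U < N → (N : ℝ) ≤ x → ∑ n ∈ Icc 1 N, b n ^ 2 ≤ D * N / Real.log x)
    (Y : (Σ q : ℕ, DirichletCharacter ℂ q) → ℕ) (hY : ∀ p, (Y p : ℝ) ≤ x) :
    ∑ p ∈ charPairs R, modulusWeight p * ‖twistedSum (highPart vonMangoldt U * b) (Y p) p‖ ≤
      864 * √(96 * D) * Real.log x ^ 2 * (x + x * R / √U + √x * R ^ 2) := by
  set L := Real.log x with hL
  have hL0 : 0 < L := Real.log_pos (by linarith)
  set B := x + x * R / √U + √x * (R : ℝ) ^ 2 with hB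
  have hB0 : 0 ≤ B := by positivity
  have hblock : ∀ k ∈ range (Nat.log 2 ⌊x⌋₊ + 1), ∑ p ∈ charPairs R, modulusWeight p *
      ‖hyperbolaSum (dyadicBlock (highPart vonMangoldt U) k) (fun n => (b n : ℂ)) (2 ^ (k + 1))
        ⌊x / 2 ^ k⌋₊ (Y p) p‖ ≤ 288 * L * (√(96 * D) * B) := by
    intro k hk
    rw [mem_range, Nat.lt_succ_iff] at hk
    have hRHS : 0 ≤ 288 * L * (√(96 * D) * B) := by positivity
    have h2k : (2 : ℝ) ^ k ≤ x := by
      have h1 : 2 ^ k ≤ ⌊x⌋₊ := (Nat.pow_le_pow_right (by norm_num) hk).trans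
        (Nat.pow_log_le_self 2 (Nat.floor_pos.2 (by linarith)).ne')
      refine le_trans ?_ (Nat.floor_le (by linarith))
      exact_mod_cast h1
    have h2k0 : (0 : ℝ) < 2 ^ k := by positivity
    set N := ⌊x / 2 ^ k⌋₊ with hN
    have hNx : (N : ℝ) * 2 ^ k ≤ x := by
      rw [← le_div_iff₀ h2k0]; exact Nat.floor_le (by positivity)
    -- Both sequences vanish up to `U`, so only blocks whose two sides exceed `U` contribute; this
    -- is where the saving `√U` originates.
    by_cases hNU : N ≤ U
    · refine le_trans (le_of_eq (sum_eq_zero fun p _ => ?_)) hRHS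
      rw [hyperbolaSum, sum_eq_zero, norm_zero, mul_zero]
      intro i hi
      simp only [mem_filter, mem_product, mem_Icc] at hi
      rw [hb0 i.2 (hi.1.2.2.trans hNU)]
      simp
    by_cases hMU : 2 ^ (k + 1) ≤ U
    · refine le_trans (le_of_eq (sum_eq_zero fun p _ => ?_)) hRHS
      rw [hyperbolaSum, sum_eq_zero, norm_zero, mul_zero]
      intro i hi
      simp only [mem_filter, mem_product, mem_Icc] at hi
      have : dyadicBlock (highPart vonMangoldt U) k i.1 = 0 := by
        rw [dyadicBlock, highPart_apply, if_pos (hi.1.1.2.trans hMU)]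
        simp
      rw [this]
      simp
    rw [not_le] at hNU hMU
    have hNU' : (U : ℝ) ≤ N := by exact_mod_cast hNU.le
    have hMU' : (U : ℝ) ≤ 2 ^ (k + 1) := by exact_mod_cast hMU.le
    have hMN : ((2 ^ (k + 1) : ℕ) : ℝ) * N ≤ 2 * x := by
      push_cast
      rw [pow_succ]; linarith
    refine (bilinear_large_sieve hx hR hMN (dyadicBlock (highPart vonMangoldt U) k)
      (fun n => (b n : ℂ)) Y hY).trans ?_
    refine mul_le_mul_of_nonneg_left ?_ (by positivity)
    have hU0 : (0 : ℝ) < U := by exact_mod_cast hU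
    have hN0 : (0 : ℝ) ≤ N := Nat.cast_nonneg N
    refine le_trans ?_ (sqrt_block_le (x := x) (R := R) (M := 2 ^ (k + 1)) (N := N) (U := U) (D := D)
      (L := L) (by linarith) (Nat.cast_nonneg R) (by positivity) hN0 hU0 hD hL0
      (by push_cast at hMN; exact hMN) ?_ ?_)
    · have hlogM : Real.log (2 ^ (k + 1)) ≤ 2 * L := by
        have : Real.log (2 ^ (k + 1)) ≤ Real.log (x ^ 2) := by
          refine Real.log_le_log (by positivity) ?_
          rw [pow_succ]; nlinarith
        refine this.trans (le_of_eq ?_)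
        rw [Real.log_pow]
        norm_num [hL]
      have hNle : (N : ℝ) ≤ x := by
        have : (1 : ℝ) ≤ 2 ^ k := one_le_pow₀ (by norm_num)
        nlinarith
      refine mul_le_mul ?_ ?_ (Real.sqrt_nonneg _) (Real.sqrt_nonneg _)
      · refine Real.sqrt_le_sqrt ?_
        push_cast
        refine mul_le_mul_of_nonneg_left ((sum_sq_dyadicBlock_le U k).trans ?_) (by positivity)
        gcongr
      · refine Real.sqrt_le_sqrt ?_
        refine mul_le_mul_of_nonneg_left ?_ (by positivity)
        simp only [Complex.norm_real, Real.norm_eq_abs, sq_abs]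
        exact hb N hNU hNle
    · calc (2 : ℝ) ^ (k + 1) * U ≤ 2 ^ (k + 1) * N := by gcongr
        _ ≤ 2 * x := by push_cast at hMN; exact hMN
    · calc (N : ℝ) * U ≤ N * 2 ^ (k + 1) := by gcongr
        _ ≤ 2 * x := by push_cast at hMN; linarith
  calc _ ≤ ∑ p ∈ charPairs R, modulusWeight p * ∑ k ∈ range (Nat.log 2 ⌊x⌋₊ + 1),
        ‖hyperbolaSum (dyadicBlock (highPart vonMangoldt U) k) (fun n => (b n : ℂ)) (2 ^ (k + 1))
          ⌊x / 2 ^ k⌋₊ (Y p) p‖ := by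
        refine sum_le_sum fun p _ => mul_le_mul_of_nonneg_left ?_ (modulusWeight_nonneg p)
        rw [twistedSum_eq_sum_hyperbolaSum _ _ (hY p)]
        exact norm_sum_le _ _
    _ = ∑ k ∈ range (Nat.log 2 ⌊x⌋₊ + 1), ∑ p ∈ charPairs R, modulusWeight p *
        ‖hyperbolaSum (dyadicBlock (highPart vonMangoldt U) k) (fun n => (b n : ℂ)) (2 ^ (k + 1))
          ⌊x / 2 ^ k⌋₊ (Y p) p‖ := by
        simp_rw [mul_sum]
        exact sum_comm
    _ ≤ ∑ k ∈ range (Nat.log 2 ⌊x⌋₊ + 1), 288 * L * (√(96 * D) * B) := sum_le_sum hblock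
    _ = ((Nat.log 2 ⌊x⌋₊ + 1 : ℕ) : ℝ) * (288 * L * (√(96 * D) * B)) := by
        rw [sum_const, card_range, nsmul_eq_mul]
    _ ≤ 3 * L * (288 * L * (√(96 * D) * B)) := by
        refine mul_le_mul_of_nonneg_right (natLog_floor_add_one_le hx) (by positivity)
    _ = _ := by ring

end TypeTwo

/-! ### Assembly and choice of parameters -/

section MeanValue
open ArithmeticFunction
open scoped ArithmeticFunction.zeta ArithmeticFunction.Moebius

theorem psiChar_eq_twistedSum {q : ℕ} (y : ℝ) (χ : DirichletCharacter ℂ q) :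
    psiChar y χ = twistedSum vonMangoldt ⌊y⌋₊ ⟨q, χ⟩ := rfl

theorem exists_maxPsiChar_eq {x : ℝ} (hx : 0 ≤ x) {q : ℕ} (χ : DirichletCharacter ℂ q) :
    ∃ Y : ℕ, (Y : ℝ) ≤ x ∧ maxPsiChar x χ = ‖twistedSum vonMangoldt Y ⟨q, χ⟩‖ := by
  obtain ⟨y, hy, he⟩ := (isGreatest_maxPsiChar x χ).1
  refine ⟨⌊y⌋₊, ?_, ?_⟩
  · rcases le_total 0 y with h | h
    · exact (Nat.floor_le h).trans hy
    · rw [Nat.floor_of_nonpos h]; simpa using hx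
  · rw [← he, ← psiChar_eq_twistedSum]

theorem card_primitiveCharacters_le {q : ℕ} (hq : 1 ≤ q) :
    (primitiveCharacters q).card ≤ q.totient := by
  have : NeZero q := ⟨by omega⟩
  rw [← DirichletCharacter.card_eq_totient_of_hasEnoughRootsOfUnity ℂ q, Nat.card_eq_fintype_card]
  exact card_le_univ _

theorem sum_modulusWeight_le (R : ℕ) : ∑ p ∈ charPairs R, modulusWeight p ≤ (R : ℝ) ^ 2 := by
  have h := sum_charPairs R (fun _ => 1)
  simp only [mul_one, sum_const, nsmul_eq_mul] at h
  rw [h]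
  calc _ ≤ ∑ q ∈ Icc 1 R, (R : ℝ) := by
        refine sum_le_sum fun q hq => ?_
        rw [mem_Icc] at hq
        have hφ : (0 : ℝ) < q.totient := by exact_mod_cast Nat.totient_pos.2 hq.1
        have h1 : ((primitiveCharacters q).card : ℝ) ≤ q.totient := by
          exact_mod_cast card_primitiveCharacters_le hq.1
        calc _ ≤ (q : ℝ) / q.totient * q.totient := by gcongr
          _ = q := div_mul_cancel₀ _ hφ.ne'
          _ ≤ R := by exact_mod_cast hq.2
    _ = _ := by simp [sq]

theorem sum_modulusWeight_one_le (R : ℕ) :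
    ∑ p ∈ charPairs R, modulusWeight p * (if p.1 = 1 then (1 : ℝ) else 0) ≤ 1 := by
  rw [sum_charPairs R (fun p => if p.1 = 1 then (1 : ℝ) else 0)]
  have h1 : ∀ q ∈ Icc 1 R, (q : ℝ) / q.totient * ∑ χ ∈ primitiveCharacters q,
      (if q = 1 then (1 : ℝ) else 0) ≤ if q = 1 then 1 else 0 := by
    intro q _
    split_ifs with h
    · subst h
      have := card_primitiveCharacters_le (le_refl 1)
      simp only [sum_const, nsmul_eq_mul, mul_one, Nat.totient_one, Nat.cast_one, div_one, one_mul] at this ⊢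
      exact_mod_cast this
    · simp
  refine (sum_le_sum h1).trans ?_
  rw [sum_ite_eq']
  split_ifs <;> norm_num

/-- Once `R² ≥ x` the sieve factor is dominated by `R²`, so no decomposition of `Λ` is needed: a
bilinear form with `m = 1` alone suffices, the trivial variable serving only to handle the maximum.
-/
theorem mean_value_of_large_modulus {x : ℝ} (hx : 4 ≤ x) {R : ℕ} (hR : 1 ≤ R)
    (hRx : x ≤ (R : ℝ) ^ 2) (Y : (Σ q : ℕ, DirichletCharacter ℂ q) → ℕ) (hY : ∀ p, (Y p : ℝ) ≤ x) :
    ∑ p ∈ charPairs R, modulusWeight p * ‖twistedSum vonMangoldt (Y p) p‖ ≤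
      1440 * ((R : ℝ) ^ 2 * √x * Real.log x ^ 2) := by
  set L := Real.log x with hL
  have hL1 : 1 ≤ L := by
    rw [hL, Real.le_log_iff_exp_le (by linarith)]
    have := Real.exp_one_lt_d9
    linarith
  have hfl : (⌊x⌋₊ : ℝ) ≤ x := Nat.floor_le (by linarith)
  have e : ∀ p, twistedSum vonMangoldt (Y p) p =
      hyperbolaSum (fun _ => 1) (fun n => (Λ n : ℂ)) 1 ⌊x⌋₊ (Y p) p := by
    intro p
    have hYx : Y p ≤ ⌊x⌋₊ := Nat.le_floor (hY p)
    rw [hyperbolaSum, twistedSum, sum_filter, sum_product, Icc_self, sum_singleton, ← sum_filter]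
    simp only [one_mul]
    refine sum_congr ?_ fun _ _ => rfl
    ext n
    simp only [mem_filter, mem_Icc]
    omega
  simp_rw [e]
  refine (bilinear_large_sieve hx hR (by push_cast; linarith) _ _ Y hY).trans ?_
  have hR1 : (1 : ℝ) ≤ (R : ℝ) ^ 2 := by exact_mod_cast Nat.one_le_pow _ _ hR
  have hsq : ∑ n ∈ Icc 1 ⌊x⌋₊, ‖(Λ n : ℂ)‖ ^ 2 ≤ L * (6 * x) := by
    calc _ ≤ ∑ n ∈ Icc 1 ⌊x⌋₊, L * Λ n := by
          refine sum_le_sum fun n hn => ?_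
          rw [mem_Icc] at hn
          have h1 : (0 : ℝ) < n := by exact_mod_cast hn.1
          have h2 : (n : ℝ) ≤ x := le_trans (by exact_mod_cast hn.2) hfl
          rw [Complex.norm_real, Real.norm_of_nonneg vonMangoldt_nonneg, sq]
          exact mul_le_mul_of_nonneg_right (vonMangoldt_le_log.trans (Real.log_le_log h1 h2))
            vonMangoldt_nonneg
      _ ≤ _ := by
          rw [← mul_sum]
          refine mul_le_mul_of_nonneg_left ((sum_vonMangoldt_le _).trans ?_) (by linarith)
          linarith
  have h1 : √(((1 : ℕ) + (R : ℝ) ^ 2) * ∑ n ∈ Icc 1 1, ‖(1 : ℂ)‖ ^ 2) ≤ √(2 * (R : ℝ) ^ 2) := by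
    refine Real.sqrt_le_sqrt ?_
    simp
    linarith
  have h2 : √((⌊x⌋₊ + (R : ℝ) ^ 2) * ∑ n ∈ Icc 1 ⌊x⌋₊, ‖(Λ n : ℂ)‖ ^ 2) ≤
      √(2 * (R : ℝ) ^ 2 * (L ^ 2 * (6 * x))) := by
    refine Real.sqrt_le_sqrt ?_
    refine mul_le_mul (by linarith) (hsq.trans ?_) (by positivity) (by positivity)
    gcongr
    nlinarith
  have h3 : √(2 * (R : ℝ) ^ 2) * √(2 * (R : ℝ) ^ 2 * (L ^ 2 * (6 * x))) ≤
      5 * (L * ((R : ℝ) ^ 2 * √x)) := by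
    rw [← Real.sqrt_mul (by positivity)]
    refine Real.sqrt_le_iff.2 ⟨by positivity, ?_⟩
    have hsx : √x ^ 2 = x := Real.sq_sqrt (by linarith)
    have : (5 * (L * ((R : ℝ) ^ 2 * √x))) ^ 2 = 25 * (L ^ 2 * ((R : ℝ) ^ 4 * x)) := by
      rw [← hsx, Real.sqrt_sq (Real.sqrt_nonneg x)]; ring
    rw [this]
    have h5 : 0 ≤ L ^ 2 * ((R : ℝ) ^ 4 * x) := by positivity
    linarith
  calc _ ≤ 288 * L * (5 * (L * ((R : ℝ) ^ 2 * √x))) := by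
        refine mul_le_mul_of_nonneg_left ?_ (by positivity)
        exact (mul_le_mul h1 h2 (by positivity) (by positivity)).trans h3
    _ = _ := by ring

/-- The mollifier `d ↦ μ(d) H(log d / L - u)`. -/
noncomputable def smoothMoebius (H : ℝ → ℝ) (L u : ℝ) : ArithmeticFunction ℝ :=
  ⟨fun d => (μ d : ℝ) * H (Real.log d / L - u), by simp⟩

theorem smoothMoebius_apply (H : ℝ → ℝ) (L u : ℝ) (d : ℕ) :
    smoothMoebius H L u d = (μ d : ℝ) * H (Real.log d / L - u) := rfl

/-- For `n ≤ x^u` every divisor lies where the cutoff equals 1, so the convolution is `μ * 1`, the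
identity. -/
theorem smoothMoebius_mul_zeta_sub_one_eq_zero {H : ℝ → ℝ} (hH1 : ∀ t, -1 ≤ t → t ≤ 0 → H t = 1)
    {x u : ℝ} (hx : 1 < x) (hu1 : u ≤ 1) {n : ℕ} (hn : n ≤ ⌊x ^ u⌋₊) :
    (smoothMoebius H (Real.log x) u * ζ - 1) n = 0 := by
  rcases Nat.eq_zero_or_pos n with rfl | hn0
  · simp
  have hL : 0 < Real.log x := Real.log_pos hx
  have h1 : (smoothMoebius H (Real.log x) u * ζ) n = ((μ * ζ : ArithmeticFunction ℤ) n : ℝ) := by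
    rw [coe_mul_zeta_apply, coe_mul_zeta_apply]
    push_cast
    refine sum_congr rfl fun d hd => ?_
    have hd0 : 0 < d := Nat.pos_of_mem_divisors hd
    have hdx : (d : ℝ) ≤ x ^ u :=
      (Nat.le_floor_iff (by positivity)).1 ((Nat.divisor_le hd).trans hn)
    have hlog0 : 0 ≤ Real.log d := Real.log_natCast_nonneg d
    have hlog : Real.log d ≤ u * Real.log x := by
      have := Real.log_le_log (by exact_mod_cast hd0) hdx
      rwa [Real.log_rpow (by linarith)] at this
    rw [smoothMoebius_apply, hH1, mul_one]
    · have : 0 ≤ Real.log d / Real.log x := by positivity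
      linarith
    · rw [sub_nonpos, div_le_iff₀ hL]; exact hlog
  rw [sub_eq_add_neg, ArithmeticFunction.add_apply, h1, moebius_mul_coe_zeta]
  change _ + -((1 : ArithmeticFunction ℝ) n) = 0
  rw [one_apply, one_apply]
  split_ifs <;> simp

theorem abs_smoothMoebius_le {H : ℝ → ℝ} (hH : ∀ t, 0 ≤ H t ∧ H t ≤ 1) (L u : ℝ) (d : ℕ) :
    |smoothMoebius H L u d| ≤ 1 := by
  rw [smoothMoebius_apply, abs_mul, abs_of_nonneg (hH _).1]
  have h1 : |(μ d : ℝ)| ≤ 1 := by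
    rw [← Int.cast_abs]
    exact_mod_cast abs_moebius_le_one
  exact mul_le_one₀ h1 (hH _).1 (hH _).2

theorem smoothMoebius_eq_zero {H : ℝ → ℝ} {η : ℝ} (hH0 : ∀ t, η ≤ t → H t = 0) {x u : ℝ}
    (hx : 1 < x) {d : ℕ} (hd : ⌊x ^ (u + η)⌋₊ < d) : smoothMoebius H (Real.log x) u d = 0 := by
  have h1 : x ^ (u + η) < d := (Nat.floor_lt (by positivity)).1 hd
  have h2 := Real.log_lt_log (by positivity) h1
  rw [Real.log_rpow (by linarith), ← lt_div_iff₀ (Real.log_pos hx)] at h2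
  rw [smoothMoebius_apply, hH0, mul_zero]
  linarith

theorem exists_mean_value_mollified {η : ℝ} (hη : 0 < η) : ∃ C : ℝ, 0 < C ∧
    ∀ (x u : ℝ) (R : ℕ), 4 ≤ x → 1 / 10 ≤ u → u ≤ 1 → 1 ≤ R → (R : ℝ) ≤ x →
    ∀ Y : (Σ q : ℕ, DirichletCharacter ℂ q) → ℕ, (∀ p, (Y p : ℝ) ≤ x) →
    ∑ p ∈ charPairs R, modulusWeight p * ‖twistedSum vonMangoldt (Y p) p‖ ≤
      C * Real.log x ^ 2 * (x + √x * (R : ℝ) ^ 2 + R * x ^ (1 - u / 2) +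
        (R : ℝ) ^ 2 * √R * x ^ (2 * u + η)) := by
  obtain ⟨H, C, hC, hH, hH1, hH0, hmean⟩ := exists_smoothed_moebius hη
  set E := 864 * √(96 * (10 * C)) with hE
  have hE0 : 0 ≤ E := by positivity
  refine ⟨28 + 2 * E, by positivity, fun x u R hx hu hu1 hR hRx Y hY => ?_⟩
  set L := Real.log x with hL
  have hL1 : 1 ≤ L := by
    rw [hL, Real.le_log_iff_exp_le (by linarith)]
    have := Real.exp_one_lt_d9
    linarith
  have hx0 : 0 < x := by linarith
  have hx1 : 1 < x := by linarith
  set lam := smoothMoebius H L u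
  set U := ⌊x ^ u⌋₊ with hUdef
  set V := ⌊x ^ (u + η)⌋₊ with hVdef
  have hxu1 : 1 ≤ x ^ u := Real.one_le_rpow hx1.le (by linarith)
  have hU : 1 ≤ U := (Nat.one_le_floor_iff _).2 hxu1
  have hV : 1 ≤ V := (Nat.one_le_floor_iff _).2 (Real.one_le_rpow hx1.le (by linarith))
  have hU' : (1 : ℝ) ≤ U := by exact_mod_cast hU
  have hV' : (1 : ℝ) ≤ V := by exact_mod_cast hV
  have hUx : (U : ℝ) ≤ x ^ u := Nat.floor_le (by positivity)
  have hVx : (V : ℝ) ≤ x ^ (u + η) := Nat.floor_le (by positivity)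
  have hR' : (1 : ℝ) ≤ R := by exact_mod_cast hR
  have hb0 : ∀ n, n ≤ U → (lam * ζ - 1 : ArithmeticFunction ℝ) n = 0 := fun n hn =>
    smoothMoebius_mul_zeta_sub_one_eq_zero hH1 hx1 hu1 hn
  have hb : ∀ N : ℕ, U < N → (N : ℝ) ≤ x →
      ∑ n ∈ Icc 1 N, (lam * ζ - 1 : ArithmeticFunction ℝ) n ^ 2 ≤ 10 * C * N / L := by
    intro N hUN hNx
    have hN1 : 1 ≤ N := by omega
    have hN0 : (0 : ℝ) < N := by exact_mod_cast hN1
    -- The lower bound `u ≥ 1/10` is used here: it makes `log N` comparable with `log x` throughout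
    -- the range `N > U`, and accounts for the factor 10.
    have hlogN : L / 10 ≤ Real.log N := by
      have h1 : x ^ u ≤ N := ((Nat.floor_lt (by positivity)).1 hUN).le
      have h2 := Real.log_le_log (by positivity) h1
      rw [Real.log_rpow hx0] at h2
      nlinarith
    have h := hmean N L u hN1 (by linarith) (Real.log_le_log hN0 hNx)
    set S := ∑ n ∈ Icc 1 N, (∑ d ∈ n.divisors, (μ d : ℝ) * H (Real.log d / L - u)) ^ 2 with hS
    have hS0 : 0 ≤ S := by positivity
    have h2 : ∑ n ∈ Icc 1 N, (lam * ζ - 1 : ArithmeticFunction ℝ) n ^ 2 ≤ S := by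
      refine sum_le_sum fun n hn => ?_
      by_cases hnU : n ≤ U
      · rw [hb0 n hnU, zero_pow two_ne_zero]; positivity
      · have hn1 : n ≠ 1 := by omega
        have e : (lam * ζ - 1 : ArithmeticFunction ℝ) n =
            ∑ d ∈ n.divisors, (μ d : ℝ) * H (Real.log d / L - u) := by
          rw [sub_eq_add_neg, ArithmeticFunction.add_apply, coe_mul_zeta_apply]
          change _ + -((1 : ArithmeticFunction ℝ) n) = _
          rw [one_apply_ne hn1, neg_zero, add_zero]
          rfl
        rw [e]
    rw [le_div_iff₀ (by linarith)]
    nlinarith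
  have h2 := type_two_bound hx hR hU hb0 (D := 10 * C) (by positivity) hb Y hY
  set T := 6 * (U : ℝ) + √R * (2 * L) * (2 * V * L + 6 * U * V) with hT
  have hpt : ∀ p ∈ charPairs R, ‖twistedSum vonMangoldt (Y p) p‖ ≤
      6 * x * (if p.1 = 1 then 1 else 0) + T +
        ‖twistedSum (highPart vonMangoldt U * (lam * ζ - 1)) (Y p) p‖ := by
    intro p hp
    rw [mem_charPairs] at hp
    have hT0 : 0 ≤ T := by positivity
    have hn0 := norm_nonneg (twistedSum (highPart vonMangoldt U * (lam * ζ - 1)) (Y p) p)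
    -- There is no cancellation modulo 1; the trivial bound is affordable, as the total weight of
    -- modulus 1 is at most 1.
    by_cases hp1 : p.1 = 1
    · rw [if_pos hp1]
      have h3 : ‖twistedSum vonMangoldt (Y p) p‖ ≤ 6 * x := by
        refine (norm_twistedSum_le _ _ _).trans ?_
        simp only [abs_of_nonneg vonMangoldt_nonneg]
        refine (sum_vonMangoldt_le _).trans ?_
        have := hY p
        linarith
      linarith
    · rw [if_neg hp1, mul_zero, zero_add]
      have hq : 2 ≤ p.1 := by have := hp.1.1; omega
      refine (norm_twistedSum_vonMangoldt_le (abs_smoothMoebius_le hH L u) (U := U) (V := V)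
        (fun d hd => smoothMoebius_eq_zero hH0 hx1 hd) hq hp.2 (Y p)).trans ?_
      have hq0 : (0 : ℝ) < p.1 := by exact_mod_cast hp.1.1
      have hqR : (p.1 : ℝ) ≤ R := by exact_mod_cast hp.1.2
      have hlq : Real.log p.1 ≤ L := Real.log_le_log hq0 (hqR.trans hRx)
      have hlq0 : 0 ≤ Real.log p.1 := Real.log_natCast_nonneg _
      have hlY : Real.log (Y p) ≤ L := by
        rcases Nat.eq_zero_or_pos (Y p) with h | h
        · rw [h, Nat.cast_zero, Real.log_zero]; linarith
        · exact Real.log_le_log (by exact_mod_cast h) (hY p)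
      have hlY0 : 0 ≤ Real.log (Y p) := Real.log_natCast_nonneg _
      rw [hT]
      gcongr
      linarith
  have hTle : T ≤ 22 * (√R * x ^ (2 * u + η) * L ^ 2) := by
    have hsR : 1 ≤ √(R : ℝ) := Real.one_le_sqrt.2 hR'
    have hUV : (U : ℝ) * V ≤ x ^ (2 * u + η) := by
      calc (U : ℝ) * V ≤ x ^ u * x ^ (u + η) := by gcongr
        _ = _ := by rw [← Real.rpow_add hx0]; ring_nf
    have hL2 : 1 ≤ L ^ 2 := one_le_pow₀ hL1
    have a1 : (U : ℝ) ≤ √R * (U * V) * L ^ 2 := by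
      calc (U : ℝ) = 1 * (U * 1) * 1 := by ring
        _ ≤ _ := by gcongr
    have a2 : √R * (V * L) * L ≤ √R * (U * V) * L ^ 2 := by
      calc √R * (V * L) * L = √R * (1 * V) * L ^ 2 := by ring
        _ ≤ _ := by gcongr
    have a3 : √R * (U * V) * L ≤ √R * (U * V) * L ^ 2 := by
      gcongr
      nlinarith
    have a4 : √R * (U * V) * L ^ 2 ≤ √R * x ^ (2 * u + η) * L ^ 2 := by gcongr
    rw [hT]
    nlinarith
  have hinvU : x * R / √U ≤ 2 * (R * x ^ (1 - u / 2)) := by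
    have h3 : x ^ u ≤ 4 * U := by
      have := Nat.lt_floor_add_one (x ^ u)
      rw [← hUdef] at this
      linarith
    have h4 : x ^ (u / 2) ≤ 2 * √U := by
      have h5 : √(x ^ u) ≤ √(4 * U) := Real.sqrt_le_sqrt h3
      rw [Real.sqrt_mul (by norm_num), show (4 : ℝ) = 2 ^ 2 by norm_num, Real.sqrt_sq (by norm_num),
        Real.sqrt_eq_rpow, ← Real.rpow_mul hx0.le] at h5
      rwa [show u * (1 / 2) = u / 2 by ring] at h5
    have h6 : x ^ (1 - u / 2) * x ^ (u / 2) = x := by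
      rw [← Real.rpow_add hx0, sub_add_cancel, Real.rpow_one]
    rw [div_le_iff₀ (Real.sqrt_pos.2 (by linarith))]
    calc x * R = R * x ^ (1 - u / 2) * x ^ (u / 2) := by rw [mul_assoc, h6, mul_comm]
      _ ≤ R * x ^ (1 - u / 2) * (2 * √U) := by gcongr
      _ = _ := by ring
  calc _ ≤ ∑ p ∈ charPairs R, modulusWeight p * (6 * x * (if p.1 = 1 then 1 else 0) + T +
        ‖twistedSum (highPart vonMangoldt U * (lam * ζ - 1)) (Y p) p‖) :=
        sum_le_sum fun p hp => mul_le_mul_of_nonneg_left (hpt p hp) (modulusWeight_nonneg p)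
    _ = 6 * x * ∑ p ∈ charPairs R, modulusWeight p * (if p.1 = 1 then (1 : ℝ) else 0) +
        T * ∑ p ∈ charPairs R, modulusWeight p + ∑ p ∈ charPairs R, modulusWeight p *
        ‖twistedSum (highPart vonMangoldt U * (lam * ζ - 1)) (Y p) p‖ := by
        rw [mul_sum, mul_sum, ← sum_add_distrib, ← sum_add_distrib]
        exact sum_congr rfl fun p _ => by ring
    _ ≤ 6 * x * 1 + 22 * (√R * x ^ (2 * u + η) * L ^ 2) * (R : ℝ) ^ 2 +
        E * L ^ 2 * (x + 2 * (R * x ^ (1 - u / 2)) + √x * (R : ℝ) ^ 2) := by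
        refine add_le_add (add_le_add ?_ ?_) ?_
        · exact mul_le_mul_of_nonneg_left (sum_modulusWeight_one_le R) (by positivity)
        · exact mul_le_mul hTle (sum_modulusWeight_le R)
            (sum_nonneg fun p _ => modulusWeight_nonneg p) (by positivity)
        · refine h2.trans ?_
          gcongr
    _ ≤ _ := by
        have hL2 : 1 ≤ L ^ 2 := one_le_pow₀ hL1
        have b1 : x ≤ L ^ 2 * x := le_mul_of_one_le_left hx0.le hL2
        have b2 : 0 ≤ L ^ 2 * (√x * (R : ℝ) ^ 2) := by positivity
        have b3 : 0 ≤ L ^ 2 * (R * x ^ (1 - u / 2)) := by positivity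
        have b4 : 0 ≤ L ^ 2 * ((R : ℝ) ^ 2 * √R * x ^ (2 * u + η)) := by positivity
        have b5 : 0 ≤ L ^ 2 * x := by positivity
        have c2 := mul_nonneg hE0 b2
        have c3 := mul_nonneg hE0 b3
        have c4 := mul_nonneg hE0 b4
        have c5 := mul_nonneg hE0 b5
        linarith

/-- The choice of the truncation exponent `u` for a modulus bound `R = x ^ θ`. -/
theorem exists_truncation_exponent {θ η ε : ℝ} (hθ : θ ≤ 1 / 2) (hη : η ≤ 1 / 20)
    (hηε : η ≤ ε) (hη0 : 0 ≤ η) : ∃ u, 1 / 10 ≤ u ∧ u ≤ 1 ∧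
      (1 + θ - u / 2 ≤ 2 * θ + 1 / 2 ∨ 1 + θ - u / 2 ≤ θ + (13 / 14 + ε)) ∧
      (5 / 2 * θ + 2 * u + η ≤ 2 * θ + 1 / 2 ∨ 5 / 2 * θ + 2 * u + η ≤ θ + (13 / 14 + ε)) := by
  rcases le_total θ (3 / 7) with h1 | h1
  -- Here `1 - u/2 = 13/14` exactly, and the linear term fits because `3θ/2 ≤ 9/14`, with equality
  -- at `θ = 3/7`.
  · exact ⟨1 / 7, by norm_num, by norm_num, Or.inr (by linarith), Or.inr (by linarith)⟩
  rcases le_total θ (9 / 20) with h2 | h2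
  -- This `u` makes the bilinear term equal to `R² √x`; the linear term needs `5θ/2 ≥ 15/14`, again
  -- the threshold `θ = 3/7`.
  · exact ⟨1 - 2 * θ, by linarith, by linarith, Or.inl (by linarith), Or.inr (by linarith)⟩
  -- Beyond `θ = 9/20` the previous choice would fall below `1/10`. The linear term requires `θ/2 +
  -- 1/5 + η ≤ 1/2`, which at `θ = 1/2` is the condition `η ≤ 1/20`.
  · exact ⟨1 / 10, by norm_num, by norm_num, Or.inl (by linarith), Or.inl (by linarith)⟩

theorem exists_mean_value {ε : ℝ} (hε : 0 < ε) : ∃ C : ℝ, 0 < C ∧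
    ∀ (x : ℝ) (R : ℕ), 4 ≤ x → 1 ≤ R →
    ∀ Y : (Σ q : ℕ, DirichletCharacter ℂ q) → ℕ, (∀ p, (Y p : ℝ) ≤ x) →
    ∑ p ∈ charPairs R, modulusWeight p * ‖twistedSum vonMangoldt (Y p) p‖ ≤
      C * ((x + (R : ℝ) ^ 2 * x ^ (1 / 2 : ℝ) + R * x ^ (13 / 14 + ε)) * Real.log x ^ 2) := by
  set η := min ε (1 / 20) with hη
  have hη0 : 0 < η := lt_min hε (by norm_num)
  obtain ⟨C, hC, hmv⟩ := exists_mean_value_mollified hη0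
  refine ⟨1440 + 3 * C, by positivity, fun x R hx hR Y hY => ?_⟩
  have hx0 : 0 < x := by linarith
  have hx1 : 1 < x := by linarith
  have hR0 : (0 : ℝ) < R := by exact_mod_cast hR
  set L := Real.log x with hL
  have hL0 : 0 < L := Real.log_pos hx1
  set a := (R : ℝ) ^ 2 * x ^ (1 / 2 : ℝ) with ha
  set b := R * x ^ (13 / 14 + ε) with hb
  have ha0 : 0 ≤ a := by positivity
  have hb0 : 0 ≤ b := by positivity
  have hxa : √x * (R : ℝ) ^ 2 = a := by rw [ha, Real.sqrt_eq_rpow, mul_comm]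
  rcases le_total x ((R : ℝ) ^ 2) with hRx | hRx
  · refine (mean_value_of_large_modulus hx hR hRx Y hY).trans ?_
    rw [mul_comm _ (√x), hxa]
    have h1 : a * L ^ 2 ≤ (x + a + b) * L ^ 2 := by gcongr; linarith
    have h2 : 0 ≤ (x + a + b) * L ^ 2 := by positivity
    nlinarith
  · set θ := Real.log R / L with hθdef
    have hRθ : (R : ℝ) = x ^ θ := by
      rw [Real.rpow_def_of_pos hx0, ← hL, hθdef, mul_div_cancel₀ _ hL0.ne', Real.exp_log hR0]
    have hθ : θ ≤ 1 / 2 := by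
      rw [hθdef, div_le_iff₀ hL0]
      have := Real.log_le_log (by positivity) hRx
      rw [Real.log_pow] at this
      push_cast at this
      linarith
    obtain ⟨u, hu1, hu2, h1, h2⟩ := exists_truncation_exponent (ε := ε) hθ (min_le_right _ _)
      (min_le_left _ _) hη0.le
    have hRx' : (R : ℝ) ≤ x := by
      have : (1 : ℝ) ≤ R := by exact_mod_cast hR
      nlinarith
    have eA : a = x ^ (2 * θ + 1 / 2) := by
      rw [ha, hRθ, ← Real.rpow_natCast (x ^ θ) 2, ← Real.rpow_mul hx0.le, ← Real.rpow_add hx0]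
      congr 1
      push_cast
      ring
    have eB : b = x ^ (θ + (13 / 14 + ε)) := by rw [hb, hRθ, ← Real.rpow_add hx0]
    have e1 : R * x ^ (1 - u / 2) ≤ a + b := by
      have e : R * x ^ (1 - u / 2) = x ^ (1 + θ - u / 2) := by
        rw [hRθ, ← Real.rpow_add hx0]; congr 1; ring
      rw [e]
      rcases h1 with h | h
      · have := Real.rpow_le_rpow_of_exponent_le hx1.le h
        linarith
      · have := Real.rpow_le_rpow_of_exponent_le hx1.le h
        linarith
    have e2 : (R : ℝ) ^ 2 * √R * x ^ (2 * u + η) ≤ a + b := by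
      have e : (R : ℝ) ^ 2 * √R * x ^ (2 * u + η) = x ^ (5 / 2 * θ + 2 * u + η) := by
        rw [Real.sqrt_eq_rpow, hRθ, ← Real.rpow_natCast (x ^ θ) 2, ← Real.rpow_mul hx0.le,
          ← Real.rpow_mul hx0.le, ← Real.rpow_add hx0, ← Real.rpow_add hx0]
        congr 1
        push_cast
        ring
      rw [e]
      rcases h2 with h | h
      · have := Real.rpow_le_rpow_of_exponent_le hx1.le h
        linarith
      · have := Real.rpow_le_rpow_of_exponent_le hx1.le h
        linarith
    refine (hmv x u R hx hu1 hu2 hR hRx' Y hY).trans ?_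
    rw [hxa]
    calc _ ≤ C * L ^ 2 * (x + a + (a + b) + (a + b)) := by gcongr
      _ ≤ C * L ^ 2 * (3 * (x + a + b)) := by gcongr; linarith
      _ = 3 * C * ((x + a + b) * L ^ 2) := by ring
      _ ≤ _ := by gcongr; linarith

end MeanValue

end

theorem proposition1 (ε : ℝ) (hε : 0 < ε) :
    ∃ C : ℝ, 0 < C ∧ ∀ x Q : ℝ, 4 ≤ x → 0 < Q →
      ∑ q ∈ Finset.Icc 1 ⌊Q⌋₊,
          (q : ℝ) / (Nat.totient q : ℝ) * ∑ χ ∈ primitiveCharacters q, maxPsiChar x χ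
        ≤ C * ((x + Q ^ 2 * x ^ (1 / 2 : ℝ) + Q * x ^ (13 / 14 + ε : ℝ)) *
            Real.log x ^ 2) := by
  obtain ⟨C, hC, h⟩ := exists_mean_value hε
  refine ⟨C, hC, fun x Q hx hQ => ?_⟩
  have hx0 : 0 ≤ x := by linarith
  rcases Nat.eq_zero_or_pos ⌊Q⌋₊ with h0 | h0
  · rw [h0]
    simp only [zero_lt_one, Finset.Icc_eq_empty_of_lt, Finset.sum_empty]
    positivity
  -- For each character, `Y` is a point at which the maximum is attained.
  choose Y hYx hY using fun p : (Σ q : ℕ, DirichletCharacter ℂ q) => exists_maxPsiChar_eq hx0 p.2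
  have h1 := h x ⌊Q⌋₊ hx h0 Y hYx
  rw [sum_charPairs ⌊Q⌋₊ (fun p => ‖twistedSum ArithmeticFunction.vonMangoldt (Y p) p‖)] at h1
  simp only [← hY] at h1
  refine h1.trans ?_
  have hfl : (⌊Q⌋₊ : ℝ) ≤ Q := Nat.floor_le hQ.le
  gcongr
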